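/- Let $D$ be a finite digraph (loops and multiple edges are allowed) with $n$ vertices, let $T\subseteq V(D)$ and let $r,s\ge 0$ be integers. A strong component of a digraph is a maximal induced subdigraph in which every two vertices are joined by walks in both directions. A set $Z\subseteq V(D)$ is a $(T,r)$-balanced separator of $D$ if every strong component of $D\setminus Z$ contains at most $r$ vertices of $T$. The Balanced Separator problem asks, given $(D,T,r,s)$, for a $(T,r)$-balanced separator $Z$ with $|Z|\le s$, or for the answer that no such set exists. Theorem. There is an algorithm that solves the Balanced Separator problem in time $2^{O(k\log k)}\cdot n^{O(1)}$, where $k=|T|$. That is, there are a program for a random access machine (with unit-cost addition, truncated subtraction, comparison with zero and indirect array access, the digraph being given by its adjacency matrix of edge multiplicities and $T$ by its indicator vector) and constants $a,b,c$ such that, on every instance $(D,T,r,s)$, the program halts after at most $a\cdot 2^{b\,k\log_2 k}\cdot (n+1)^{c}$ steps (where $k\log_2 k=0$ for $k=0$) and outputs a $(T,r)$-balanced separator $Z$ of $D$ with $|Z|\le s$ if one exists, and otherwise reports that there is none. -/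

import Mathlib

/-! ### Digraphs and balanced separators -/

/-- A digraph with vertex set `V`, loops and multiple edges allowed:
`mult u v` is the number of edges with tail `u` and head `v`. -/
structure MultiDigraph (V : Type*) where
  mult : V → V → ℕ

namespace MultiDigraph

variable {V : Type*}

/-- There is a (possibly trivial) walk from `u` to `v` in `D`. -/
def Reachable (D : MultiDigraph V) (u v : V) : Prop :=
  Relation.ReflTransGen (fun x y => 0 < D.mult x y) u v

/-- Any two vertices are joined by walks in both directions. -/
def StronglyConnected (D : MultiDigraph V) : Prop :=
  ∀ u v : V, D.Reachable u v ∧ D.Reachable v u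

/-- The subdigraph of `D` induced by a set `S` of vertices. -/
def induce (D : MultiDigraph V) (S : Set V) : MultiDigraph S where
  mult u v := D.mult u v

/-- `C` is the vertex set of a strong component of `D`, that is, of a maximal induced subdigraph
that is strongly connected. -/
def IsStrongComponent (D : MultiDigraph V) (C : Set V) : Prop :=
  Maximal (fun S : Set V => (D.induce S).StronglyConnected) C

/-- The digraph `D ∖ Z` obtained by deleting the vertices of `Z`. -/
def deleteVerts (D : MultiDigraph V) (Z : Set V) : MultiDigraph (Zᶜ : Set V) :=
  D.induce Zᶜ

/-- `Z` is a `(T, r)`-balanced separator of `D`: every strong component of `D ∖ Z` contains at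
most `r` vertices of `T`. -/
def IsBalancedSeparator (D : MultiDigraph V) (T : Finset V) (r : ℕ) (Z : Finset V) : Prop :=
  ∀ C : Set ((Z : Set V)ᶜ : Set V), (D.deleteVerts (Z : Set V)).IsStrongComponent C →
    ((Subtype.val '' C) ∩ (T : Set V)).ncard ≤ r

end MultiDigraph

/-! ### The machine model

A random access machine with finitely many scalar registers and finitely many one-dimensional
arrays used by each program, all cells holding natural numbers. The only arithmetic operations are
addition and truncated subtraction; there is no unit-cost multiplication. Programs are
structured (sequencing, branching on zero, `while` loops). -/
namespace RAM

/-- Memory contents: `reg x` is the value of register `x`, and `arr a i` is the value of cell `i` of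
array `a`. -/
structure State where
  reg : ℕ → ℕ
  arr : ℕ → ℕ → ℕ

namespace State

/-- Assign `v` to register `x`. -/
def setReg (σ : State) (x v : ℕ) : State where
  reg := Function.update σ.reg x v
  arr := σ.arr

/-- Assign `v` to cell `i` of array `a`. -/
def setArr (σ : State) (a i v : ℕ) : State where
  reg := σ.reg
  arr := Function.update σ.arr a (Function.update (σ.arr a) i v)

end State

/-- Programs. Register names `x, y, z`, array names `a` and constants `c` are fixed in the program
text; array cells are addressed indirectly, through the value of a register. -/
inductive Program where
  /-- `x := c` -/
  | const (x c : ℕ)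
  /-- `x := y + z` -/
  | add (x y z : ℕ)
  /-- `x := max (y - z) 0` -/
  | sub (x y z : ℕ)
  /-- `x := a[y]` -/
  | load (x a y : ℕ)
  /-- `a[x] := y` -/
  | store (a x y : ℕ)
  /-- first `p`, then `q` -/
  | seq (p q : Program)
  /-- if `x ≠ 0` then `p` else `q` -/
  | branch (x : ℕ) (p q : Program)
  /-- while `x ≠ 0` do `p` -/
  | loop (x : ℕ) (p : Program)

/-- `Exec p σ t τ`: started in state `σ`, the program `p` halts in state `τ` after exactly `t` steps,
where every elementary instruction and every evaluation of a guard is one step. -/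
inductive Exec : Program → State → ℕ → State → Prop
  | const (x c : ℕ) (σ : State) :
      Exec (.const x c) σ 1 (σ.setReg x c)
  | add (x y z : ℕ) (σ : State) :
      Exec (.add x y z) σ 1 (σ.setReg x (σ.reg y + σ.reg z))
  | sub (x y z : ℕ) (σ : State) :
      Exec (.sub x y z) σ 1 (σ.setReg x (σ.reg y - σ.reg z))
  | load (x a y : ℕ) (σ : State) :
      Exec (.load x a y) σ 1 (σ.setReg x (σ.arr a (σ.reg y)))
  | store (a x y : ℕ) (σ : State) :
      Exec (.store a x y) σ 1 (σ.setArr a (σ.reg x) (σ.reg y))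
  | seq {p q : Program} {σ τ υ : State} {t u : ℕ} (hp : Exec p σ t τ) (hq : Exec q τ u υ) :
      Exec (.seq p q) σ (t + u) υ
  | branchTrue {x : ℕ} {p q : Program} {σ τ : State} {t : ℕ} (hx : σ.reg x ≠ 0)
      (hp : Exec p σ t τ) : Exec (.branch x p q) σ (1 + t) τ
  | branchFalse {x : ℕ} {p q : Program} {σ τ : State} {t : ℕ} (hx : σ.reg x = 0)
      (hq : Exec q σ t τ) : Exec (.branch x p q) σ (1 + t) τ
  | loopTrue {x : ℕ} {p : Program} {σ τ υ : State} {t u : ℕ} (hx : σ.reg x ≠ 0)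
      (hp : Exec p σ t τ) (hl : Exec (.loop x p) τ u υ) :
      Exec (.loop x p) σ (1 + t + u) υ
  | loopFalse {x : ℕ} {p : Program} {σ : State} (hx : σ.reg x = 0) :
      Exec (.loop x p) σ 1 σ

/-- Execution is deterministic: the number of steps and the final state are determined by the
program and the initial state. -/
theorem Exec.deterministic {p : Program} {σ τ τ' : State} {t t' : ℕ}
    (h : Exec p σ t τ) (h' : Exec p σ t' τ') : t = t' ∧ τ = τ' := by
  induction h generalizing t' τ' with
  | const | add | sub | load | store => cases h'; exact ⟨rfl, rfl⟩
  | seq _ _ ihp ihq =>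
    cases h' with
    | seq hp hq =>
      obtain ⟨rfl, rfl⟩ := ihp hp
      obtain ⟨rfl, rfl⟩ := ihq hq
      exact ⟨rfl, rfl⟩
  | branchTrue hx _ ih =>
    cases h' with
    | branchTrue _ hp => obtain ⟨rfl, rfl⟩ := ih hp; exact ⟨rfl, rfl⟩
    | branchFalse hx' _ => exact absurd hx' hx
  | branchFalse hx _ ih =>
    cases h' with
    | branchTrue hx' _ => exact absurd hx hx'
    | branchFalse _ hq => obtain ⟨rfl, rfl⟩ := ih hq; exact ⟨rfl, rfl⟩
  | loopTrue hx _ _ ihp ihl =>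
    cases h' with
    | loopTrue _ hp hl =>
      obtain ⟨rfl, rfl⟩ := ihp hp
      obtain ⟨rfl, rfl⟩ := ihl hl
      exact ⟨rfl, rfl⟩
    | loopFalse hx' => exact absurd hx' hx
  | loopFalse hx =>
    cases h' with
    | loopTrue hx' _ _ => exact absurd hx hx'
    | loopFalse _ => exact ⟨rfl, rfl⟩

end RAM

/-! ### Input and output of Balanced Separator

The vertices are `0, …, n - 1`. -/
namespace BalancedSeparator

open scoped Classical in
/-- The initial memory for the instance `(D, T, r, s)`: registers `0, 1, 2` hold `n, r, s`, array `0`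
is the indicator vector of `T`, array `1` is the adjacency matrix of `D` in row-major order (entry
`u * n + v` is the number of edges from `u` to `v`), and every other cell is `0`. -/
noncomputable def input {n : ℕ} (D : MultiDigraph (Fin n)) (T : Finset (Fin n)) (r s : ℕ) :
    RAM.State where
  reg x := if x = 0 then n else if x = 1 then r else if x = 2 then s else 0
  arr a i :=
    if a = 0 then (if ∃ v ∈ T, (v : ℕ) = i then 1 else 0)
    else if a = 1 then
      ∑ u : Fin n, ∑ v : Fin n, if (u : ℕ) * n + (v : ℕ) = i then D.mult u v else 0
    else 0

/-- The answer read off from the final memory: if register `0` is `0`, the answer is that there is no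
separator; otherwise it is the set of vertices `v` for which cell `v` of array `0` is not `0`. -/
def output (n : ℕ) (σ : RAM.State) : Option (Finset (Fin n)) :=
  if σ.reg 0 = 0 then none else some (Finset.univ.filter fun v : Fin n => σ.arr 0 v ≠ 0)

/-- Correct answers for the instance `(D, T, r, s)`: a `(T, r)`-balanced separator of size at most `s`,
or `none` if there is no such set. -/
def IsCorrectAnswer {V : Type*} (D : MultiDigraph V) (T : Finset V) (r s : ℕ) :
    Option (Finset V) → Prop
  | some Z => D.IsBalancedSeparator T r Z ∧ Z.card ≤ s
  | none => ¬ ∃ Z : Finset V, D.IsBalancedSeparator T r Z ∧ Z.card ≤ s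

end BalancedSeparator

/-! If `s ≥ k`, the set `T` itself is a separator, so let `s < k`. Let `Z` be a balanced separator
of size at most `s`. Reachability in `D ∖ Z` is a preorder on the surviving terminals; it can be
numbered by `1, …, k` so that numbers never decrease along walks and equal numbers mean strongly
connected (`exists_numbering`). Deleted terminals get label `0`. Conversely, if a set contains the
terminals of label `0` and cuts all walks from larger to smaller positive labels, then two terminals
in one strong component have equal labels, so they were strongly connected in `D ∖ Z` already. Any
such set is therefore balanced (`Balanced.exists_label`), and for guessed labels only this
separation problem remains.

The separation problem is solved by branching on cuts in a network where each vertex is a unit arc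
and each edge an arc of capacity `N`, too expensive to cut. The label `i` decreases from `k + 1`.
The sources include the nodes of label at least `i`, the sinks are those with a smaller positive
label, and the far cut is the largest source side of a minimum cut. If no surviving vertex crosses
it, nothing is left to separate at `i`. Otherwise some crossing vertex is either deleted or kept,
the latter by adding its exit node and the far cut to the sources.

The existence of a successful sequence of choices is shown by a labeling `l` of all nodes, at first
the largest number of a surviving terminal that reaches the node. Arcs with decreasing labels are
paid for, and their total cost `b` bounds the deletions still needed. By submodularity, raising all
labels on the far cut to `i` costs nothing (`IsFarCut.descentCost_le`). The raised labeling then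
prescribes the choice: keeping the vertex raises the minimum cut `lam`, deleting it lowers `b` by
one and `lam` by at most one. Thus `2 * b - lam` drops with each choice, and `2 * k` bits suffice
(`Labeled.Feasible.exists_wins`).

The algorithm runs through all `(k + 1) ^ (3 * k)` strings of `k` labels and `2 * k` bits, follows
each one deterministically and checks the outcome, so bad strings do no harm. Far cuts come from
augmenting paths. Flows are never mentioned: it is enough that augmenting lowers the residual weight
of every cut by one (`IsResidual`, `run_flow`). The work per string is written in a language whose
loops all run `N = 4 * n + 4` times, so its compiled code takes polynomially many steps
(`Stmt.exec_compile`, `Stmt.exists_cost_le`); only the loop over the strings is a genuine `while`.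
-/

/-! ### A language of bounded loops over arrays -/
namespace BoundedLoop

/-- The contents of the arrays. -/
abbrev Store := ℕ → ℕ → ℕ

/-- Expressions; `var i` is the `i`-th innermost loop counter, `size` the common number of iterations
of all loops. -/
inductive Expr where
  | lit (c : ℕ)
  | var (i : ℕ)
  | size
  | load (a : ℕ) (e : Expr)
  | add (e f : Expr)
  | sub (e f : Expr)
  | cond (e f g : Expr)

/-- Statements; `forN p` runs `p` with loop counter `0, …, N - 1`. -/
inductive Stmt where
  | store (a : ℕ) (e f : Expr)
  | seq (p q : Stmt)
  | ite (e : Expr) (p q : Stmt)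
  | forN (p : Stmt)
  | skip

/-- `x` if `c ≠ 0`, and `y` if `c = 0`. -/
def choice {α : Type*} (c : ℕ) (x y : α) : α :=
  match c with
  | 0 => y
  | _ + 1 => x

theorem choice_zero {α : Type*} (x y : α) : choice 0 x y = y := rfl

theorem choice_of_ne {α : Type*} {c : ℕ} (h : c ≠ 0) (x y : α) : choice c x y = x := by
  cases c with
  | zero => exact absurd rfl h
  | succ c => rfl

theorem choice_of_eq {α : Type*} {c : ℕ} (h : c = 0) (x y : α) : choice c x y = y := by
  rw [h, choice_zero]

theorem choice_ne_zero_iff {c x y : ℕ} :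
    choice c x y ≠ 0 ↔ (c ≠ 0 ∧ x ≠ 0) ∨ (c = 0 ∧ y ≠ 0) := by
  cases c <;> simp [choice]

/-- The value of an expression. -/
def Expr.eval (N : ℕ) (env : List ℕ) (s : Store) : Expr → ℕ
  | .lit c => c
  | .var i => env.getD i 0
  | .size => N
  | .load a e => s a (e.eval N env s)
  | .add e f => e.eval N env s + f.eval N env s
  | .sub e f => e.eval N env s - f.eval N env s
  | .cond e f g => choice (e.eval N env s) (f.eval N env s) (g.eval N env s)

/-- The arrays read by an expression. -/
def Expr.reads : Expr → List ℕ
  | .lit _ => []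
  | .var _ => []
  | .size => []
  | .load a e => a :: e.reads
  | .add e f => e.reads ++ f.reads
  | .sub e f => e.reads ++ f.reads
  | .cond e f g => e.reads ++ (f.reads ++ g.reads)

/-- Assign `v` to cell `i` of array `a`. -/
def Store.set (s : Store) (a i v : ℕ) : Store :=
  Function.update s a (Function.update (s a) i v)

/-- Run `body 0`, …, `body (m - 1)` in this order. -/
def repeatFor (body : ℕ → Store → Store) : ℕ → Store → Store
  | 0, s => s
  | m + 1, s => body m (repeatFor body m s)

/-- The effect of a statement. -/
def Stmt.run (N : ℕ) : Stmt → List ℕ → Store → Store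
  | .store a e f, env, s => s.set a (e.eval N env s) (f.eval N env s)
  | .seq p q, env, s => q.run N env (p.run N env s)
  | .ite e p q, env, s => choice (e.eval N env s) (p.run N env s) (q.run N env s)
  | .forN p, env, s => repeatFor (fun j => p.run N (j :: env)) N s
  | .skip, _, s => s

theorem Stmt.run_seq (N : ℕ) (p q : Stmt) (env : List ℕ) (s : Store) :
    (seq p q).run N env s = q.run N env (p.run N env s) := rfl

/-- The arrays written by a statement. -/
def Stmt.writes : Stmt → List ℕ
  | .store a _ _ => [a]
  | .seq p q => p.writes ++ q.writes
  | .ite _ p q => p.writes ++ q.writes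
  | .forN p => p.writes
  | .skip => []

theorem repeatFor_induction {body : ℕ → Store → Store} (P : ℕ → Store → Prop) {m : ℕ} {s : Store}
    (h0 : P 0 s) (hs : ∀ j < m, ∀ s, P j s → P (j + 1) (body j s)) : P m (repeatFor body m s) := by
  induction m with
  | zero => exact h0
  | succ m ih => exact hs m (Nat.lt_succ_self m) _ (ih fun j hj => hs j (by omega))

/-- Frame rule. The written arrays form a computable list, so for concrete programs the side
condition is usually settled by `decide`. -/
theorem Stmt.run_of_notMem_writes (N : ℕ) (p : Stmt) {a : ℕ} (h : a ∉ p.writes) (env : List ℕ)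
    (s : Store) : p.run N env s a = s a := by
  induction p generalizing env s with
  | store b e f =>
    simp only [writes, List.mem_singleton] at h
    simp [run, Store.set, h]
  | seq p q ihp ihq =>
    simp only [writes, List.mem_append, not_or] at h
    rw [run, ihq h.2, ihp h.1]
  | ite e p q ihp ihq =>
    simp only [writes, List.mem_append, not_or] at h
    rw [run]
    by_cases hc : e.eval N env s = 0
    · rw [choice_of_eq hc, ihq h.2]
    · rw [choice_of_ne hc, ihp h.1]
  | forN p ih =>
    rw [run]
    exact repeatFor_induction (fun _ s' => s' a = s a) rfl fun j _ s' hs' => by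
      rw [ih h, hs']
  | skip => rfl

/-- The loop rule, with the frame condition built in. -/
theorem Stmt.run_forN {N : ℕ} {p : Stmt} {env : List ℕ} {s : Store} (P : ℕ → Store → Prop)
    (h0 : P 0 s)
    (hs : ∀ j < N, ∀ s', (∀ a, a ∉ p.writes → s' a = s a) → P j s' →
      P (j + 1) (p.run N (j :: env) s')) :
    P N ((Stmt.forN p).run N env s) := by
  refine (repeatFor_induction (fun j s' => (∀ a, a ∉ p.writes → s' a = s a) ∧ P j s')
    ⟨fun _ _ => rfl, h0⟩ fun j hj s' hs' => ⟨fun a ha => ?_, hs j hj s' hs'.1 hs'.2⟩).2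
  rw [p.run_of_notMem_writes N ha, hs'.1 a ha]

theorem Store.set_apply (s : Store) (a i v b j : ℕ) :
    s.set a i v b j = if b = a ∧ j = i then v else s b j := by
  unfold Store.set
  by_cases h1 : b = a
  · subst h1
    by_cases h2 : j = i <;> simp [h2]
  · simp [h1]

theorem Expr.eval_congr {N : ℕ} {env : List ℕ} {s s' : Store} {e : Expr}
    (h : ∀ a ∈ e.reads, s' a = s a) : e.eval N env s' = e.eval N env s := by
  induction e with
  | lit | var | size => rfl
  | load a e ih =>
    simp only [reads, List.mem_cons, forall_eq_or_imp] at h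
    rw [eval, eval, ih h.2, h.1]
  | add e f ihe ihf =>
    simp only [reads, List.mem_append, or_imp, forall_and] at h
    rw [eval, eval, ihe h.1, ihf h.2]
  | sub e f ihe ihf =>
    simp only [reads, List.mem_append, or_imp, forall_and] at h
    rw [eval, eval, ihe h.1, ihf h.2]
  | cond e f g ihe ihf ihg =>
    simp only [reads, List.mem_append, or_imp, forall_and] at h
    rw [eval, eval, ihe h.1, ihf h.2.1, ihg h.2.2]

/-- A loop that updates the entries of an array independently of each other. -/
theorem run_forN_update {N : ℕ} {env : List ℕ} {s : Store} {a : ℕ} {e f : Expr}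
    (he : a ∉ e.reads) (hf : a ∉ f.reads) (j : ℕ) :
    (Stmt.forN (.ite e (.store a (.var 0) f) .skip)).run N env s a j =
      if j < N ∧ e.eval N (j :: env) s ≠ 0 then f.eval N (j :: env) s else s a j := by
  refine Stmt.run_forN (fun m s' => s' a j =
    if j < m ∧ e.eval N (j :: env) s ≠ 0 then f.eval N (j :: env) s else s a j) (by simp) ?_
  intro m _ s' hfr hs'
  have h1 : ∀ x : Expr, a ∉ x.reads → x.eval N (m :: env) s' = x.eval N (m :: env) s :=
    fun x hx => Expr.eval_congr fun b hb => hfr b (by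
      simp only [Stmt.writes, List.append_nil, List.mem_singleton]
      rintro rfl
      exact hx hb)
  rw [Stmt.run, h1 e he]
  by_cases hj : j = m
  · subst hj
    by_cases h2 : e.eval N (j :: env) s = 0
    · simp [h2, Stmt.run, hs', choice_zero]
    · simp [choice_of_ne h2, h2, Stmt.run, Store.set_apply, Expr.eval, h1 f hf]
  · have hlt : j < m + 1 ↔ j < m := by omega
    simp only [hlt]
    rw [← hs']
    by_cases h2 : e.eval N (m :: env) s = 0
    · rw [choice_of_eq h2, Stmt.run]
    · simp [choice_of_ne h2, Stmt.run, Store.set_apply, Expr.eval, hj]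

/-- A loop that fills an array. -/
theorem run_forN_store {N : ℕ} {env : List ℕ} {s : Store} {a : ℕ} {f : Expr}
    (hf : a ∉ f.reads) {j : ℕ} (hj : j < N) :
    (Stmt.forN (.store a (.var 0) f)).run N env s a j = f.eval N (j :: env) s := by
  have h := run_forN_update (N := N) (env := env) (s := s) (e := .lit 1) (f := f)
    (by simp [Expr.reads]) hf j
  simpa [Stmt.run, Expr.eval, hj, choice_of_ne one_ne_zero] using h

/-- A loop that computes partial sums. -/
theorem run_forN_prefix {N : ℕ} {env : List ℕ} {s : Store} {a : ℕ} {e : Expr}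
    (he : a ∉ e.reads) {j : ℕ} (hj : j ≤ N) :
    (Stmt.forN (.store a (.add (.var 0) (.lit 1)) (.add (.load a (.var 0)) e))).run N env s a j =
      s a 0 + ∑ i ∈ Finset.range j, e.eval N (i :: env) s := by
  refine Stmt.run_forN (fun m s' => ∀ j ≤ m, s' a j =
    s a 0 + ∑ i ∈ Finset.range j, e.eval N (i :: env) s) (by simp) ?_ j hj
  intro m _ s' hfr hs' j hj
  have h1 : e.eval N (m :: env) s' = e.eval N (m :: env) s :=
    Expr.eval_congr fun b hb => hfr b (by
      simp only [Stmt.writes, List.mem_singleton]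
      rintro rfl
      exact he hb)
  simp only [Stmt.run, Expr.eval, Store.set_apply, true_and, List.getD_cons_zero, h1]
  split_ifs with h2
  · rw [h2, hs' m le_rfl, Finset.sum_range_succ, add_assoc]
  · exact hs' j (by omega)

/-- A loop that adds up values. -/
theorem run_forN_sum {N : ℕ} {env : List ℕ} {s : Store} {a : ℕ} {e : Expr} (he : a ∉ e.reads) :
    (Stmt.forN (.store a (.lit 0) (.add (.load a (.lit 0)) e))).run N env s a 0 =
      s a 0 + ∑ i ∈ Finset.range N, e.eval N (i :: env) s := by
  refine Stmt.run_forN (fun m s' => s' a 0 =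
    s a 0 + ∑ i ∈ Finset.range m, e.eval N (i :: env) s) (by simp) ?_
  intro m _ s' hfr hs'
  have h1 : e.eval N (m :: env) s' = e.eval N (m :: env) s :=
    Expr.eval_congr fun b hb => hfr b (by
      simp only [Stmt.writes, List.mem_singleton]
      rintro rfl
      exact he hb)
  simp [Stmt.run, Expr.eval, Store.set_apply, h1, hs', Finset.sum_range_succ, add_assoc]

/-- A loop that finds the last index satisfying a condition. -/
theorem run_forN_find {N : ℕ} {env : List ℕ} {s : Store} {a b : ℕ} {e : Expr} (hab : a ≠ b)
    (ha : a ∉ e.reads) (hb : b ∉ e.reads) (h0 : s a 0 = 0) :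
    ((Stmt.forN (.ite e (.seq (.store a (.lit 0) (.lit 1)) (.store b (.lit 0) (.var 0)))
        .skip)).run N env s a 0 = 0 ∧ ∀ j < N, e.eval N (j :: env) s = 0) ∨
    ((Stmt.forN (.ite e (.seq (.store a (.lit 0) (.lit 1)) (.store b (.lit 0) (.var 0)))
        .skip)).run N env s a 0 ≠ 0 ∧
      IsGreatest {j | j < N ∧ e.eval N (j :: env) s ≠ 0}
        ((Stmt.forN (.ite e (.seq (.store a (.lit 0) (.lit 1)) (.store b (.lit 0) (.var 0)))
        .skip)).run N env s b 0)) := by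
  refine Stmt.run_forN (fun m s' => (s' a 0 = 0 ∧ ∀ j < m, e.eval N (j :: env) s = 0) ∨
    (s' a 0 ≠ 0 ∧ IsGreatest {j | j < m ∧ e.eval N (j :: env) s ≠ 0} (s' b 0)))
    (.inl ⟨h0, by simp⟩) ?_
  intro m _ s' hfr hs'
  have h1 : e.eval N (m :: env) s' = e.eval N (m :: env) s :=
    Expr.eval_congr fun c hc => hfr c (by
      simp only [Stmt.writes, List.append_nil, List.mem_append, List.mem_singleton]
      rintro (rfl | rfl)
      exacts [ha hc, hb hc])
  rw [Stmt.run, h1]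
  by_cases h2 : e.eval N (m :: env) s = 0
  swap
  · right
    rw [choice_of_ne h2]
    simp only [Stmt.run, Expr.eval, Store.set_apply, hab, and_true, if_true, if_false,
      List.getD_cons_zero]
    refine ⟨one_ne_zero, ⟨Nat.lt_succ_self m, h2⟩, fun j hj => Nat.lt_succ_iff.1 hj.1⟩
  · rw [choice_of_eq h2, Stmt.run]
    rcases hs' with ⟨h3, h4⟩ | ⟨h3, h4⟩
    · refine .inl ⟨h3, fun j hj => ?_⟩
      rcases Nat.lt_succ_iff_lt_or_eq.1 hj with h | rfl
      exacts [h4 j h, h2]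
    · refine .inr ⟨h3, ⟨Nat.lt_succ_of_lt h4.1.1, h4.1.2⟩, fun j hj => h4.2 ⟨?_, hj.2⟩⟩
      rcases Nat.lt_succ_iff_lt_or_eq.1 hj.1 with h | rfl
      exacts [h, absurd h2 hj.2]

/-- Row-major addressing: division with remainder by `N` recovers row and column, so the rows need
no bound. -/
theorem mul_add_inj {N a b u v : ℕ} (hb : b < N) (hv : v < N) :
    a * N + b = u * N + v ↔ a = u ∧ b = v := by
  refine ⟨fun h => ?_, fun h => by rw [h.1, h.2]⟩
  have hN : 0 < N := by omega
  have h1 : (b + N * a) / N = (v + N * u) / N := by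
    rw [add_comm, mul_comm N a, h, add_comm, mul_comm u N]
  rw [Nat.add_mul_div_left _ _ hN, Nat.add_mul_div_left _ _ hN, Nat.div_eq_of_lt hb,
    Nat.div_eq_of_lt hv] at h1
  have h2 : a = u := by omega
  subst h2
  exact ⟨rfl, by omega⟩

/-- A double loop that fills a matrix, given a table of row offsets. -/
theorem run_forN_forN_store {N : ℕ} {env : List ℕ} {s : Store} {a t : ℕ} {e : Expr} (hat : a ≠ t)
    (he : a ∉ e.reads) (ht : ∀ i < N, s t i = i * N) {u v : ℕ} (hu : u < N) (hv : v < N) :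
    (Stmt.forN (.forN (.store a (.add (.load t (.var 1)) (.var 0)) e))).run N env s a (u * N + v) =
      e.eval N (v :: u :: env) s := by
  refine Stmt.run_forN (fun m s' => ∀ u < m, ∀ v < N, s' a (u * N + v) =
    e.eval N (v :: u :: env) s) (by simp) ?_ u hu v hv
  intro m hm s' hfr hs'
  have key := Stmt.run_forN (N := N) (env := m :: env) (s := s')
    (p := .store a (.add (.load t (.var 1)) (.var 0)) e)
    (fun k s'' => ∀ u < N, ∀ v < N, (u < m ∨ u = m ∧ v < k) →
      s'' a (u * N + v) = e.eval N (v :: u :: env) s)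
    (fun u hu v hv h => hs' u (by omega) v hv) ?_
  · intro u hu' v hv'
    exact key u (by omega) v hv' (by omega)
  · intro k hk s'' hfr' h u hu v hv huv
    have hfr'' : ∀ b, b ≠ a → s'' b = s b := fun b hb => by
      rw [hfr' b (by simpa [Stmt.writes] using hb), hfr b (by simpa [Stmt.writes] using hb)]
    have h1 : e.eval N (k :: m :: env) s'' = e.eval N (k :: m :: env) s :=
      Expr.eval_congr fun b hb => hfr'' b (by rintro rfl; exact he hb)
    have h2 : s'' t m = m * N := by rw [hfr'' t hat.symm, ht m hm]
    simp only [Stmt.run, Expr.eval, List.getD_cons_succ, List.getD_cons_zero, Store.set_apply, h2,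
      true_and, h1, mul_add_inj hv hk]
    split_ifs with h3
    · rw [h3.1, h3.2]
    · exact h u hu v hv (by omega)

/-! ### Compilation to the random access machine -/

open RAM

/-- Code that leaves the value of an expression in register `d`, where `regs` lists the registers
holding the loop counters and register `2` holds the size. -/
def Expr.compile (regs : List ℕ) : ℕ → Expr → Program
  | d, .lit c => .const d c
  | d, .var i =>
    if h : i < regs.length then .seq (.const d 0) (.add d d regs[i]) else .const d 0
  | d, .size => .seq (.const d 0) (.add d d 2)
  | d, .load a e => .seq (e.compile regs d) (.load d a d)
  | d, .add e f => .seq (e.compile regs d) (.seq (f.compile regs (d + 1)) (.add d d (d + 1)))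
  | d, .sub e f => .seq (e.compile regs d) (.seq (f.compile regs (d + 1)) (.sub d d (d + 1)))
  | d, .cond e f g =>
    .seq (e.compile regs d) (.branch d (f.compile regs d) (g.compile regs d))

/-- A bound for the running time of the code of an expression. -/
def Expr.cost : Expr → ℕ
  | .lit _ => 1
  | .var _ => 2
  | .size => 2
  | .load _ e => e.cost + 1
  | .add e f => e.cost + (f.cost + 1)
  | .sub e f => e.cost + (f.cost + 1)
  | .cond e f g => e.cost + (1 + (f.cost + g.cost))

/-- Code for a statement; registers from `d` on are free, and register `1` holds `1`. -/
def Stmt.compile : List ℕ → ℕ → Stmt → Program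
  | regs, d, .store a e f =>
    .seq (e.compile regs d) (.seq (f.compile regs (d + 1)) (.store a d (d + 1)))
  | regs, d, .seq p q => .seq (p.compile regs d) (q.compile regs d)
  | regs, d, .ite e p q => .seq (e.compile regs d) (.branch d (p.compile regs d) (q.compile regs d))
  | regs, d, .forN p =>
    .seq (.const d 0) (.seq (.seq (.const (d + 1) 0) (.add (d + 1) (d + 1) 2))
      (.loop (d + 1) (.seq (p.compile (d :: regs) (d + 2)) (.seq (.add d d 1) (.sub (d + 1) 2 d)))))
  | _, d, .skip => .const d 0

/-- A bound for the running time of the code of a statement. -/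
def Stmt.cost (N : ℕ) : Stmt → ℕ
  | .store _ e f => e.cost + (f.cost + 1)
  | .seq p q => p.cost N + q.cost N
  | .ite e p q => e.cost + (1 + (p.cost N + q.cost N))
  | .forN p => 4 + N * (p.cost N + 3)
  | .skip => 1

/-- The registers of `σ` hold the loop counters and constants the code refers to. -/
structure Represents (N : ℕ) (regs : List ℕ) (d : ℕ) (env : List ℕ) (σ : State) : Prop where
  two_lt : 2 < d
  one : σ.reg 1 = 1
  size : σ.reg 2 = N
  lt : ∀ x ∈ regs, x < d
  env_eq : env = regs.map σ.reg

theorem Represents.congr {N d : ℕ} {regs env : List ℕ} {σ τ : State}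
    (h : Represents N regs d env σ) (hreg : ∀ x < d, τ.reg x = σ.reg x) :
    Represents N regs d env τ where
  two_lt := h.two_lt
  one := by rw [hreg 1 (by have := h.two_lt; omega), h.one]
  size := by rw [hreg 2 h.two_lt, h.size]
  lt := h.lt
  env_eq := by
    rw [h.env_eq]
    exact List.map_congr_left fun x hx => (hreg x (h.lt x hx)).symm

theorem Represents.succ {N d : ℕ} {regs env : List ℕ} {σ : State}
    (h : Represents N regs d env σ) : Represents N regs (d + 1) env σ where
  two_lt := by have := h.two_lt; omega
  one := h.one
  size := h.size
  lt x hx := by have := h.lt x hx; omega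
  env_eq := h.env_eq

/-- Code generated at depth `d` writes only registers from `d` on. Hence a first operand left in `d`
survives the evaluation of the second one at depth `d + 1`; the clause on registers below `d`
carries the induction. -/
theorem Expr.exec_compile {N : ℕ} {regs : List ℕ} {env : List ℕ} (e : Expr) {d : ℕ} {σ : State}
    (h : Represents N regs d env σ) :
    ∃ t τ, Exec (e.compile regs d) σ t τ ∧ t ≤ e.cost ∧ τ.reg d = e.eval N env σ.arr ∧
      (∀ x < d, τ.reg x = σ.reg x) ∧ τ.arr = σ.arr := by
  induction e generalizing d σ with
  | lit c =>
    refine ⟨_, _, .const d c σ, le_rfl, by simp [State.setReg, eval], fun x hx => ?_, rfl⟩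
    simp [State.setReg, hx.ne]
  | var i =>
    by_cases hi : i < regs.length
    · have hlt : regs[i] < d := h.lt _ (List.getElem_mem hi)
      simp only [compile, hi, dif_pos]
      refine ⟨_, _, .seq (.const d 0 σ) (.add d d regs[i] _), le_rfl, ?_, fun x hx => ?_, rfl⟩
      · simp [State.setReg, eval, h.env_eq, hi, hlt.ne]
      · simp [State.setReg, hx.ne]
    · simp only [compile, hi, dif_neg, not_false_eq_true]
      refine ⟨_, _, .const d 0 σ, by simp [cost], ?_, fun x hx => ?_, rfl⟩
      · simp [State.setReg, eval, h.env_eq, hi]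
      · simp [State.setReg, hx.ne]
  | size =>
    refine ⟨_, _, .seq (.const d 0 σ) (.add d d 2 _), le_rfl, ?_, fun x hx => ?_, rfl⟩
    · simp [State.setReg, eval, h.size, h.two_lt.ne]
    · simp [State.setReg, hx.ne]
  | load a e ih =>
    obtain ⟨t, τ, he, ht, hd, hreg, harr⟩ := ih h
    refine ⟨_, _, .seq he (.load d a d τ), by simpa [cost] using ht, ?_, fun x hx => ?_, harr⟩
    · simp [State.setReg, eval, hd, harr]
    · simp [State.setReg, hx.ne, hreg x hx]
  | add e f ihe ihf =>
    obtain ⟨t, τ, he, ht, hd, hreg, harr⟩ := ihe h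
    obtain ⟨t', τ', he', ht', hd', hreg', harr'⟩ := ihf (h.congr hreg).succ
    refine ⟨_, _, .seq he (.seq he' (.add d d (d + 1) τ')), by simp only [cost]; omega, ?_,
      fun x hx => ?_, harr'.trans harr⟩
    · simp [State.setReg, eval, hd', hreg' d (Nat.lt_succ_self d), hd, harr]
    · simp [State.setReg, hx.ne, hreg' x (by omega), hreg x hx]
  | sub e f ihe ihf =>
    obtain ⟨t, τ, he, ht, hd, hreg, harr⟩ := ihe h
    obtain ⟨t', τ', he', ht', hd', hreg', harr'⟩ := ihf (h.congr hreg).succ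
    refine ⟨_, _, .seq he (.seq he' (.sub d d (d + 1) τ')), by simp only [cost]; omega, ?_,
      fun x hx => ?_, harr'.trans harr⟩
    · simp [State.setReg, eval, hd', hreg' d (Nat.lt_succ_self d), hd, harr]
    · simp [State.setReg, hx.ne, hreg' x (by omega), hreg x hx]
  | cond e f g ihe ihf ihg =>
    obtain ⟨t, τ, he, ht, hd, hreg, harr⟩ := ihe h
    by_cases hc : e.eval N env σ.arr = 0
    · obtain ⟨t', τ', he', ht', hd', hreg', harr'⟩ := ihg (h.congr hreg)
      refine ⟨_, _, .seq he (.branchFalse (hd.trans hc) he'), by simp only [cost]; omega, ?_,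
        fun x hx => by rw [hreg' x hx, hreg x hx], harr'.trans harr⟩
      rw [hd', harr, eval, choice_of_eq hc]
    · obtain ⟨t', τ', he', ht', hd', hreg', harr'⟩ := ihf (h.congr hreg)
      refine ⟨_, _, .seq he (.branchTrue (by rwa [hd]) he'), by simp only [cost]; omega, ?_,
        fun x hx => by rw [hreg' x hx, hreg x hx], harr'.trans harr⟩
      rw [hd', harr, eval, choice_of_ne hc]

theorem Stmt.exec_compile {N : ℕ} {regs : List ℕ} {env : List ℕ} (p : Stmt) {d : ℕ} {σ : State}
    (h : Represents N regs d env σ) :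
    ∃ t τ, Exec (p.compile regs d) σ t τ ∧ t ≤ p.cost N ∧ τ.arr = p.run N env σ.arr ∧
      ∀ x < d, τ.reg x = σ.reg x := by
  induction p generalizing regs env d σ with
  | store a e f =>
    obtain ⟨t, τ, he, ht, hd, hreg, harr⟩ := e.exec_compile h
    obtain ⟨t', τ', he', ht', hd', hreg', harr'⟩ := f.exec_compile (h.congr hreg).succ
    refine ⟨_, _, .seq he (.seq he' (.store a d (d + 1) τ')), by simp only [cost]; omega, ?_,
      fun x hx => ?_⟩
    · simp [State.setArr, run, Store.set, hd', hreg' d (Nat.lt_succ_self d), hd, harr, harr']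
    · simp [State.setArr, hreg' x (by omega), hreg x hx]
  | seq p q ihp ihq =>
    obtain ⟨t, τ, he, ht, harr, hreg⟩ := ihp h
    obtain ⟨t', τ', he', ht', harr', hreg'⟩ := ihq (h.congr hreg)
    refine ⟨_, _, .seq he he', by simp only [cost]; omega, ?_, fun x hx => ?_⟩
    · rw [harr', harr, run]
    · rw [hreg' x hx, hreg x hx]
  | ite e p q ihp ihq =>
    obtain ⟨t, τ, he, ht, hd, hreg, harr⟩ := e.exec_compile h
    by_cases hc : e.eval N env σ.arr = 0
    · obtain ⟨t', τ', he', ht', harr', hreg'⟩ := ihq (h.congr hreg)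
      refine ⟨_, _, .seq he (.branchFalse (hd.trans hc) he'), by simp only [cost]; omega, ?_,
        fun x hx => by rw [hreg' x hx, hreg x hx]⟩
      rw [harr', harr, run, choice_of_eq hc]
    · obtain ⟨t', τ', he', ht', harr', hreg'⟩ := ihp (h.congr hreg)
      refine ⟨_, _, .seq he (.branchTrue (by rwa [hd]) he'), by simp only [cost]; omega, ?_,
        fun x hx => by rw [hreg' x hx, hreg x hx]⟩
      rw [harr', harr, run, choice_of_ne hc]
  | forN p ih =>
    -- Induction on the number `m` of iterations still to run: register `d` counts up, while the
    -- guard register `d + 1` holds what remains, since guards can only be compared with zero.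
    have key : ∀ m ≤ N, ∀ τ : State, τ.reg d = N - m → τ.reg (d + 1) = m →
        (∀ x < d, τ.reg x = σ.reg x) →
        τ.arr = repeatFor (fun j => p.run N (j :: env)) (N - m) σ.arr →
        ∃ t υ, Exec (.loop (d + 1) (.seq (p.compile (d :: regs) (d + 2))
          (.seq (.add d d 1) (.sub (d + 1) 2 d)))) τ t υ ∧ t ≤ 1 + m * (p.cost N + 3) ∧
          υ.arr = repeatFor (fun j => p.run N (j :: env)) N σ.arr ∧
          ∀ x < d, υ.reg x = σ.reg x := by
      intro m
      induction m with
      | zero =>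
        intro _ τ _ h1 h2 h3
        exact ⟨1, τ, .loopFalse h1, by omega, h3, h2⟩
      | succ m ihm =>
        intro hm τ h0 h1 h2 h3
        have hr : Represents N (d :: regs) (d + 2) ((N - (m + 1)) :: env) τ := by
          have := h.congr h2
          refine ⟨by have := h.two_lt; omega, this.one, this.size, ?_, ?_⟩
          · intro x hx
            rcases List.mem_cons.1 hx with rfl | hx
            · omega
            · have := h.lt x hx
              omega
          · rw [List.map_cons, h0, ← this.env_eq]
        obtain ⟨t, τ', he, ht, harr, hreg⟩ := ih hr
        have e0 : τ'.reg d = N - (m + 1) := by rw [hreg d (by omega), h0]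
        have e1 : τ'.reg 1 = 1 := by rw [hreg 1 (by have := h.two_lt; omega), hr.one]
        have e2 : τ'.reg 2 = N := by rw [hreg 2 (by have := h.two_lt; omega), hr.size]
        have hd2 : 2 ≠ d := h.two_lt.ne
        have hsub : N - m = N - (m + 1) + 1 := by omega
        obtain ⟨u, υ, hu, hut, huarr, hureg⟩ := ihm (by omega)
          ((τ'.setReg d (τ'.reg d + τ'.reg 1)).setReg (d + 1)
            ((τ'.setReg d (τ'.reg d + τ'.reg 1)).reg 2 -
              (τ'.setReg d (τ'.reg d + τ'.reg 1)).reg d))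
          (by simp [State.setReg, e0, e1, hsub])
          (by simp [State.setReg, e0, e1, e2, hd2]; omega)
          (fun x hx => by
            simp [State.setReg, hx.ne, (show x ≠ d + 1 by omega), hreg x (by omega), h2 x hx])
          (by simp only [State.setReg]; rw [harr, h3, hsub, repeatFor])
        refine ⟨_, υ, .loopTrue (by omega) (.seq he (.seq (.add d d 1 τ') (.sub (d + 1) 2 d _))) hu,
          ?_, huarr, hureg⟩
        calc 1 + (t + (1 + 1)) + u
            ≤ 1 + (p.cost N + (1 + 1)) + (1 + m * (p.cost N + 3)) := by omega
          _ = 1 + (m + 1) * (p.cost N + 3) := by ring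
    obtain ⟨t, τ, he, ht, harr, hreg⟩ := key N le_rfl
      (((σ.setReg d 0).setReg (d + 1) 0).setReg (d + 1)
        (((σ.setReg d 0).setReg (d + 1) 0).reg (d + 1) + ((σ.setReg d 0).setReg (d + 1) 0).reg 2))
      (by simp [State.setReg])
      (by
        have := h.two_lt
        simp [State.setReg, h.size, this.ne, (show 2 ≠ d + 1 by omega)])
      (fun x hx => by simp [State.setReg, hx.ne, (show x ≠ d + 1 by omega)])
      (by simp [State.setReg, repeatFor])
    refine ⟨_, τ, .seq (.const d 0 σ) (.seq (.seq (.const (d + 1) 0 _)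
      (.add (d + 1) (d + 1) 2 _)) he), by simp only [cost]; omega, ?_, hreg⟩
    rw [harr, run]
  | skip =>
    refine ⟨_, _, .const d 0 σ, le_rfl, rfl, fun x hx => ?_⟩
    simp [State.setReg, hx.ne]

/-- Every loop makes exactly `N` iterations, so the nesting depth of the loops is a possible
exponent. -/
theorem Stmt.exists_cost_le (p : Stmt) : ∃ a c : ℕ, ∀ N, p.cost N ≤ a * (N + 1) ^ c := by
  have mono : ∀ {c c' : ℕ} (_ : c ≤ c') (N : ℕ), (N + 1) ^ c ≤ (N + 1) ^ c' := fun h N =>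
    Nat.pow_le_pow_right (Nat.succ_pos N) h
  have both : ∀ p q : Stmt, (∃ a c : ℕ, ∀ N, p.cost N ≤ a * (N + 1) ^ c) →
      (∃ a c : ℕ, ∀ N, q.cost N ≤ a * (N + 1) ^ c) →
      ∃ a c : ℕ, ∀ N, p.cost N + q.cost N ≤ a * (N + 1) ^ c := by
    rintro p q ⟨a, c, h⟩ ⟨a', c', h'⟩
    refine ⟨a + a', max c c', fun N => ?_⟩
    calc p.cost N + q.cost N ≤ a * (N + 1) ^ c + a' * (N + 1) ^ c' := add_le_add (h N) (h' N)
      _ ≤ a * (N + 1) ^ max c c' + a' * (N + 1) ^ max c c' :=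
        add_le_add (Nat.mul_le_mul_left _ (mono (le_max_left _ _) N))
          (Nat.mul_le_mul_left _ (mono (le_max_right _ _) N))
      _ = (a + a') * (N + 1) ^ max c c' := by ring
  induction p with
  | store a e f => exact ⟨e.cost + (f.cost + 1), 0, fun N => by simp [cost]⟩
  | seq p q ihp ihq => exact both p q ihp ihq
  | ite e p q ihp ihq =>
    obtain ⟨a, c, h⟩ := both p q ihp ihq
    refine ⟨e.cost + 1 + a, c, fun N => ?_⟩
    have h1 : 1 ≤ (N + 1) ^ c := Nat.one_le_pow _ _ (Nat.succ_pos N)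
    have h2 : (e.cost + 1) * 1 ≤ (e.cost + 1) * (N + 1) ^ c := Nat.mul_le_mul_left _ h1
    have := h N
    simp only [cost]
    rw [add_mul]
    omega
  | forN p ih =>
    obtain ⟨a, c, h⟩ := ih
    -- Loop control takes `4 + 3 * N ≤ 7 * (N + 1)` steps.
    refine ⟨7 + a, c + 1, fun N => ?_⟩
    have h1 : 1 ≤ (N + 1) ^ c := Nat.one_le_pow _ _ (Nat.succ_pos N)
    have h2 : N * p.cost N ≤ N * (a * (N + 1) ^ c) := Nat.mul_le_mul_left _ (h N)
    have h3 : (4 + 3 * N) * 1 ≤ (4 + 3 * N) * (N + 1) ^ c := Nat.mul_le_mul_left _ h1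
    simp only [cost]
    calc 4 + N * (p.cost N + 3) = N * p.cost N + (4 + 3 * N) * 1 := by ring
      _ ≤ N * (a * (N + 1) ^ c) + (4 + 3 * N) * (N + 1) ^ c := add_le_add h2 h3
      _ ≤ (7 + a) * (N + 1) ^ (c + 1) := by
        rw [pow_succ]
        nlinarith [Nat.zero_le (a * (N + 1) ^ c), Nat.zero_le (N * (N + 1) ^ c)]
  | skip => exact ⟨1, 0, fun N => by simp [cost]⟩

end BoundedLoop

/-! ### Cuts, flows and labelings of networks on `{0, …, N - 1}` -/
namespace Network

open Finset
open scoped Classical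

/-- `R` is the source side of a cut between `X` and `Y`. -/
structure IsCut (N : ℕ) (X Y R : Set ℕ) : Prop where
  source : X ⊆ R
  sink : Disjoint R Y
  lt : ∀ w ∈ R, w < N

/-- The total capacity of the arcs leaving `R`. -/
noncomputable def cutWeight (N : ℕ) (c : ℕ → ℕ → ℕ) (R : Set ℕ) : ℕ :=
  ∑ u ∈ range N, ∑ v ∈ range N, if u ∈ R ∧ v ∉ R then c u v else 0

/-- The total capacity of the arcs along which the labels decrease. -/
noncomputable def descentCost (N : ℕ) (c : ℕ → ℕ → ℕ) (l : ℕ → ℕ) : ℕ :=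
  ∑ u ∈ range N, ∑ v ∈ range N, if l v < l u then c u v else 0

/-- The largest cut of minimum weight. -/
structure IsFarCut (N : ℕ) (c : ℕ → ℕ → ℕ) (X Y R : Set ℕ) : Prop where
  isCut : IsCut N X Y R
  le : ∀ S, IsCut N X Y S → cutWeight N c R ≤ cutWeight N c S
  subset : ∀ S, IsCut N X Y S → cutWeight N c S ≤ cutWeight N c R → S ⊆ R

/-- `F` is the residual network of a flow of value `val` from `X` to `Y`, seen through its cuts. -/
def IsResidual (N : ℕ) (c : ℕ → ℕ → ℕ) (X Y : Set ℕ) (val : ℕ) (F : ℕ → ℕ → ℕ) : Prop :=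
  ∀ R, IsCut N X Y R → cutWeight N c R = val + cutWeight N F R

variable {N : ℕ} {c F : ℕ → ℕ → ℕ} {X Y R S : Set ℕ} {l : ℕ → ℕ}

theorem sum_sum_le_sum_sum {f g : ℕ → ℕ → ℕ} (h : ∀ u < N, ∀ v < N, f u v ≤ g u v) :
    ∑ u ∈ range N, ∑ v ∈ range N, f u v ≤ ∑ u ∈ range N, ∑ v ∈ range N, g u v :=
  sum_le_sum fun u hu => sum_le_sum fun v hv => h u (mem_range.1 hu) v (mem_range.1 hv)

theorem sum_sum_eq_single {u v : ℕ} (hu : u < N) (hv : v < N) (p : ℕ → ℕ → Prop)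
    [∀ a b, Decidable (p a b)] (x : ℕ) :
    (∑ a ∈ range N, ∑ b ∈ range N, if p a b then (if a = u ∧ b = v then x else 0) else 0) =
      if p u v then x else 0 := by
  rw [sum_eq_single_of_mem u (mem_range.2 hu), sum_eq_single_of_mem v (mem_range.2 hv)]
  · simp
  · intro b _ hb
    simp [hb]
  · intro a _ ha
    exact sum_eq_zero fun b _ => by simp [ha]

theorem cutWeight_eq_zero_iff :
    cutWeight N c R = 0 ↔ ∀ u < N, ∀ v < N, u ∈ R → v ∉ R → c u v = 0 := by
  simp only [cutWeight, sum_eq_zero_iff, mem_range]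
  refine forall₄_congr fun u _ v _ => ?_
  split_ifs with h
  · simp [h.1, h.2]
  · simp only [true_iff]
    exact fun h1 h2 => absurd ⟨h1, h2⟩ h

theorem le_cutWeight {u v : ℕ} (hu : u < N) (hv : v < N) (huR : u ∈ R) (hvR : v ∉ R) :
    c u v ≤ cutWeight N c R := by
  calc c u v = ∑ a ∈ range N, ∑ b ∈ range N,
        if a ∈ R ∧ b ∉ R then (if a = u ∧ b = v then c u v else 0) else 0 := by
        rw [sum_sum_eq_single hu hv (fun a b => a ∈ R ∧ b ∉ R), if_pos ⟨huR, hvR⟩]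
    _ ≤ cutWeight N c R := sum_sum_le_sum_sum fun a _ b _ => by
        split_ifs with h1 h2
        · rw [h2.1, h2.2]
        · exact Nat.zero_le _
        · exact le_rfl

theorem cutWeight_congr {c' : ℕ → ℕ → ℕ} (h : ∀ u < N, ∀ v < N, c u v = c' u v) :
    cutWeight N c R = cutWeight N c' R :=
  sum_congr rfl fun u hu => sum_congr rfl fun v hv => by
    rw [h u (mem_range.1 hu) v (mem_range.1 hv)]

/-- Submodularity, which holds for each arc separately, according to the position of its two ends.
-/
theorem cutWeight_union_add_inter_le :
    cutWeight N c (R ∪ S) + cutWeight N c (R ∩ S) ≤ cutWeight N c R + cutWeight N c S := by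
  simp only [cutWeight, ← sum_add_distrib]
  refine sum_sum_le_sum_sum fun u _ v _ => ?_
  by_cases h1 : u ∈ R <;> by_cases h2 : u ∈ S <;> by_cases h3 : v ∈ R <;> by_cases h4 : v ∈ S <;>
    simp [h1, h2, h3, h4]

theorem IsCut.union (hR : IsCut N X Y R) (hS : IsCut N X Y S) : IsCut N X Y (R ∪ S) :=
  ⟨hR.source.trans Set.subset_union_left, hR.sink.union_left hS.sink,
    fun w hw => hw.elim (hR.lt w) (hS.lt w)⟩

theorem IsCut.inter (hR : IsCut N X Y R) (hS : IsCut N X Y S) : IsCut N X Y (R ∩ S) :=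
  ⟨Set.subset_inter hR.source hS.source, hR.sink.mono_left Set.inter_subset_left,
    fun w hw => hR.lt w hw.1⟩

/-- By submodularity the minimum cuts are closed under union, so a maximal one among the finitely
many contains all the others. -/
theorem exists_isFarCut (h : IsCut N X Y S) : ∃ R, IsFarCut N c X Y R := by
  let m := sInf (cutWeight N c '' {R | IsCut N X Y R})
  have hne : (cutWeight N c '' {R | IsCut N X Y R}).Nonempty := ⟨_, S, h, rfl⟩
  have hm : ∀ R, IsCut N X Y R → m ≤ cutWeight N c R := fun R hR => Nat.sInf_le ⟨R, hR, rfl⟩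
  let C : Set (Set ℕ) := {R | IsCut N X Y R ∧ cutWeight N c R = m}
  have hC : C.Finite := (Set.finite_Iio N).finite_subsets.subset fun R hR w hw => hR.1.lt w hw
  obtain ⟨R₀, hR₀, hR₀m⟩ := Nat.sInf_mem hne
  have hCne : C.Nonempty := ⟨R₀, hR₀, hR₀m⟩
  obtain ⟨R, hR⟩ := hC.exists_maximal hCne
  refine ⟨R, hR.prop.1, fun S hS => hR.prop.2.trans_le (hm S hS), fun S hS hSR => ?_⟩
  have h1 := cutWeight_union_add_inter_le (N := N) (c := c) (R := R) (S := S)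
  have h2 := hm _ (hR.prop.1.inter hS)
  have h3 := hm _ (hR.prop.1.union hS)
  have h4 := hR.prop.2
  -- Union and intersection weigh at least `m` each and at most `2 * m` together, so the union is a
  -- minimum cut.
  have hmem : R ∪ S ∈ C := ⟨hR.prop.1.union hS, by omega⟩
  exact Set.subset_union_right.trans (hR.le_of_ge hmem Set.subset_union_left)

theorem IsFarCut.eq (hR : IsFarCut N c X Y R) (hS : IsFarCut N c X Y S) : R = S :=
  Set.Subset.antisymm (hS.subset R hR.isCut (hR.le S hS.isCut))
    (hR.subset S hS.isCut (hS.le R hR.isCut))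

theorem IsFarCut.congr {c' : ℕ → ℕ → ℕ} (h : IsFarCut N c X Y R)
    (hc : ∀ u < N, ∀ v < N, c u v = c' u v) : IsFarCut N c' X Y R where
  isCut := h.isCut
  le S hS := by
    rw [← cutWeight_congr hc, ← cutWeight_congr hc]
    exact h.le S hS
  subset S hS hSR := by
    rw [← cutWeight_congr hc, ← cutWeight_congr hc] at hSR
    exact h.subset S hS hSR

/-- The intersection with `R` is again a cut, hence no lighter than `R`; submodularity passes the
gain on to the union. -/
theorem IsFarCut.cutWeight_union_le (hR : IsFarCut N c X Y R) (hS : IsCut N X Y S) :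
    cutWeight N c (S ∪ R) ≤ cutWeight N c S := by
  have h1 := cutWeight_union_add_inter_le (N := N) (c := c) (R := S) (S := R)
  have h2 := hR.le _ (hS.inter hR.isCut)
  omega

/-- Raising the labels on a far cut to the maximum does not increase the cost. -/
theorem IsFarCut.descentCost_le {i : ℕ} (hR : IsFarCut N c X Y R) (hl : ∀ w, l w ≤ i)
    (hcut : IsCut N X Y {w | w < N ∧ l w = i}) :
    descentCost N c (fun w => if w ∈ R then i else l w) ≤ descentCost N c l := by
  -- Descents that start at the top label are exactly the arcs leaving the top class, so the cost is
  -- a cut weight plus the descents that start lower.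
  have split : ∀ l' : ℕ → ℕ, (∀ w, l' w ≤ i) → descentCost N c l' =
      cutWeight N c {w | w < N ∧ l' w = i} + ∑ u ∈ range N, ∑ v ∈ range N,
        if l' v < l' u ∧ l' u < i then c u v else 0 := by
    intro l' hl'
    simp only [descentCost, cutWeight, ← sum_add_distrib]
    refine sum_congr rfl fun u hu => sum_congr rfl fun v hv => ?_
    have h1 := hl' u
    have h2 := hl' v
    have h3 := mem_range.1 hu
    have h4 := mem_range.1 hv
    simp only [Set.mem_ofPred_eq, h3, h4, true_and]
    rcases h1.eq_or_lt with h | h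
    · rw [h]
      simp only [true_and, lt_irrefl, and_false, if_false, add_zero]
      exact if_congr (by omega) rfl rfl
    · simp [h, h.ne]
  rw [split l hl, split _ fun w => by split_ifs; exacts [le_rfl, hl w]]
  refine add_le_add ?_ (sum_sum_le_sum_sum fun u _ v _ => ?_)
  · have : {w | w < N ∧ (if w ∈ R then i else l w) = i} = {w | w < N ∧ l w = i} ∪ R := by
      ext w
      have := hR.isCut.lt w
      by_cases h : w ∈ R <;> simp [h]
      exact this h
    rw [this]
    exact hR.cutWeight_union_le hcut
  -- No lower descent is created: an arc with raised head does not descend, and one with raised tail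
  -- is no longer counted here.
  · by_cases hu : u ∈ R <;> by_cases hv : v ∈ R <;> simp only [hu, hv, if_true, if_false]
    · simp
    · simp
    · have : ¬(i < l u ∧ l u < i) := by omega
      simp [this]
    · exact le_rfl

theorem descentCost_min_le (i : ℕ) : descentCost N c (fun w => min (l w) i) ≤ descentCost N c l :=
  sum_sum_le_sum_sum fun u _ v _ => by
    split_ifs with h1 h2
    · exact le_rfl
    · dsimp only at h1
      omega
    · exact Nat.zero_le _
    · exact le_rfl

/-- An arc leaving the top class goes to a smaller label. This is how the budget bounds the minimum
cut. -/
theorem cutWeight_le_descentCost {i : ℕ} (hl : ∀ w, l w ≤ i) :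
    cutWeight N c {w | w < N ∧ l w = i} ≤ descentCost N c l :=
  sum_sum_le_sum_sum fun u _ v hv => by
    split_ifs with h1 h2
    · exact le_rfl
    · refine absurd h1 fun h => ?_
      have := hl v
      have h3 := h.1.2
      have h4 : l v ≠ i := fun h' => h.2 ⟨hv, h'⟩
      omega
    · exact Nat.zero_le _
    · exact le_rfl

/-- Pushing one unit of flow along an arc. -/
theorem cutWeight_push {F' : ℕ → ℕ → ℕ} {u v : ℕ} (hu : u < N) (hv : v < N)
    (h : ∀ a < N, ∀ b < N, F' a b + (if a = u ∧ b = v then 1 else 0) =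
      F a b + if a = v ∧ b = u then 1 else 0) :
    cutWeight N F' R + (if u ∈ R then 1 else 0) = cutWeight N F R + if v ∈ R then 1 else 0 := by
  -- Only the arcs between `u` and `v` change. The balance is kept additive because subtraction
  -- truncates.
  have key : cutWeight N F' R + (if u ∈ R ∧ v ∉ R then 1 else 0) =
      cutWeight N F R + if v ∈ R ∧ u ∉ R then 1 else 0 := by
    rw [← sum_sum_eq_single hu hv (fun a b => a ∈ R ∧ b ∉ R) 1,
      ← sum_sum_eq_single hv hu (fun a b => a ∈ R ∧ b ∉ R) 1]
    simp only [cutWeight, ← sum_add_distrib]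
    refine sum_congr rfl fun a ha => sum_congr rfl fun b hb => ?_
    have := h a (mem_range.1 ha) b (mem_range.1 hb)
    split_ifs at this ⊢ <;> omega
  by_cases h1 : u ∈ R <;> by_cases h2 : v ∈ R <;> simp [h1, h2] at key ⊢ <;> omega

/-- Weight and residual weight differ by the same constant for all cuts, so minimum cuts are those
of residual weight zero. -/
theorem IsResidual.isFarCut {val : ℕ} (h : IsResidual N c X Y val F) (hR : IsCut N X Y R)
    (h0 : cutWeight N F R = 0) (hmax : ∀ S, IsCut N X Y S → cutWeight N F S = 0 → S ⊆ R) :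
    IsFarCut N c X Y R where
  isCut := hR
  le S hS := by rw [h R hR, h S hS, h0]; omega
  subset S hS hSR := hmax S hS (by rw [h R hR, h S hS, h0] at hSR; omega)

end Network

/-! ### Branching on far cuts -/
namespace Network

open Finset
open scoped Classical

/-- The capacities of the split network of a digraph with arc relation `E` on `{0, …, n - 1}` after
deletion of the vertices in `Z`: the vertex `v` becomes an arc from `v` to `v + n`. -/
noncomputable def splitCap (n N : ℕ) (E : ℕ → ℕ → Prop) (Z : Finset ℕ) (u v : ℕ) : ℕ :=
  if u < n ∧ v = u + n then (if u ∈ Z then 0 else 1)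
  else if n ≤ u ∧ u < 2 * n ∧ v < n ∧ E (u - n) v then N else 0

/-- A network with terminal labels, where label `0` marks the nodes that are not terminals. -/
structure Labeled where
  /-- the number of vertices -/
  n : ℕ
  /-- the number of nodes of the network -/
  N : ℕ
  /-- the arc relation -/
  E : ℕ → ℕ → Prop
  /-- the label of a node -/
  label : ℕ → ℕ
  /-- the number of vertices that may be deleted -/
  s : ℕ
  /-- vertices that have to be deleted -/
  base : Finset ℕ

namespace Labeled

variable (L : Labeled)

/-- The capacities after deletion of `Z`. -/
noncomputable def cap (Z : Finset ℕ) : ℕ → ℕ → ℕ := splitCap L.n L.N L.E Z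

/-- The terminals with a label less than `i`. -/
def sink (i : ℕ) : Set ℕ := {w | w < L.N ∧ L.label w ≠ 0 ∧ L.label w < i}

/-- There is no path from the terminals with label at least `i` to those with smaller labels. -/
def Separated (Z : Finset ℕ) (i : ℕ) : Prop :=
  ∃ S : Set ℕ, (∀ w < L.N, i ≤ L.label w → w ∈ S) ∧ Disjoint S (L.sink i) ∧
    ∀ u < L.N, ∀ v < L.N, u ∈ S → v ∉ S → L.cap Z u v = 0

/-- `Z` solves the separation problem given by the labels. -/
structure Solves (Z : Finset ℕ) : Prop where
  card_le : Z.card ≤ L.s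
  base_subset : L.base ⊆ Z
  lt : ∀ v ∈ Z, v < L.n
  separated : ∀ i, 0 < i → L.Separated Z i

/-- The vertices at which the boundary of `R` can be cut. -/
def crossing (Z : Finset ℕ) (R : Set ℕ) : Set ℕ := {v | v < L.n ∧ v ∉ Z ∧ v ∈ R ∧ v + L.n ∉ R}

/-- Whatever far cuts come up, following the choices `bs` for `m` rounds leads to a solution. Here
`Z` is the set of deleted vertices, `X` the set of sources, and `i` the current label. -/
def Wins : ℕ → List Bool → Finset ℕ → Set ℕ → ℕ → Prop
  | 0, _, Z, _, _ => L.Solves Z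
  | m + 1, bs, Z, X, i =>
    (∃ R, IsCut L.N X (L.sink i) R ∧ cutWeight L.N (L.cap Z) R < L.N) ∧
    ∀ R, IsFarCut L.N (L.cap Z) X (L.sink i) R →
      (L.crossing Z R = ∅ → Wins m bs Z (X ∪ {w | w < L.N ∧ i - 1 ≤ L.label w}) (i - 1)) ∧
      ∀ P, IsGreatest (L.crossing Z R) P → ∃ b bs', bs = b :: bs' ∧
        if b then Wins m bs' Z (R ∪ {P + L.n}) i else Wins m bs' (insert P Z) X i

/-- The labeling `l` shows that the separation can be completed with `b` further deletions, and all
cuts have weight at least `lam`. -/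
structure Feasible (Z : Finset ℕ) (X : Set ℕ) (i : ℕ) (l : ℕ → ℕ) (b lam : ℕ) : Prop where
  le : ∀ w, l w ≤ i
  lt : ∀ w ∈ X, w < L.N
  eq_of_mem : ∀ w ∈ X, l w = i
  eq_label : ∀ w ∈ L.sink i, l w = L.label w
  mem_of_le : ∀ w < L.N, i ≤ L.label w → w ∈ X
  cost_le : descentCost L.N (L.cap Z) l ≤ b
  lam_le : ∀ R, IsCut L.N X (L.sink i) R → lam ≤ cutWeight L.N (L.cap Z) R
  lt_size : b < L.N
  card_le : Z.card + b ≤ L.s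
  base_subset : L.base ⊆ Z
  deleted_lt : ∀ v ∈ Z, v < L.n
  separated : ∀ j, i < j → L.Separated Z j

/-! ### How the branching steps change a feasible labeling -/

variable {L} {Z : Finset ℕ} {X R : Set ℕ} {i b lam : ℕ} {l : ℕ → ℕ}

theorem Feasible.isCut (h : L.Feasible Z X i l b lam) :
    IsCut L.N X (L.sink i) {w | w < L.N ∧ l w = i} where
  source w hw := ⟨h.lt w hw, h.eq_of_mem w hw⟩
  sink := Set.disjoint_left.2 fun w hw hs => by
    have h1 := h.eq_label w hs
    have h2 : l w = i := hw.2
    have h3 : L.label w < i := hs.2.2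
    omega
  lt w hw := hw.1

theorem Feasible.cutWeight_le (h : L.Feasible Z X i l b lam) :
    cutWeight L.N (L.cap Z) {w | w < L.N ∧ l w = i} ≤ b :=
  (cutWeight_le_descentCost h.le).trans h.cost_le

/-- Arcs that come from edges have capacity `N`, so a cut lighter than `N` severs only the unit arcs
of vertices. -/
theorem cap_of_mem_crossing {u v : ℕ} (hu : u < L.N) (hv : v < L.N)
    (huR : u ∈ R) (hvR : v ∉ R) (hlt : cutWeight L.N (L.cap Z) R < L.N)
    (hc : L.cap Z u v ≠ 0) : u ∈ L.crossing Z R := by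
  have h1 := (le_cutWeight hu hv huR hvR).trans_lt hlt
  unfold cap splitCap at h1 hc
  split_ifs at h1 hc with h2 h3 h4
  · exact absurd rfl hc
  · exact ⟨h2.1, h3, huR, h2.2 ▸ hvR⟩
  · omega
  · exact absurd rfl hc

theorem cap_insert (P u v : ℕ) : L.cap (insert P Z) u v =
    if u = P ∧ P < L.n ∧ v = P + L.n then 0 else L.cap Z u v := by
  unfold cap splitCap
  by_cases h : u = P
  · subst h
    by_cases h1 : u < L.n ∧ v = u + L.n
    · simp [h1]
    · simp [h1]
  · simp [h]

theorem cap_insert_le (P u v : ℕ) : L.cap (insert P Z) u v ≤ L.cap Z u v := by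
  rw [cap_insert]
  split_ifs
  exacts [Nat.zero_le _, le_rfl]

theorem cap_crossing {P : ℕ} (hP : P ∈ L.crossing Z R) : L.cap Z P (P + L.n) = 1 := by
  simp [cap, splitCap, hP.1, hP.2.1]

theorem Separated.insert {j P : ℕ} (h : L.Separated Z j) : L.Separated (insert P Z) j := by
  obtain ⟨S, h1, h2, h3⟩ := h
  refine ⟨S, h1, h2, fun u hu v hv huS hvS => ?_⟩
  have := cap_insert_le (L := L) (Z := Z) P u v
  have := h3 u hu v hv huS hvS
  omega

/-- The next label is considered when there is nothing left to cut. -/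
theorem Feasible.lower (h : L.Feasible Z X i l b lam)
    (hR : IsFarCut L.N (L.cap Z) X (L.sink i) R) (hcr : L.crossing Z R = ∅) :
    lam = 0 ∧
    L.Feasible Z (X ∪ {w | w < L.N ∧ i - 1 ≤ L.label w}) (i - 1) (fun w => min (l w) (i - 1)) b 0 := by
  have hlt : cutWeight L.N (L.cap Z) R < L.N :=
    ((hR.le _ h.isCut).trans h.cutWeight_le).trans_lt h.lt_size
  -- A light cut severing a positive arc would be crossed at a vertex. So the far cut has weight
  -- zero, which certifies the separation at `i` and forces `lam = 0`; resetting `lam` then leaves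
  -- `2 * b - lam` unchanged.
  have hzero : ∀ u < L.N, ∀ v < L.N, u ∈ R → v ∉ R → L.cap Z u v = 0 := by
    intro u hu v hv huR hvR
    by_contra hc
    have := cap_of_mem_crossing hu hv huR hvR hlt hc
    rw [hcr] at this
    exact this
  refine ⟨Nat.le_zero.1 ((h.lam_le R hR.isCut).trans (cutWeight_eq_zero_iff.2 hzero).le), ?_⟩
  have hsink : ∀ w, w < L.N → L.label w ≠ 0 → L.label w < i → l w = L.label w :=
    fun w h1 h2 h3 => h.eq_label w ⟨h1, h2, h3⟩
  refine ⟨fun w => min_le_right _ _, ?_, ?_, ?_, ?_, ?_, fun _ _ => Nat.zero_le _, h.lt_size,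
    h.card_le, h.base_subset, h.deleted_lt, ?_⟩
  · rintro w (hw | hw)
    exacts [h.lt w hw, hw.1]
  · rintro w (hw | ⟨hw, hw'⟩)
    · have := h.eq_of_mem w hw
      omega
    · by_cases h1 : i ≤ L.label w
      · have := h.eq_of_mem w (h.mem_of_le w hw h1)
        omega
      -- Nodes of label `0` are added as sources only when `i - 1 = 0`, and then every truncated
      -- label is zero.
      · by_cases h2 : L.label w = 0
        · omega
        · have := hsink w hw h2 (by omega)
          omega
  · rintro w ⟨h1, h2, h3⟩
    have := hsink w h1 h2 (by omega)
    omega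
  · exact fun w hw hle => Or.inr ⟨hw, hle⟩
  · exact (descentCost_min_le _).trans h.cost_le
  · intro j hj
    rcases Nat.lt_or_ge i j with h1 | h1
    · exact h.separated j h1
    -- Only `j = i` is new. The far cut is the witness, since `X` contains all nodes of label at
    -- least `i`.
    · obtain rfl : j = i := by omega
      exact ⟨R, fun w hw hle => hR.isCut.source (h.mem_of_le w hw hle), hR.isCut.sink, hzero⟩

/-- The labels on the far cut may be assumed maximal. -/
theorem Feasible.raise (h : L.Feasible Z X i l b lam)
    (hR : IsFarCut L.N (L.cap Z) X (L.sink i) R) :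
    L.Feasible Z X i (fun w => if w ∈ R then i else l w) b (cutWeight L.N (L.cap Z) R) where
  le w := by
    split_ifs
    exacts [le_rfl, h.le w]
  lt := h.lt
  eq_of_mem w hw := if_pos (hR.isCut.source hw)
  eq_label w hw := by
    rw [if_neg fun hwR => Set.disjoint_left.1 hR.isCut.sink hwR hw, h.eq_label w hw]
  mem_of_le := h.mem_of_le
  cost_le := (hR.descentCost_le h.le h.isCut).trans h.cost_le
  lam_le := hR.le
  lt_size := h.lt_size
  card_le := h.card_le
  base_subset := h.base_subset
  deleted_lt := h.deleted_lt
  separated := h.separated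

/-- The branch in which the vertex is not deleted. -/
theorem Feasible.extend (hN : 2 * L.n ≤ L.N) (h : L.Feasible Z X i l b lam)
    (hR : IsFarCut L.N (L.cap Z) X (L.sink i) R) (hl : ∀ w ∈ R, l w = i) {P : ℕ}
    (hP : P ∈ L.crossing Z R) (hlP : l (P + L.n) = i) :
    L.Feasible Z (R ∪ {P + L.n}) i l b (cutWeight L.N (L.cap Z) R + 1) where
  le := h.le
  lt := by
    rintro w (hw | rfl)
    · exact hR.isCut.lt w hw
    · have := hP.1
      omega
  eq_of_mem := by
    rintro w (hw | rfl)
    exacts [hl w hw, hlP]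
  eq_label := h.eq_label
  mem_of_le w hw hle := Or.inl (hR.isCut.source (h.mem_of_le w hw hle))
  cost_le := h.cost_le
  lam_le S hS := by
    by_contra hlt
    have hS' : IsCut L.N X (L.sink i) S :=
      ⟨(hR.isCut.source.trans Set.subset_union_left).trans hS.source, hS.sink, hS.lt⟩
    -- A cut containing `P + L.n` that is no heavier than the far cut would lie inside it, but `P +
    -- L.n` does not. So the minimum rises by at least one.
    exact hP.2.2.2 (hR.subset S hS' (by omega) (hS.source (Or.inr rfl)))
  lt_size := h.lt_size
  card_le := h.card_le
  base_subset := h.base_subset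
  deleted_lt := h.deleted_lt
  separated := h.separated

/-- Deleting `P` removes a single unit arc. The predicate is left general because both descents and
cuts need this identity. -/
theorem sum_cap_insert (hN : 2 * L.n ≤ L.N) {P : ℕ} (hP : P ∈ L.crossing Z R)
    (p : ℕ → ℕ → Prop) [∀ u v, Decidable (p u v)] :
    (∑ u ∈ range L.N, ∑ v ∈ range L.N, if p u v then L.cap Z u v else 0) =
    (∑ u ∈ range L.N, ∑ v ∈ range L.N, if p u v then L.cap (insert P Z) u v else 0) +
      if p P (P + L.n) then 1 else 0 := by
  have hP1 := hP.1
  rw [← sum_sum_eq_single (show P < L.N by omega) (show P + L.n < L.N by omega) p 1]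
  simp only [← sum_add_distrib]
  refine sum_congr rfl fun u _ => sum_congr rfl fun v _ => ?_
  rw [cap_insert]
  by_cases h : u = P ∧ v = P + L.n
  · obtain ⟨rfl, rfl⟩ := h
    simp [cap_crossing hP, hP1]
  · have : ¬(u = P ∧ P < L.n ∧ v = P + L.n) := fun h' => h ⟨h'.1, h'.2.2⟩
    simp [h, this]

/-- The branch in which the vertex is deleted. -/
theorem Feasible.delete (hN : 2 * L.n ≤ L.N) (h : L.Feasible Z X i l b lam)
    {P : ℕ} (hP : P ∈ L.crossing Z R) (hlt : l (P + L.n) < l P) :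
    0 < b ∧ L.Feasible (insert P Z) X i l (b - 1) (lam - 1) := by
  have hcost := sum_cap_insert hN hP (fun u v => l v < l u)
  rw [if_pos hlt] at hcost
  have hcost' : descentCost L.N (L.cap Z) l =
    descentCost L.N (L.cap (insert P Z)) l + 1 := hcost
  have hb := h.cost_le
  have hb0 : 0 < b := by omega
  refine ⟨hb0, ⟨h.le, h.lt, h.eq_of_mem, h.eq_label, h.mem_of_le, by omega, fun S hS => ?_,
    by have := h.lt_size; omega, ?_,
    h.base_subset.trans (subset_insert P Z), ?_, fun j hj => (h.separated j hj).insert⟩⟩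
  -- A cut loses at most the unit arc of `P`, so the lower bound drops by at most one.
  · have h1 := h.lam_le S hS
    have h2 : cutWeight L.N (L.cap Z) S = cutWeight L.N (L.cap (insert P Z)) S + _ :=
      sum_cap_insert hN hP (fun u v => u ∈ S ∧ v ∉ S)
    split_ifs at h2 <;> omega
  · have := h.card_le
    rw [card_insert_of_notMem hP.2.1]
    omega
  · intro v hv
    rcases mem_insert.1 hv with rfl | hv
    exacts [hP.1, h.deleted_lt v hv]

/-- Each choice lowers `2 * b - lam` by at least one, so this measure bounds the bits that are used.
Rounds without a choice lower `i` and keep the measure, which gives the bound `i + (2 * b - lam)` on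
the rounds; at `i = 0` further rounds are idle. -/
theorem Feasible.exists_wins (hN : 2 * L.n ≤ L.N) (m : ℕ) :
    ∀ {Z : Finset ℕ} {X : Set ℕ} {i : ℕ} {l : ℕ → ℕ} {b lam : ℕ} (k : ℕ),
    L.Feasible Z X i l b lam → (i = 0 ∨ i + (2 * b - lam) ≤ m) → 2 * b - lam ≤ k →
    ∃ bs : List Bool, bs.length = k ∧ L.Wins m bs Z X i := by
  induction m with
  | zero =>
    intro Z X i l b lam k h hm _
    -- No rounds are left; the bits only pad the list to the prescribed length.
    refine ⟨List.replicate k false, List.length_replicate, ?_⟩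
    have h0 : i = 0 := by omega
    subst h0
    exact ⟨by have := h.card_le; omega, h.base_subset, h.deleted_lt, h.separated⟩
  | succ m ih =>
    intro Z X i l b lam k h hm hk
    have hcut : ∃ R, IsCut L.N X (L.sink i) R ∧ cutWeight L.N (L.cap Z) R < L.N :=
      ⟨_, h.isCut, h.cutWeight_le.trans_lt h.lt_size⟩
    obtain ⟨R, hR⟩ := exists_isFarCut (c := L.cap Z) h.isCut
    by_cases hcr : L.crossing Z R = ∅
    · obtain ⟨hlam, h'⟩ := h.lower hR hcr
      obtain ⟨bs, hbs, hw⟩ := ih k h' (by omega) (by omega)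
      refine ⟨bs, hbs, hcut, fun R' hR' => ?_⟩
      -- `Wins` quantifies over all far cuts, but there is only one.
      obtain rfl := hR'.eq hR
      refine ⟨fun _ => hw, fun P hP => ?_⟩
      rw [hcr] at hP
      exact absurd hP.1 (Set.notMem_empty P)
    -- For `i = 0` there are no sinks: the set of all nodes is a cut of weight zero, hence inside
    -- the far cut, and nothing crosses.
    · have hi : i ≠ 0 := by
        rintro rfl
        refine hcr (Set.eq_empty_of_forall_notMem fun P hP => hP.2.2.2 ?_)
        have hfull : IsCut L.N X (L.sink 0) (Set.Iio L.N) :=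
          ⟨h.lt, Set.disjoint_left.2 fun w _ hw => absurd hw.2.2 (Nat.not_lt_zero _), fun w hw => hw⟩
        refine hR.subset _ hfull (le_of_eq_of_le (cutWeight_eq_zero_iff.2
          fun u _ v hv _ hv' => absurd hv hv') (Nat.zero_le _)) ?_
        have := hP.1
        show P + L.n < L.N
        omega
      have hfin : (L.crossing Z R).Finite := (Set.finite_Iio L.n).subset fun v hv => hv.1
      obtain ⟨P, hP⟩ := hfin.exists_maximal (Set.nonempty_iff_ne_empty.2 hcr)
      have hPg : IsGreatest (L.crossing Z R) P := ⟨hP.prop, fun Q hQ => by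
        by_contra hlt
        exact hlt (hP.le_of_ge hQ (by omega))⟩
      have h' := h.raise hR
      have hlamR := h.lam_le R hR.isCut
      -- With the inequalities below, `lam` is at most this weight, which lies between `1` and `b`;
      -- so the truncated subtractions in the measure are exact.
      have hpos : 0 < cutWeight L.N (L.cap Z) R := by
        have hP1 := hP.prop.1
        have := le_cutWeight (c := L.cap Z) (show P < L.N by omega) (show P + L.n < L.N by omega)
          hP.prop.2.2.1 hP.prop.2.2.2
        rw [cap_crossing hP.prop] at this
        omega
      have hle := hR.le _ h.isCut
      have hle' := h.cutWeight_le
      have step : ∃ (bit : Bool) (bs' : List Bool), bs'.length + 1 = k ∧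
          if bit then L.Wins m bs' Z (R ∪ {P + L.n}) i else L.Wins m bs' (insert P Z) X i := by
        -- The raised labeling decides the bit: if the exit node of `P` has the top label, `P` is
        -- kept; otherwise the arc of `P` is a descent and `P` is deleted.
        by_cases hlP : (if P + L.n ∈ R then i else l (P + L.n)) = i
        · obtain ⟨bs, hbs, hw⟩ := ih (k - 1)
            (h'.extend hN hR (fun w hw => if_pos hw) hP.prop hlP) (by omega) (by omega)
          exact ⟨true, bs, by omega, by simpa using hw⟩
        · obtain ⟨hb0, h''⟩ := h'.delete hN hP.prop (by
            have := h'.le (P + L.n)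
            simp only [hP.prop.2.2.1, if_true] at this ⊢
            omega)
          obtain ⟨bs, hbs, hw⟩ := ih (k - 1) h'' (by omega) (by omega)
          exact ⟨false, bs, by omega, by simpa using hw⟩
      obtain ⟨bit, bs', hlen, hw⟩ := step
      refine ⟨bit :: bs', by simpa using hlen, hcut, fun R' hR' => ?_⟩
      obtain rfl := hR'.eq hR
      refine ⟨fun h0 => absurd h0 hcr, fun Q hQ => ?_⟩
      obtain rfl := hQ.unique hPg
      exact ⟨bit, bs', rfl, hw⟩

end Labeled

end Network

/-! ### Balanced separators and labeled networks -/
namespace Network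

open Finset
open scoped Classical

/-- There is a walk from `u` to `v` that avoids `Z`, or `u = v`. -/
def AvoidReach (E : ℕ → ℕ → Prop) (Z : Finset ℕ) : ℕ → ℕ → Prop :=
  Relation.ReflTransGen fun x y => x ∉ Z ∧ y ∉ Z ∧ E x y

/-- The terminals strongly connected to `t` after deletion of `Z`. -/
noncomputable def companions (E : ℕ → ℕ → Prop) (T Z : Finset ℕ) (t : ℕ) : Finset ℕ :=
  T.filter fun t' => t' ∉ Z ∧ AvoidReach E Z t t' ∧ AvoidReach E Z t' t

/-- After deletion of `Z` no terminal is strongly connected to more than `r` terminals. -/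
def Balanced (E : ℕ → ℕ → Prop) (T : Finset ℕ) (r : ℕ) (Z : Finset ℕ) : Prop :=
  ∀ t ∈ T, t ∉ Z → (companions E T Z t).card ≤ r

/-- Both nodes of a terminal carry its label. -/
noncomputable def nodeLabel (n : ℕ) (T : Finset ℕ) (g : ℕ → ℕ) (w : ℕ) : ℕ :=
  if w ∈ T then g w else if n ≤ w ∧ w - n ∈ T then g (w - n) else 0

/-- The labeled network in which terminals with label `0` are deleted. -/
noncomputable def labeled (n N : ℕ) (E : ℕ → ℕ → Prop) (T : Finset ℕ) (s : ℕ) (g : ℕ → ℕ) :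
    Labeled where
  n := n
  N := N
  E := E
  label := nodeLabel n T g
  s := s
  base := T.filter fun t => g t = 0

/-- Walks in the split network. -/
def NetReach (n N : ℕ) (E : ℕ → ℕ → Prop) (Z : Finset ℕ) : ℕ → ℕ → Prop :=
  Relation.ReflTransGen fun a b => splitCap n N E Z a b ≠ 0

variable {n N r s : ℕ} {E : ℕ → ℕ → Prop} {T Z : Finset ℕ} {g : ℕ → ℕ}

theorem splitCap_ne_zero_iff (hN : 0 < N) {a b : ℕ} : splitCap n N E Z a b ≠ 0 ↔
    (a < n ∧ b = a + n ∧ a ∉ Z) ∨ (n ≤ a ∧ a < 2 * n ∧ b < n ∧ E (a - n) b) := by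
  unfold splitCap
  by_cases h1 : a < n
  · have h2 : ¬ n ≤ a := by omega
    by_cases h3 : b = a + n <;> by_cases h4 : a ∈ Z <;> simp [h1, h2, h3, h4]
  · by_cases h5 : n ≤ a ∧ a < 2 * n ∧ b < n ∧ E (a - n) b <;> simp [h1, h5]
    omega

/-- A step from `x` to `y` becomes the walk `x`, `x + n`, `y`, for which only `x` has to survive. -/
theorem netReach_of_avoidReach (hN : 0 < N) (hE : ∀ x y, E x y → x < n ∧ y < n) {u v : ℕ}
    (h : AvoidReach E Z u v) : NetReach n N E Z u v := by
  induction h with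
  | refl => exact .refl
  | tail _ hxy ih =>
    obtain ⟨hx, _, hxy⟩ := hxy
    obtain ⟨hxn, hyn⟩ := hE _ _ hxy
    refine (ih.tail ((splitCap_ne_zero_iff hN).2 (.inl ⟨hxn, rfl, hx⟩))).tail
      ((splitCap_ne_zero_iff hN).2 (.inr ⟨by omega, by omega, hyn, by simpa using hxy⟩))

/-- Walks in the network may enter a deleted vertex but not leave it. So survival of the last vertex
must be assumed at an entry node and comes for free at an exit node. -/
theorem avoidReach_of_netReach (hN : 0 < N) {u w : ℕ} (hu : u < n)
    (h : NetReach n N E Z u w) :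
    (w < n ∧ (u ∉ Z → w ∉ Z → AvoidReach E Z u w)) ∨
      (n ≤ w ∧ w < 2 * n ∧ w - n ∉ Z ∧ (u ∉ Z → AvoidReach E Z u (w - n))) := by
  induction h with
  | refl => exact .inl ⟨hu, fun _ _ => .refl⟩
  | @tail a b _ hab ih =>
    rcases (splitCap_ne_zero_iff hN).1 hab with ⟨h1, rfl, h3⟩ | ⟨h1, h2, h3, h4⟩
    · rcases ih with ⟨_, ih⟩ | ih
      · exact .inr ⟨by omega, by omega, by simpa using h3, fun hu => by simpa using ih hu h3⟩
      · omega
    · rcases ih with ih | ⟨_, _, ih1, ih2⟩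
      · omega
      · exact .inl ⟨h3, fun hu hb => (ih2 hu).tail ⟨ih1, hb, h4⟩⟩

/-- A finite preorder can be numbered so that equal numbers mean equivalent elements. -/
theorem exists_numbering (S : Finset ℕ) (ρ : ℕ → ℕ → Prop) (hrefl : ∀ x, ρ x x)
    (htrans : ∀ x y z, ρ x y → ρ y z → ρ x z) :
    ∃ f : ℕ → ℕ, (∀ x ∈ S, 0 < f x ∧ f x ≤ S.card) ∧
      (∀ x ∈ S, ∀ y ∈ S, ρ x y → f x ≤ f y) ∧
      ∀ x ∈ S, ∀ y ∈ S, f x = f y → ρ x y := by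
  -- The number of elements below `x` increases strictly along strict relations, and the least
  -- member of the class tells apart inequivalent elements with equal counts. The numbering is the
  -- rank in the lexicographic order of these pairs.
  let c : ℕ → ℕ := fun x => (S.filter fun y => ρ y x).card
  let m : ℕ → ℕ := fun x => sInf {y | y ∈ S ∧ ρ x y ∧ ρ y x}
  have hm : ∀ x ∈ S, m x ∈ S ∧ ρ x (m x) ∧ ρ (m x) x := fun x hx =>
    Nat.sInf_mem (s := {y | y ∈ S ∧ ρ x y ∧ ρ y x}) ⟨x, hx, hrefl x, hrefl x⟩
  let key : ℕ → ℕ ×ₗ ℕ := fun x => toLex (c x, m x)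
  have hkey : ∀ x ∈ S, ∀ y ∈ S, key x = key y → ρ x y := by
    intro x hx y hy h
    have h2 : m x = m y := (Prod.ext_iff.1 (toLex.injective h)).2
    exact htrans _ _ _ (hm x hx).2.1 (h2 ▸ (hm y hy).2.2)
  have hmono : ∀ x ∈ S, ∀ y ∈ S, ρ x y → key x ≤ key y := by
    intro x hx y hy hxy
    have hsub : (S.filter fun z => ρ z x) ⊆ S.filter fun z => ρ z y := fun z hz =>
      mem_filter.2 ⟨(mem_filter.1 hz).1, htrans _ _ _ (mem_filter.1 hz).2 hxy⟩
    rcases (card_le_card hsub).lt_or_eq with h | h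
    · exact Prod.Lex.toLex_le_toLex.2 (.inl h)
    · have hyx : ρ y x := by
        have : y ∈ S.filter fun z => ρ z x := by
          rw [eq_of_subset_of_card_le hsub h.ge]
          exact mem_filter.2 ⟨hy, hrefl y⟩
        exact (mem_filter.1 this).2
      have hmm : m x = m y := by
        have : {z | z ∈ S ∧ ρ x z ∧ ρ z x} = {z | z ∈ S ∧ ρ y z ∧ ρ z y} := by
          ext z
          exact ⟨fun h => ⟨h.1, htrans _ _ _ hyx h.2.1, htrans _ _ _ h.2.2 hxy⟩,
            fun h => ⟨h.1, htrans _ _ _ hxy h.2.1, htrans _ _ _ h.2.2 hyx⟩⟩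
        simp only [m, this]
      exact Prod.Lex.toLex_le_toLex.2 (.inr ⟨h, hmm.le⟩)
  refine ⟨fun x => (S.filter fun y => key y ≤ key x).card, fun x hx =>
    ⟨card_pos.2 ⟨x, mem_filter.2 ⟨hx, le_rfl⟩⟩, card_filter_le _ _⟩, fun x hx y hy hxy =>
    card_le_card fun z hz => mem_filter.2 ⟨(mem_filter.1 hz).1,
      (mem_filter.1 hz).2.trans (hmono x hx y hy hxy)⟩, fun x hx y hy hxy => ?_⟩
  have aux : ∀ x ∈ S, ∀ y ∈ S, (S.filter fun z => key z ≤ key x).card =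
      (S.filter fun z => key z ≤ key y).card → key y ≤ key x := by
    intro x hx y hy h
    by_contra hlt
    have hlt : key x < key y := not_le.1 hlt
    refine h.not_lt (card_lt_card ⟨fun z hz => mem_filter.2 ⟨(mem_filter.1 hz).1,
      (mem_filter.1 hz).2.trans hlt.le⟩, fun hsub => ?_⟩)
    exact hlt.not_ge (mem_filter.1 (hsub (mem_filter.2 ⟨hy, le_rfl⟩))).2
  exact hkey x hx y hy ((aux y hy x hx hxy.symm).antisymm (aux x hx y hy hxy))

theorem AvoidReach.trans {x y z : ℕ} (h : AvoidReach E Z x y) (h' : AvoidReach E Z y z) :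
    AvoidReach E Z x z := Relation.ReflTransGen.trans h h'

theorem nodeLabel_of_mem {t : ℕ} (ht : t ∈ T) : nodeLabel n T g t = g t := if_pos ht

theorem nodeLabel_cases {w : ℕ} (h : nodeLabel n T g w ≠ 0) :
    ∃ t ∈ T, nodeLabel n T g w = g t ∧ (w = t ∨ w = t + n) := by
  unfold nodeLabel at h ⊢
  split_ifs at h ⊢ with h1 h2
  · exact ⟨w, h1, rfl, .inl rfl⟩
  · exact ⟨w - n, h2.2, rfl, .inr (by omega)⟩
  · exact absurd rfl h

/-- A balanced separator gives rise to a feasible labeled network all of whose solutions are balanced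
separators. -/
theorem Balanced.exists_label (hN : 2 * n ≤ N) (hn : 0 < N) (hE : ∀ x y, E x y → x < n ∧ y < n)
    (hT : ∀ t ∈ T, t < n) (hZ : ∀ v ∈ Z, v < n) (hs : Z.card ≤ s) (hsN : s < N)
    (hbal : Balanced E T r Z) :
    ∃ g : ℕ → ℕ, (∀ t ∈ T, g t ≤ T.card) ∧
      (∃ l b, b ≤ s ∧ (labeled n N E T s g).Feasible (T.filter fun t => g t = 0) ∅ (T.card + 1) l b 0) ∧
      ∀ Z', (labeled n N E T s g).Solves Z' → Balanced E T r Z' ∧ Z'.card ≤ s := by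
  obtain ⟨f, hf, hmono, hinj⟩ := exists_numbering (T \ Z) (AvoidReach E Z) (fun _ => .refl)
    fun _ _ _ => AvoidReach.trans
  -- Label `0` is free for deleted terminals because the numbering of the survivors starts at `1`.
  let g : ℕ → ℕ := fun t => if t ∈ Z then 0 else f t
  have hg : ∀ t ∈ T, g t ≠ 0 → t ∈ T \ Z ∧ g t = f t := by
    intro t ht h
    by_cases hz : t ∈ Z
    · simp [g, hz] at h
    · exact ⟨mem_sdiff.2 ⟨ht, hz⟩, if_neg hz⟩
  have hg' : ∀ t ∈ T \ Z, g t = f t := fun t ht => if_neg (mem_sdiff.1 ht).2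
  have hgcard : ∀ t ∈ T, g t ≤ T.card := by
    intro t ht
    by_cases hz : g t = 0
    · omega
    · obtain ⟨h1, h2⟩ := hg t ht hz
      exact h2 ▸ (hf t h1).2.trans (card_le_card sdiff_subset)
  have hbase : (T.filter fun t => g t = 0) = T ∩ Z := by
    ext t
    simp only [mem_filter, mem_inter]
    refine and_congr_right fun ht => ⟨fun h => ?_, fun h => if_pos h⟩
    by_contra hz
    have := hg' t (mem_sdiff.2 ⟨ht, hz⟩)
    have := (hf t (mem_sdiff.2 ⟨ht, hz⟩)).1
    omega
  have hlabel : ∀ w, nodeLabel n T g w ≤ T.card := by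
    intro w
    by_cases h : nodeLabel n T g w = 0
    · omega
    · obtain ⟨t, ht, h1, _⟩ := nodeLabel_cases h
      exact h1 ▸ hgcard t ht
  -- A node is labeled by the largest number of a surviving terminal that reaches it, and by `0` if
  -- there is none. The budget leaves out the deleted terminals, which belong to the base.
  refine ⟨g, hgcard, ⟨fun w => ((T \ Z).filter fun t => NetReach n N E Z t w).sup f, (Z \ T).card,
    (card_le_card sdiff_subset).trans hs, ?_⟩, fun Z' hZ' => ⟨fun t ht htZ' => ?_, hZ'.card_le⟩⟩
  · refine ⟨fun w => ?_, by simp, by simp, ?_, ?_, ?_, fun _ _ => Nat.zero_le _, ?_, ?_, le_rfl, ?_, ?_⟩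
    · refine Finset.sup_le fun t ht => ?_
      exact ((hf t (mem_filter.1 ht).1).2.trans (card_le_card sdiff_subset)).trans (Nat.le_succ _)
    · rintro w ⟨_, hw, _⟩
      change nodeLabel n T g w ≠ 0 at hw
      change _ = nodeLabel n T g w
      obtain ⟨t, ht, h1, h2⟩ := nodeLabel_cases hw
      obtain ⟨h3, h4⟩ := hg t ht (h1 ▸ hw)
      have htn := hT t ht
      have htZ := (mem_sdiff.1 h3).2
      rw [h1, h4]
      -- Terminals that reach `t` have numbers at most that of `t`, and `t` reaches both of its
      -- nodes.
      refine le_antisymm (Finset.sup_le fun t' ht' => ?_) (Finset.le_sup (f := f)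
        (mem_filter.2 ⟨h3, ?_⟩))
      · obtain ⟨h5, h6⟩ := mem_filter.1 ht'
        refine hmono t' h5 t h3 ?_
        have h7 := (mem_sdiff.1 h5).2
        rcases avoidReach_of_netReach hn (hT t' (mem_sdiff.1 h5).1) h6 with
          ⟨h8, h9⟩ | ⟨h8, _, h9, h10⟩
        · obtain rfl : w = t := by omega
          exact h9 h7 htZ
        · obtain rfl : w = t + n := by omega
          simpa using h10 h7
      · rcases h2 with rfl | rfl
        · exact .refl
        · exact .single ((splitCap_ne_zero_iff hn).2 (.inl ⟨htn, rfl, htZ⟩))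
    · intro w _ hw
      exact absurd (hlabel w) (not_le.2 hw)
    · rw [hbase]
      -- Along an arc that survives the deletion of `Z` the set of terminals reaching a node only
      -- grows. So every descent of positive capacity is the unit arc of a vertex in `Z \ T`.
      calc _ ≤ ∑ u ∈ range N, ∑ v ∈ range N, if u ∈ Z \ T then (if v = u + n then 1 else 0) else 0 := by
            refine sum_sum_le_sum_sum fun u hu v hv => ?_
            split_ifs with h1 h2 h3 h3
            · subst h3
              have hun : u < n := hZ u (mem_sdiff.1 h2).1
              have hone : splitCap n N E (T ∩ Z) u (u + n) ≤ 1 := by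
                simp only [splitCap, hun, true_and, if_true]
                split_ifs <;> omega
              exact hone
            · have hun : u < n := hZ u (mem_sdiff.1 h2).1
              have hzero : splitCap n N E (T ∩ Z) u v = 0 := by
                by_contra hne
                rcases (splitCap_ne_zero_iff hn).1 hne with h | h <;> omega
              exact hzero.le
            · by_contra hne
              have hne : splitCap n N E (T ∩ Z) u v ≠ 0 := fun h => hne h.le
              have hstep : splitCap n N E Z u v ≠ 0 := by
                rw [splitCap_ne_zero_iff hn] at hne ⊢
                refine hne.imp_left fun h => ⟨h.1, h.2.1, fun hz => ?_⟩
                exact h2 (mem_sdiff.2 ⟨hz, fun ht => h.2.2 (mem_inter.2 ⟨ht, hz⟩)⟩)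
              refine absurd h1 (not_lt.2 (Finset.sup_mono fun t ht => ?_))
              obtain ⟨h4, h5⟩ := mem_filter.1 ht
              exact mem_filter.2 ⟨h4, h5.tail hstep⟩
            · exact Nat.zero_le _
            · exact le_rfl
            · exact le_rfl
        _ ≤ ∑ u ∈ range N, if u ∈ Z \ T then 1 else 0 := by
            refine sum_le_sum fun u _ => ?_
            by_cases h : u ∈ Z \ T
            · simp only [h, if_true, sum_ite_eq']
              split_ifs <;> omega
            · simp [h]
        _ ≤ (Z \ T).card := by
            rw [sum_ite, sum_const_zero, add_zero, sum_const, smul_eq_mul, mul_one]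
            exact card_le_card fun u hu => (mem_filter.1 hu).2
    · exact ((card_le_card sdiff_subset).trans hs).trans_lt hsN
    · change (T.filter fun t => g t = 0).card + (Z \ T).card ≤ s
      rw [hbase, inter_comm, add_comm, card_sdiff_add_card_inter]
      exact hs
    · intro v hv
      rw [hbase] at hv
      exact hZ v (mem_inter.1 hv).2
    · intro j hj
      -- No label exceeds `T.card`, so the empty set separates.
      refine ⟨∅, fun w _ hw => ?_, by simp, by simp⟩
      have h1 : nodeLabel n T g w ≤ T.card := hlabel w
      have h2 : j ≤ nodeLabel n T g w := hw
      omega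
  · have hsub : ∀ t ∈ T, t ∉ Z' → t ∈ T \ Z := by
      intro t ht h
      refine mem_sdiff.2 ⟨ht, fun hz => h (hZ'.base_subset ?_)⟩
      change t ∈ T.filter fun t => g t = 0
      rw [hbase]
      exact mem_inter.2 ⟨ht, hz⟩
    -- A walk from `u` that avoids `Z'` stays in the set `S` that separates at `f u`, and `S`
    -- contains no positive label below `f u`.
    have hlt : ∀ u ∈ T, ∀ v ∈ T, u ∉ Z' → v ∉ Z' → AvoidReach E Z' u v → f u ≤ f v := by
      intro u hu v hv huZ hvZ huv
      by_contra hlt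
      have hu' := hsub u hu huZ
      have hv' := hsub v hv hvZ
      obtain ⟨S, h1, h2, h3⟩ := hZ'.separated (f u) (hf u hu').1
      have hun := hT u hu
      have hvn := hT v hv
      have closed : ∀ w, NetReach n N E Z' u w → w ∈ S ∧ w < N := by
        intro w hw
        induction hw with
        | refl =>
          refine ⟨h1 u (show u < N by omega) ?_, by omega⟩
          change f u ≤ nodeLabel n T g u
          rw [nodeLabel_of_mem hu, hg' u hu']
        | @tail a b _ hab ih =>
          have hbN : b < N := by
            rcases (splitCap_ne_zero_iff hn).1 hab with h | h <;> omega
          refine ⟨?_, hbN⟩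
          by_contra hb
          exact hab (h3 a ih.2 b hbN ih.1 hb)
      refine Set.disjoint_left.1 h2 (closed v (netReach_of_avoidReach hn hE huv)).1
        ⟨show v < N by omega, ?_, ?_⟩
      · change nodeLabel n T g v ≠ 0
        rw [nodeLabel_of_mem hv, hg' v hv']
        exact (hf v hv').1.ne'
      · change nodeLabel n T g v < f u
        rw [nodeLabel_of_mem hv, hg' v hv']
        omega
    -- Terminals strongly connected after deletion of `Z'` have equal numbers, so they were strongly
    -- connected after deletion of `Z`.
    refine (card_le_card fun t' h => ?_).trans (hbal t ht (mem_sdiff.1 (hsub t ht htZ')).2)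
    obtain ⟨h1, h2, h3, h4⟩ := mem_filter.1 h
    have h5 := hsub t' h1 h2
    have h6 := hsub t ht htZ'
    have heq := (hlt t ht t' h1 htZ' h2 h3).antisymm (hlt t' h1 t ht h2 htZ' h4)
    exact mem_filter.2 ⟨h1, (mem_sdiff.1 h5).2, hinj t h6 t' h5 heq, hinj t' h5 t h6 heq.symm⟩

end Network

/-! ### The algorithm -/
namespace SeparatorProgram

open BoundedLoop Stmt Expr Network

/-! Names of the arrays; scalars are kept in cell `0` of an array of their own. -/
notation "aTerm" => (0 : ℕ)
notation "aAdj" => (1 : ℕ)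
notation "aRowN" => (2 : ℕ)
notation "aRown" => (3 : ℕ)
notation "aRank" => (4 : ℕ)
notation "aNum" => (5 : ℕ)
notation "aBound" => (6 : ℕ)
notation "aBudget" => (7 : ℕ)
notation "aAdvice" => (8 : ℕ)
notation "aLabel" => (9 : ℕ)
notation "aDel" => (10 : ℕ)
notation "aSrc" => (11 : ℕ)
notation "aSink" => (12 : ℕ)
notation "aRes" => (13 : ℕ)
notation "aDist" => (14 : ℕ)
notation "aNext" => (15 : ℕ)
notation "aReach" => (16 : ℕ)
notation "aStage" => (17 : ℕ)
notation "aPos" => (18 : ℕ)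
notation "aFound" => (19 : ℕ)
notation "aCur" => (20 : ℕ)
notation "aCount" => (21 : ℕ)
notation "aBad" => (22 : ℕ)
notation "aCarry" => (23 : ℕ)
notation "aRun" => (24 : ℕ)
notation "aAns" => (25 : ℕ)

/-- The value of a scalar. -/
def scalar (a : ℕ) : Expr := load a (lit 0)

/-- Assignment to a scalar. -/
def assign (a : ℕ) (e : Expr) : Stmt := store a (lit 0) e

/-- The number of terminals. -/
def numTerminals : Expr := load aRank size

/-- Entry `(e, f)` of a matrix with rows of length `size`. -/
def entry (a : ℕ) (e f : Expr) : Expr := load a (add (load aRowN e) f)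

/-- Breadth first search from the sinks, backwards along arcs with positive residual capacity. -/
def search : Stmt :=
  seq (forN (store aDist (var 0) (cond (load aSink (var 0)) (lit 1) (lit 0))))
    (forN (forN (forN (ite
      (cond (load aDist (var 1)) (lit 0) (cond (load aDist (var 0))
        (cond (sub (add (var 2) (lit 2)) (load aDist (var 0)))
          (entry aRes (var 1) (var 0)) (lit 0)) (lit 0)))
      (seq (store aDist (var 1) (add (var 2) (lit 2))) (store aNext (var 1) (var 0)))
      skip))))

/-- Push one unit of flow from the current node to the next one. -/
def pushArc : Stmt :=
  ite (load aSink (scalar aCur)) skip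
    (seq (store aRes (add (load aRowN (scalar aCur)) (load aNext (scalar aCur)))
      (sub (entry aRes (scalar aCur) (load aNext (scalar aCur))) (lit 1)))
    (seq (store aRes (add (load aRowN (load aNext (scalar aCur))) (scalar aCur))
      (add (entry aRes (load aNext (scalar aCur)) (scalar aCur)) (lit 1)))
    (assign aCur (load aNext (scalar aCur)))))

/-- Push one unit of flow from a source to a sink, if the search has reached a source. -/
def augment : Stmt :=
  seq (assign aFound (lit 0))
    (seq (forN (ite (cond (load aSrc (var 0)) (load aDist (var 0)) (lit 0))
      (seq (assign aFound (lit 1)) (assign aCur (var 0))) skip))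
    (ite (scalar aFound) (forN pushArc) skip))

/-- The capacity of the arc from `var 1` to `var 0`. -/
def capacity : Expr :=
  cond (sub (scalar aNum) (var 1))
    (cond (sub (var 0) (add (var 1) (scalar aNum))) (lit 0)
      (cond (sub (add (var 1) (scalar aNum)) (var 0)) (lit 0)
        (cond (load aDel (var 1)) (lit 0) (lit 1))))
    (cond (sub (add (scalar aNum) (scalar aNum)) (var 1))
      (cond (sub (scalar aNum) (var 0))
        (cond (load aAdj (add (load aRown (sub (var 1) (scalar aNum))) (var 0))) size (lit 0))
        (lit 0)) (lit 0))

/-- Set up the capacities. -/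
def build : Stmt := forN (forN (store aRes (add (load aRowN (var 1)) (var 0)) capacity))

/-- Compute a maximum flow and the nodes from which the sinks can be reached. -/
def maxFlow : Stmt := seq build (seq (forN (seq search augment)) search)

/-- Mark the terminals with a label below the current stage. -/
def markSinks : Stmt :=
  forN (store aSink (var 0) (cond (load aLabel (var 0))
    (cond (sub (scalar aStage) (load aLabel (var 0))) (lit 1) (lit 0)) (lit 0)))

/-- Find the last vertex at which the far cut can be cut. -/
def findCrossing : Stmt :=
  seq (assign aFound (lit 0))
    (forN (ite (cond (sub (scalar aNum) (var 0)) (cond (load aDel (var 0)) (lit 0)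
      (cond (load aDist (var 0)) (lit 0) (load aDist (add (var 0) (scalar aNum))))) (lit 0))
      (seq (assign aFound (lit 1)) (assign aCur (var 0))) skip))

/-- Branch on the crossing vertex as the advice says, or go on to the next stage. -/
def choose : Stmt :=
  ite (scalar aFound)
    (seq (ite (load aAdvice (scalar aPos))
      (seq (forN (store aSrc (var 0) (cond (load aDist (var 0)) (lit 0) (lit 1))))
        (store aSrc (add (scalar aCur) (scalar aNum)) (lit 1)))
      (store aDel (scalar aCur) (lit 1)))
      (assign aPos (add (scalar aPos) (lit 1))))
    (seq (assign aStage (sub (scalar aStage) (lit 1)))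
      (forN (ite (sub (add (load aLabel (var 0)) (lit 1)) (scalar aStage))
        (store aSrc (var 0) (lit 1)) skip)))

/-- One round of the branching. -/
def round : Stmt := seq markSinks (seq maxFlow (seq findCrossing choose))

/-- Read off the labels from the advice and initialize. -/
def prepare : Stmt :=
  seq (forN (store aLabel (var 0) (cond (sub (scalar aNum) (var 0))
      (cond (load aTerm (var 0)) (load aAdvice (load aRank (var 0))) (lit 0))
      (cond (load aTerm (sub (var 0) (scalar aNum)))
        (load aAdvice (load aRank (sub (var 0) (scalar aNum)))) (lit 0)))))
  (seq (forN (store aDel (var 0) (cond (load aTerm (var 0))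
      (cond (load aAdvice (load aRank (var 0))) (lit 0) (lit 1)) (lit 0))))
  (seq (forN (store aSrc (var 0) (lit 0)))
  (seq (assign aStage (add numTerminals (lit 1)))
  (assign aPos numTerminals))))

/-- Compute the candidate for the current advice. -/
def candidate : Stmt := seq prepare (forN round)

/-- Count the deleted vertices. -/
def checkSize : Stmt :=
  seq (assign aCount (lit 0))
  (seq (forN (assign aCount (add (scalar aCount)
    (cond (sub (scalar aNum) (var 0)) (cond (load aDel (var 0)) (lit 1) (lit 0)) (lit 0)))))
  (assign aBad (sub (scalar aCount) (scalar aBudget))))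

/-- Compute the reachability relation of the network without the deleted vertices. -/
def allReach : Stmt :=
  seq build (forN (seq
    (forN (store aSink (var 0) (cond (sub (var 0) (var 1)) (lit 0)
      (cond (sub (var 1) (var 0)) (lit 0) (lit 1)))))
    (seq search (forN (store aReach (add (load aRowN (var 1)) (var 0)) (load aDist (var 0)))))))

/-- Count the terminals strongly connected to each terminal. -/
def checkBalance : Stmt :=
  forN (ite (cond (load aTerm (var 0)) (cond (load aDel (var 0)) (lit 0) (lit 1)) (lit 0))
    (seq (assign aCount (lit 0))
    (seq (forN (assign aCount (add (scalar aCount)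
      (cond (load aTerm (var 0)) (cond (load aDel (var 0)) (lit 0)
        (cond (entry aReach (var 0) (var 1)) (cond (entry aReach (var 1) (var 0)) (lit 1) (lit 0))
          (lit 0))) (lit 0)))))
    (ite (sub (scalar aCount) (scalar aBound)) (assign aBad (lit 1)) skip)))
    skip)

/-- Test whether the candidate is a solution. -/
def check : Stmt := seq checkSize (seq allReach checkBalance)

/-- Go on to the next advice, or stop if there is none. -/
def advance : Stmt :=
  seq (assign aCarry (lit 1))
  (seq (forN (ite (cond (scalar aCarry)
      (sub (add numTerminals (add numTerminals numTerminals)) (var 0)) (lit 0))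
    (ite (sub numTerminals (load aAdvice (var 0)))
      (seq (store aAdvice (var 0) (add (load aAdvice (var 0)) (lit 1))) (assign aCarry (lit 0)))
      (store aAdvice (var 0) (lit 0))) skip))
  (ite (scalar aCarry) (assign aRun (lit 0)) skip))

/-- Test one advice. -/
def testAdvice : Stmt :=
  seq candidate (seq check
    (ite (scalar aBad) advance (seq (assign aAns (lit 1)) (assign aRun (lit 0)))))

/-- Fill the tables and deal with the case that all terminals may be deleted. -/
def setUp : Stmt :=
  seq (forN (store aRowN (add (var 0) (lit 1)) (add (load aRowN (var 0)) size)))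
  (seq (forN (store aRown (add (var 0) (lit 1)) (add (load aRown (var 0)) (scalar aNum))))
  (seq (forN (store aRank (add (var 0) (lit 1)) (add (load aRank (var 0))
    (cond (load aTerm (var 0)) (lit 1) (lit 0)))))
  (ite (sub numTerminals (scalar aBudget)) (assign aRun (lit 1))
    (seq (forN (store aDel (var 0) (load aTerm (var 0)))) (assign aAns (lit 1))))))

/-- Write the answer to the output array. -/
def finish : Stmt := forN (store aTerm (var 0) (load aDel (var 0)))

/-! ### Search and augmentation -/

/-- The matrix stored in array `a`. -/
def mat (N : ℕ) (s : Store) (a : ℕ) : ℕ → ℕ → ℕ := fun u v => s a (u * N + v)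

theorem mat_congr {N a : ℕ} {s s' : Store} (h : s' a = s a) : mat N s' a = mat N s a := by
  unfold mat
  rw [h]

/-- `B` and `P` are distances (increased by one) and pointers of a backward search in the network `F`
from the nodes with `Y w ≠ 0`, with distances at most `m`. -/
structure PartialSearch (N : ℕ) (F : ℕ → ℕ → ℕ) (Y B P : ℕ → ℕ) (m : ℕ) : Prop where
  le : ∀ w < N, B w ≤ m
  eq_one : ∀ w < N, B w = 1 ↔ Y w ≠ 0
  next : ∀ w < N, 2 ≤ B w → P w < N ∧ F w (P w) ≠ 0 ∧ B (P w) ≠ 0 ∧ B (P w) < B w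

/-- Every node with an arc into `B` is in `B`. -/
def Saturated (N : ℕ) (F : ℕ → ℕ → ℕ) (B : ℕ → ℕ) : Prop :=
  ∀ u < N, ∀ v < N, B v ≠ 0 → F u v ≠ 0 → B u ≠ 0

/-- A round of the search. -/
structure SearchRound (N : ℕ) (F : ℕ → ℕ → ℕ) (B₀ : ℕ → ℕ) (it : ℕ) (B : ℕ → ℕ) : Prop where
  keep : ∀ w < N, B₀ w ≠ 0 → B w = B₀ w
  fresh : ∀ w < N, B₀ w = 0 → B w ≠ 0 → B w = it + 2 ∧ ∃ v < N, B₀ v ≠ 0 ∧ F w v ≠ 0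

/-- New nodes get distance `it + 2`, and the guard admits only heads of smaller distance, that is,
nodes found before this round. So a round adds a single layer, although the array is updated in
place. -/
theorem search_round {N it : ℕ} {env : List ℕ} {s : Store} {Y : ℕ → ℕ}
    (ht : ∀ i < N, s aRowN i = i * N)
    (h : PartialSearch N (mat N s aRes) Y (s aDist) (s aNext) (it + 1)) :
    let s' := (forN (forN (ite
      (cond (load aDist (var 1)) (lit 0) (cond (load aDist (var 0))
        (cond (sub (add (var 2) (lit 2)) (load aDist (var 0)))
          (entry aRes (var 1) (var 0)) (lit 0)) (lit 0)))
      (seq (store aDist (var 1) (add (var 2) (lit 2))) (store aNext (var 1) (var 0)))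
      skip))).run N (it :: env) s
    PartialSearch N (mat N s aRes) Y (s' aDist) (s' aNext) (it + 2) ∧
      SearchRound N (mat N s aRes) (s aDist) it (s' aDist) ∧
      ∀ u < N, ∀ v < N, s aDist v ≠ 0 → mat N s aRes u v ≠ 0 → s' aDist u ≠ 0 := by
  intro s'
  have outer := Stmt.run_forN (N := N) (env := it :: env) (s := s)
    (p := forN (ite
      (cond (load aDist (var 1)) (lit 0) (cond (load aDist (var 0))
        (cond (sub (add (var 2) (lit 2)) (load aDist (var 0)))
          (entry aRes (var 1) (var 0)) (lit 0)) (lit 0)))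
      (seq (store aDist (var 1) (add (var 2) (lit 2))) (store aNext (var 1) (var 0)))
      skip))
    (fun k s' => PartialSearch N (mat N s aRes) Y (s' aDist) (s' aNext) (it + 2) ∧
      SearchRound N (mat N s aRes) (s aDist) it (s' aDist) ∧
      ∀ u < k, ∀ v < N, s aDist v ≠ 0 → mat N s aRes u v ≠ 0 → s' aDist u ≠ 0)
    ⟨⟨fun w hw => (h.le w hw).trans (Nat.le_succ _), h.eq_one, h.next⟩,
      ⟨fun _ _ _ => rfl, fun _ _ h1 h2 => absurd h1 h2⟩, by simp⟩ ?_
  · exact outer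
  · intro u hu s₁ hfr₁ ⟨hp₁, hr₁, hc₁⟩
    have inner := Stmt.run_forN (N := N) (env := u :: it :: env) (s := s₁)
      (p := ite
        (cond (load aDist (var 1)) (lit 0) (cond (load aDist (var 0))
          (cond (sub (add (var 2) (lit 2)) (load aDist (var 0)))
            (entry aRes (var 1) (var 0)) (lit 0)) (lit 0)))
        (seq (store aDist (var 1) (add (var 2) (lit 2))) (store aNext (var 1) (var 0)))
        skip)
      (fun k s' => PartialSearch N (mat N s aRes) Y (s' aDist) (s' aNext) (it + 2) ∧
        SearchRound N (mat N s aRes) (s aDist) it (s' aDist) ∧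
        ∀ u' v, u' < N → v < N → (u' < u ∨ u' = u ∧ v < k) → s aDist v ≠ 0 →
          mat N s aRes u' v ≠ 0 → s' aDist u' ≠ 0)
      ⟨hp₁, hr₁, fun u' v _ hv h => hc₁ u' (by omega) v hv⟩ ?_
    · exact ⟨inner.1, inner.2.1, fun u' hu' v hv => inner.2.2 u' v (by omega) hv (by omega)⟩
    · intro v hv s₂ hfr₂ ⟨hp, hr, hc⟩
      have hfr : ∀ a, a ≠ aDist → a ≠ aNext → s₂ a = s a := fun a h1 h2 => by
        rw [hfr₂ a (by simp [Stmt.writes, h1, h2]), hfr₁ a (by simp [Stmt.writes, h1, h2])]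
      have hF : s₂ aRes (u * N + v) = mat N s aRes u v := by
        rw [hfr aRes (by decide) (by decide)]
        rfl
      have hrow : s₂ aRowN u = u * N := by rw [hfr aRowN (by decide) (by decide), ht u hu]
      by_cases hcond : s₂ aDist u = 0 ∧ s₂ aDist v ≠ 0 ∧ s₂ aDist v < it + 2 ∧ mat N s aRes u v ≠ 0
      · obtain ⟨h1, h2, h3, h4⟩ := hcond
        have h3' : it + 2 - s₂ aDist v ≠ 0 := by omega
        have huv : u ≠ v := by
          rintro rfl
          exact h2 h1
        have hsu : s aDist u = 0 := by
          by_contra hne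
          have := hr.keep u hu hne
          omega
        have hsv : s aDist v ≠ 0 := by
          intro hz
          have := (hr.fresh v hv hz h2).1
          omega
        simp only [Stmt.run, Expr.eval, entry, List.getD_cons_succ, List.getD_cons_zero, hrow, hF,
          choice_of_eq h1, choice_of_ne h2, choice_of_ne h3', choice_of_ne h4]
        have e1 : ∀ w, ((s₂.set aDist u (it + 2)).set aNext u v) aDist w =
            if w = u then it + 2 else s₂ aDist w := fun w => by simp [Store.set_apply]
        have e2 : ∀ w, ((s₂.set aDist u (it + 2)).set aNext u v) aNext w =
            if w = u then v else s₂ aNext w := fun w => by simp [Store.set_apply]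
        refine ⟨⟨fun w hw => ?_, fun w hw => ?_, fun w hw => ?_⟩, ⟨fun w hw hne => ?_,
          fun w hw h0 => ?_⟩, fun u' v' hu' hv' h5 h6 h7 => ?_⟩
        · rw [e1]
          split_ifs
          exacts [le_rfl, hp.le w hw]
        · rw [e1]
          split_ifs with h5
          · subst h5
            have := hp.eq_one w hw
            rw [h1] at this
            exact ⟨fun h => by omega, fun h => absurd (this.2 h) (by omega)⟩
          · exact hp.eq_one w hw
        · rw [e1, e1, e2]
          by_cases h5 : w = u
          · subst h5
            simp only [if_true, if_neg huv.symm]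
            exact fun _ => ⟨hv, h4, h2, h3⟩
          · simp only [if_neg h5]
            intro h6
            obtain ⟨n1, n2, n3, n4⟩ := hp.next w hw h6
            -- Pointers lead to nodes already found, hence not to `u`, and remain valid when the
            -- distance of `u` is set.
            have : s₂ aNext w ≠ u := by
              intro h7
              rw [h7] at n3
              exact n3 h1
            simp only [if_neg this]
            exact ⟨n1, n2, n3, n4⟩
        · rw [e1, if_neg (by rintro rfl; exact hne hsu)]
          exact hr.keep w hw hne
        · rw [e1]
          split_ifs with h5
          · subst h5
            exact fun _ => ⟨rfl, v, hv, hsv, h4⟩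
          · exact hr.fresh w hw h0
        · rw [e1]
          split_ifs with h8
          · omega
          · exact hc u' v' hu' hv' (by omega) h6 h7
      · have hskip : (cond (load aDist (var 1)) (lit 0) (cond (load aDist (var 0))
            (cond (sub (add (var 2) (lit 2)) (load aDist (var 0)))
              (entry aRes (var 1) (var 0)) (lit 0)) (lit 0))).eval N (v :: u :: it :: env) s₂ = 0 := by
          simp only [Expr.eval, entry, List.getD_cons_succ, List.getD_cons_zero, hrow, hF]
          by_contra hne
          simp only [← ne_eq, choice_ne_zero_iff] at hne
          exact hcond ⟨by omega, by omega, by omega, by tauto⟩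
        rw [Stmt.run, choice_of_eq hskip, Stmt.run]
        refine ⟨hp, hr, fun u' v' hu' hv' h5 h6 h7 => ?_⟩
        -- A head found before this round has distance at most `it + 1` and passes the guard. If the
        -- pair was skipped all the same, `u` had been found already.
        by_cases h8 : u' = u ∧ v' = v
        · obtain ⟨rfl, rfl⟩ := h8
          intro h9
          have h10 := hr.keep v' hv h6
          have h11 := h.le v' hv
          exact hcond ⟨h9, by omega, by omega, h7⟩
        · exact hc u' v' hu' hv' (by omega) h6 h7

/-- A round that finds nothing new leaves a saturated set, and saturation persists. Otherwise the
number of nodes found grows, so after `N` rounds all nodes are found. -/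
theorem run_search {N : ℕ} {env : List ℕ} {s : Store} (ht : ∀ i < N, s aRowN i = i * N) :
    PartialSearch N (mat N s aRes) (s aSink) (search.run N env s aDist)
      (search.run N env s aNext) (N + 1) ∧
    Saturated N (mat N s aRes) (search.run N env s aDist) := by
  rw [search, Stmt.run]
  set s₀ := (forN (store aDist (var 0) (cond (load aSink (var 0)) (lit 1) (lit 0)))).run N env s
    with hs₀
  have hfr₀ : ∀ a, a ≠ aDist → s₀ a = s a := fun a h =>
    Stmt.run_of_notMem_writes _ _ (by simpa [Stmt.writes] using h) _ _
  have h0 : ∀ w < N, s₀ aDist w = if s aSink w ≠ 0 then 1 else 0 := fun w hw => by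
    rw [hs₀, run_forN_store (by decide) hw]
    by_cases h : s aSink w = 0 <;> simp [Expr.eval, choice, h]
    exact choice_of_ne h _ _
  have hres : mat N s aRes = mat N s₀ aRes :=
     (mat_congr (hfr₀ aRes (by decide))).symm
  have main := Stmt.run_forN (N := N) (env := env) (s := s₀)
    (p := forN (forN (ite
      (cond (load aDist (var 1)) (lit 0) (cond (load aDist (var 0))
        (cond (sub (add (var 2) (lit 2)) (load aDist (var 0)))
          (entry aRes (var 1) (var 0)) (lit 0)) (lit 0)))
      (seq (store aDist (var 1) (add (var 2) (lit 2))) (store aNext (var 1) (var 0)))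
      skip)))
    (fun it s' => PartialSearch N (mat N s aRes) (s aSink) (s' aDist) (s' aNext) (it + 1) ∧
      (Saturated N (mat N s aRes) (s' aDist) ∨
        it ≤ ((Finset.range N).filter fun w => s' aDist w ≠ 0).card)) ?_ ?_
  · refine ⟨main.1, main.2.elim id fun hcard u hu v hv _ _ => ?_⟩
    have hall := Finset.eq_of_subset_of_card_le (Finset.filter_subset _ (Finset.range N))
      (by rwa [Finset.card_range])
    have hmem := Finset.mem_range.2 hu
    rw [← hall] at hmem
    exact (Finset.mem_filter.1 hmem).2
  · refine ⟨⟨fun w hw => ?_, fun w hw => ?_, fun w hw h => ?_⟩, .inr (Nat.zero_le _)⟩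
    · rw [h0 w hw]
      split_ifs <;> omega
    · rw [h0 w hw]
      split_ifs with h <;> simp [h]
    · rw [h0 w hw] at h
      split_ifs at h <;> omega
  · intro it hit s' hfr ⟨hp, hsat⟩
    have hfr' : ∀ a, a ≠ aDist → a ≠ aNext → s' a = s a := fun a h1 h2 => by
      rw [hfr a (by simp [Stmt.writes, h1, h2]), hfr₀ a h1]
    have hres' : mat N s' aRes = mat N s aRes :=
      mat_congr (hfr' aRes (by decide) (by decide))
    have hround := search_round (N := N) (it := it) (env := env) (s := s') (Y := s aSink)
      (fun i hi => by rw [hfr' aRowN (by decide) (by decide), ht i hi]) (hres' ▸ hp)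
    rw [hres'] at hround
    obtain ⟨hp', hr, hc⟩ := hround
    refine ⟨hp', ?_⟩
    rcases hsat with hsat | hcard
    · left
      intro u hu v hv hv0 huv
      refine hc u hu v hv (fun hz => ?_) huv
      obtain ⟨_, x, hx, hx0, hvx⟩ := hr.fresh v hv hz hv0
      exact hsat v hv x hx hx0 hvx hz
    · by_cases hgrow : ∃ w < N, s' aDist w = 0 ∧ (forN (forN (ite
          (cond (load aDist (var 1)) (lit 0) (cond (load aDist (var 0))
            (cond (sub (add (var 2) (lit 2)) (load aDist (var 0)))
              (entry aRes (var 1) (var 0)) (lit 0)) (lit 0)))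
          (seq (store aDist (var 1) (add (var 2) (lit 2))) (store aNext (var 1) (var 0)))
          skip))).run N (it :: env) s' aDist w ≠ 0
      · right
        obtain ⟨w, hw, hw0, hw1⟩ := hgrow
        refine Nat.succ_le_of_lt (hcard.trans_lt (Finset.card_lt_card ⟨fun x hx => ?_, fun hsub => ?_⟩))
        · obtain ⟨h1, h2⟩ := Finset.mem_filter.1 hx
          exact Finset.mem_filter.2 ⟨h1, by rwa [hr.keep x (Finset.mem_range.1 h1) h2]⟩
        · exact (Finset.mem_filter.1
            (hsub (Finset.mem_filter.2 ⟨Finset.mem_range.2 hw, hw1⟩))).2 hw0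
      · left
        push Not at hgrow
        exact fun u hu v hv hv0 huv => hc u hu v hv (fun hz => hv0 (hgrow v hv hz)) huv

end SeparatorProgram

/-! ### Far cuts from augmenting paths -/

namespace SeparatorProgram

open BoundedLoop Stmt Expr Network

/-- The nodes marked in an array. -/
def marked (N : ℕ) (x : ℕ → ℕ) : Set ℕ := {w | w < N ∧ x w ≠ 0}

/-- The unmarked nodes. -/
def unmarked (N : ℕ) (x : ℕ → ℕ) : Set ℕ := {w | w < N ∧ x w = 0}

theorem cutWeight_unmarked {N : ℕ} {F : ℕ → ℕ → ℕ} {B : ℕ → ℕ} (h : Saturated N F B) :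
    cutWeight N F (unmarked N B) = 0 :=
  cutWeight_eq_zero_iff.2 fun u hu v hv huB hvB => by
    by_contra hne
    exact h u hu v hv (fun hz => hvB ⟨hv, hz⟩) hne huB.2

/-- A cut without residual capacity does not meet the nodes found by the search. -/
theorem PartialSearch.subset_unmarked {N m : ℕ} {F : ℕ → ℕ → ℕ} {Y B P : ℕ → ℕ} {X R : Set ℕ}
    (h : PartialSearch N F Y B P m) (hR : IsCut N X (marked N Y) R) (h0 : cutWeight N F R = 0) :
    R ⊆ unmarked N B := by
  -- The pointers from a node of `R` run along residual arcs, none of which leaves `R`, and they end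
  -- at a sink.
  have key : ∀ d w, w ∈ R → B w = d → d = 0 := by
    intro d
    induction d using Nat.strong_induction_on with
    | _ d ih =>
      intro w hw hd
      have hwN := hR.lt w hw
      by_contra hd0
      by_cases h1 : d = 1
      · exact Set.disjoint_left.1 hR.sink hw ⟨hwN, (h.eq_one w hwN).1 (hd.trans h1)⟩
      · obtain ⟨n1, n2, n3, n4⟩ := h.next w hwN (by omega)
        have hP : P w ∈ R := by
          by_contra hP
          exact n2 (cutWeight_eq_zero_iff.1 h0 w hwN (P w) n1 hw hP)
        exact n3 (ih (B (P w)) (by omega) (P w) hP rfl)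
  exact fun w hw => ⟨hR.lt w hw, key _ w hw rfl⟩

theorem isCut_unmarked {N m : ℕ} {F : ℕ → ℕ → ℕ} {x Y B P : ℕ → ℕ}
    (h : PartialSearch N F Y B P m) (hx : ∀ w < N, x w ≠ 0 → B w = 0) :
    IsCut N (marked N x) (marked N Y) (unmarked N B) where
  source w hw := ⟨hw.1, hx w hw.1 hw.2⟩
  sink := Set.disjoint_left.2 fun w h1 h2 => by
    have := (h.eq_one w h1.1).2 h2.2
    have := h1.2
    omega
  lt w hw := hw.1

/-- Following the pointers from a node of the search pushes one unit of flow to the sinks. -/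
theorem run_forN_pushArc {N : ℕ} {env : List ℕ} {s : Store} {X : Set ℕ}
    (ht : ∀ i < N, s aRowN i = i * N)
    (h : PartialSearch N (mat N s aRes) (s aSink) (s aDist) (s aNext) (N + 1))
    (hcur : s aCur 0 < N) (hX : s aCur 0 ∈ X) (hd : s aDist (s aCur 0) ≠ 0) :
    ∀ R, IsCut N X (marked N (s aSink)) R →
      cutWeight N (mat N ((forN pushArc).run N env s) aRes) R + 1 =
        cutWeight N (mat N s aRes) R := by
  classical
  have main := Stmt.run_forN (N := N) (env := env) (s := s) (p := pushArc)
    -- Distances decrease along pointers, so `N` steps reach a sink (distance `1`), and the pointer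
    -- arcs ahead keep positive capacity. Compared with the start, a cut has lost one unit unless
    -- the current node is still on its source side.
    (fun j s' => s' aCur 0 < N ∧ s aDist (s' aCur 0) ≠ 0 ∧
      (s aDist (s' aCur 0) = 1 ∨ s aDist (s' aCur 0) + j ≤ N + 1) ∧
      (∀ w < N, 2 ≤ s aDist w → s aDist w ≤ s aDist (s' aCur 0) →
        mat N s' aRes w (s aNext w) ≠ 0) ∧
      ∀ R, IsCut N X (marked N (s aSink)) R →
        cutWeight N (mat N s' aRes) R + 1 =
          cutWeight N (mat N s aRes) R + if s' aCur 0 ∈ R then 1 else 0) ?_ ?_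
  · obtain ⟨h1, h2, h3, -, h5⟩ := main
    intro R hR
    rw [h5 R hR, if_neg, add_zero]
    intro hmem
    exact Set.disjoint_left.1 hR.sink hmem ⟨h1, (h.eq_one _ h1).1 (by omega)⟩
  · refine ⟨hcur, hd, .inr (h.le _ hcur), fun w hw h2 _ => (h.next w hw h2).2.1, fun R hR => ?_⟩
    rw [if_pos (hR.source hX)]
  · intro j hj s' hfr ⟨h1, h2, h3, h4, h5⟩
    have hfr' : ∀ a, a ≠ aRes → a ≠ aCur → s' a = s a := fun a e1 e2 =>
      hfr a (by simp [pushArc, assign, Stmt.writes, e1, e2])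
    have eSink := hfr' aSink (by decide) (by decide)
    have eNext := hfr' aNext (by decide) (by decide)
    have eRow := hfr' aRowN (by decide) (by decide)
    by_cases hs : s' aSink (s' aCur 0) = 0
    · rw [eSink] at hs
      have hne1 : s aDist (s' aCur 0) ≠ 1 := fun h1' => (h.eq_one _ h1).1 h1' hs
      obtain ⟨n1, n2, n3, n4⟩ := h.next _ h1 (by omega)
      have hF := h4 _ h1 (by omega) le_rfl
      set u := s' aCur 0 with hu
      set v := s aNext u with hv
      have huv : u ≠ v := fun e => by
        rw [← e] at n4
        omega
      have hrun : pushArc.run N (j :: env) s' =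
          ((s'.set aRes (u * N + v) (mat N s' aRes u v - 1)).set aRes (v * N + u)
            (mat N s' aRes v u + 1)).set aCur 0 v := by
        have h6 : ¬(v = u ∧ u = v) := fun e => huv e.2
        simp [pushArc, assign, scalar, entry, Stmt.run, Expr.eval, Store.set_apply, eSink, eNext,
          eRow, ← hu, ← hv, hs, choice_zero, ht u h1, ht v n1, mul_add_inj h1 n1, h6, mat]
      have hmat : ∀ a < N, ∀ b < N, mat N (pushArc.run N (j :: env) s') aRes a b =
          if a = v ∧ b = u then mat N s' aRes v u + 1
          else if a = u ∧ b = v then mat N s' aRes u v - 1 else mat N s' aRes a b := by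
        intro a ha b hb
        rw [hrun]
        simp [mat, Store.set_apply, mul_add_inj hb h1, mul_add_inj hb n1]
      have hcur' : pushArc.run N (j :: env) s' aCur 0 = v := by
        rw [hrun]
        simp [Store.set_apply]
      rw [hcur']
      refine ⟨n1, n3, by omega, fun w hw e1 e2 => ?_, fun R hR => ?_⟩
      · have hwu : w ≠ u := by
          rintro rfl
          omega
        rw [hmat w hw _ (h.next w hw e1).1]
        split_ifs with e3 e4
        · omega
        · exact absurd e4.1 hwu
        · exact h4 w hw e1 (by omega)
      · have hpush := cutWeight_push (N := N) (F := mat N s' aRes) (R := R)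
          (F' := mat N (pushArc.run N (j :: env) s') aRes) h1 n1 (fun a ha b hb => by
            rw [hmat a ha b hb]
            by_cases e3 : a = v ∧ b = u
            · obtain ⟨rfl, rfl⟩ := e3
              rw [if_pos ⟨rfl, rfl⟩, if_neg (fun e => huv e.2), if_pos ⟨rfl, rfl⟩]
            · by_cases e4 : a = u ∧ b = v
              · obtain ⟨rfl, rfl⟩ := e4
                rw [if_neg e3, if_pos ⟨rfl, rfl⟩, if_pos ⟨rfl, rfl⟩, if_neg e3]
                omega
              · simp only [if_neg e3, if_neg e4])
        have := h5 R hR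
        omega
    · have hrun : pushArc.run N (j :: env) s' = s' := by
        simp only [pushArc, Stmt.run]
        exact choice_of_ne hs _ _
      rw [hrun]
      rw [eSink] at hs
      exact ⟨h1, h2, .inl ((h.eq_one _ h1).2 hs), h4, h5⟩

theorem run_augment {N : ℕ} {env : List ℕ} {s : Store} (ht : ∀ i < N, s aRowN i = i * N)
    (h : PartialSearch N (mat N s aRes) (s aSink) (s aDist) (s aNext) (N + 1)) :
    ((∀ w < N, s aSrc w ≠ 0 → s aDist w = 0) ∧
      mat N (augment.run N env s) aRes = mat N s aRes) ∨
    ((∃ w < N, s aSrc w ≠ 0 ∧ s aDist w ≠ 0) ∧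
      ∀ R, IsCut N (marked N (s aSrc)) (marked N (s aSink)) R →
        cutWeight N (mat N (augment.run N env s) aRes) R + 1 = cutWeight N (mat N s aRes) R) := by
  rw [augment, Stmt.run, Stmt.run]
  set s₀ := (assign aFound (lit 0)).run N env s with hs₀
  have hfr₀ : ∀ a, a ≠ aFound → s₀ a = s a := fun a ha =>
    Stmt.run_of_notMem_writes _ _ (by simpa [assign, Stmt.writes] using ha) _ _
  have hfind := run_forN_find (N := N) (env := env) (s := s₀) (a := aFound) (b := aCur)
    (e := cond (load aSrc (var 0)) (load aDist (var 0)) (lit 0)) (by decide) (by decide) (by decide)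
    (by simp [hs₀, assign, Stmt.run, Store.set_apply, Expr.eval])
  have heval : ∀ w, (cond (load aSrc (var 0)) (load aDist (var 0)) (lit 0)).eval N (w :: env) s₀ ≠ 0 ↔
      s aSrc w ≠ 0 ∧ s aDist w ≠ 0 := fun w => by
    simp [Expr.eval, choice_ne_zero_iff, hfr₀]
  set s₁ := (forN (ite (cond (load aSrc (var 0)) (load aDist (var 0)) (lit 0))
      (seq (assign aFound (lit 1)) (assign aCur (var 0))) skip)).run N env s₀ with hs₁
  have hfr₁ : ∀ a, a ≠ aFound → a ≠ aCur → s₁ a = s a := fun a ha hb => by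
    rw [← hfr₀ a ha]
    exact Stmt.run_of_notMem_writes _ _ (by simp [assign, Stmt.writes, ha, hb]) _ _
  have hres : mat N s₁ aRes = mat N s aRes := mat_congr (hfr₁ _ (by decide) (by decide))
  change (s₁ aFound 0 = 0 ∧ _) ∨ (s₁ aFound 0 ≠ 0 ∧ IsGreatest _ (s₁ aCur 0)) at hfind
  rw [Stmt.run]
  change (_ ∧ mat N (choice (s₁ aFound 0) _ s₁) aRes = _) ∨ (_ ∧ ∀ R, _ →
    cutWeight N (mat N (choice (s₁ aFound 0) _ s₁) aRes) R + 1 = _)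
  rcases hfind with ⟨h1, h2⟩ | ⟨h1, h2, -⟩
  · refine .inl ⟨fun w hw hX => ?_, by rw [choice_of_eq h1, hres]⟩
    by_contra hne
    exact (heval w).2 ⟨hX, hne⟩ (h2 w hw)
  · obtain ⟨h2, h3⟩ := h2
    rw [heval] at h3
    refine .inr ⟨⟨_, h2, h3⟩, fun R hR => ?_⟩
    have eSink := hfr₁ aSink (by decide) (by decide)
    have eDist := hfr₁ aDist (by decide) (by decide)
    rw [choice_of_ne h1, ← hres]
    refine run_forN_pushArc (X := marked N (s aSrc)) (fun i hi => ?_) ?_ h2 ⟨h2, h3.1⟩ ?_ R ?_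
    · rw [hfr₁ aRowN (by decide) (by decide), ht i hi]
    · rw [hres, eSink, eDist, hfr₁ aNext (by decide) (by decide)]
      exact h
    · rw [eDist]
      exact h3.2
    · rw [eSink]
      exact hR

/-- The flow computation finds the far cut, if there is a cut of weight less than `N`. -/
theorem run_flow {N : ℕ} {env : List ℕ} {s : Store} (ht : ∀ i < N, s aRowN i = i * N)
    (hcut : ∃ R, IsCut N (marked N (s aSrc)) (marked N (s aSink)) R ∧
      cutWeight N (mat N s aRes) R < N) :
    IsFarCut N (mat N s aRes) (marked N (s aSrc)) (marked N (s aSink))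
      (unmarked N ((seq (forN (seq search augment)) search).run N env s aDist)) := by
  rw [Stmt.run]
  have hwrites : ∀ a, a ∈ [aRowN, aSrc, aSink] → a ∉ (forN (seq search augment)).writes := by decide
  have hfrw : ∀ a, a ∈ [aRowN, aSrc, aSink] → (forN (seq search augment)).run N env s a = s a :=
    fun a ha => Stmt.run_of_notMem_writes _ _ (hwrites a ha) _ _
  have main := Stmt.run_forN (N := N) (env := env) (s := s) (p := seq search augment)
    -- Each round pushes a unit until some cut has residual weight zero. Otherwise the value would
    -- reach `N`, against the cut assumed lighter than `N`.
    (fun j s' => ∃ val, IsResidual N (mat N s aRes) (marked N (s aSrc)) (marked N (s aSink)) val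
        (mat N s' aRes) ∧
      (j ≤ val ∨ ∃ R, IsCut N (marked N (s aSrc)) (marked N (s aSink)) R ∧
        cutWeight N (mat N s' aRes) R = 0)) ?_ ?_
  · set s₁ := (forN (seq search augment)).run N env s with hs₁
    obtain ⟨val, hval, hor⟩ := main
    have hzero : ∃ R, IsCut N (marked N (s aSrc)) (marked N (s aSink)) R ∧
        cutWeight N (mat N s₁ aRes) R = 0 := by
      rcases hor with hle | h
      · obtain ⟨R, hR, hlt⟩ := hcut
        have := hval R hR
        omega
      · exact h
    obtain ⟨hp, hsat⟩ := run_search (N := N) (env := env) (s := s₁)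
      (fun i hi => by rw [hfrw aRowN (by decide), ht i hi])
    have eSink := hfrw aSink (by decide)
    rw [eSink] at hp
    obtain ⟨R, hR, hR0⟩ := hzero
    refine hval.isFarCut (isCut_unmarked hp fun w hw hX => ?_) (cutWeight_unmarked hsat)
      fun S hS hS0 => hp.subset_unmarked hS hS0
    exact (hp.subset_unmarked hR hR0 (hR.source ⟨hw, hX⟩)).2
  · exact ⟨0, fun R _ => (zero_add _).symm, .inl le_rfl⟩
  · intro j hj s' hfr ⟨val, hval, hor⟩
    have hfr' : ∀ a, a ∈ [aRowN, aSrc, aSink] → s' a = s a := fun a ha => hfr a (hwrites a ha)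
    rw [Stmt.run]
    obtain ⟨hp, hsat⟩ := run_search (N := N) (env := j :: env) (s := s')
      (fun i hi => by rw [hfr' aRowN (by decide), ht i hi])
    have hw2 : ∀ a, a ∈ [aRowN, aSrc, aSink, aRes] → a ∉ search.writes := by decide
    have hfr2 : ∀ a, a ∈ [aRowN, aSrc, aSink, aRes] → search.run N (j :: env) s' a = s' a :=
      fun a ha => Stmt.run_of_notMem_writes _ _ (hw2 a ha) _ _
    set s₂ := search.run N (j :: env) s' with hs₂
    have eres : mat N s₂ aRes = mat N s' aRes := mat_congr (hfr2 aRes (by decide))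
    have eSink : s₂ aSink = s aSink := by rw [hfr2 aSink (by decide), hfr' aSink (by decide)]
    have eSrc : s₂ aSrc = s aSrc := by rw [hfr2 aSrc (by decide), hfr' aSrc (by decide)]
    have eRow : s₂ aRowN = s aRowN := by rw [hfr2 aRowN (by decide), hfr' aRowN (by decide)]
    rw [hfr' aSink (by decide)] at hp
    have haug := run_augment (N := N) (env := j :: env) (s := s₂) (by rwa [eRow])
      (by rwa [eres, eSink])
    rw [eres, eSink, eSrc] at haug
    rcases haug with ⟨h1, h2⟩ | ⟨⟨w, hw, hX, hB⟩, h2⟩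
    · rw [h2]
      exact ⟨val, hval, .inr ⟨_, isCut_unmarked hp h1, cutWeight_unmarked hsat⟩⟩
    · refine ⟨val + 1, fun R hR => ?_, ?_⟩
      · have := h2 R hR
        have := hval R hR
        omega
      · rcases hor with h3 | ⟨R, hR, hR0⟩
        · exact .inl (by omega)
        -- A cut of residual weight zero cannot lose another unit, so this augmentation is
        -- impossible.
        · have := h2 R hR
          omega

end SeparatorProgram

/-! ### Simulation of the branching -/

namespace SeparatorProgram

open BoundedLoop Stmt Expr Network

/-- The arrays that describe the instance hold what they should. -/
structure Context (n N r s : ℕ) (T : Finset ℕ) (E : ℕ → ℕ → Prop) (st : Store) : Prop where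
  term : ∀ v, st aTerm v ≠ 0 ↔ v ∈ T
  term_lt : ∀ v ∈ T, v < n
  adj : ∀ u < n, ∀ v < n, st aAdj (u * n + v) ≠ 0 ↔ E u v
  rowN : ∀ i ≤ N, st aRowN i = i * N
  rown : ∀ i ≤ N, st aRown i = i * n
  rank : ∀ i ≤ N, st aRank i = (T.filter (· < i)).card
  num : st aNum 0 = n
  bound : st aBound 0 = r
  budget : st aBudget 0 = s

/-- The set of deleted vertices. -/
def deleted (n : ℕ) (st : Store) : Finset ℕ := (Finset.range n).filter fun v => st aDel v ≠ 0

theorem mem_deleted {n v : ℕ} {st : Store} (hv : v < n) : v ∈ deleted n st ↔ st aDel v ≠ 0 := by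
  simp [deleted, hv]

variable {n N r s : ℕ} {T : Finset ℕ} {E : ℕ → ℕ → Prop} {st : Store} {env : List ℕ}

theorem Context.congr {st' : Store} (h : Context n N r s T E st)
    (hst : ∀ a < 8, st' a = st a) : Context n N r s T E st' where
  term := by rw [hst aTerm (by decide)]; exact h.term
  term_lt := h.term_lt
  adj := by rw [hst aAdj (by decide)]; exact h.adj
  rowN := by rw [hst aRowN (by decide)]; exact h.rowN
  rown := by rw [hst aRown (by decide)]; exact h.rown
  rank := by rw [hst aRank (by decide)]; exact h.rank
  num := by rw [hst aNum (by decide)]; exact h.num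
  bound := by rw [hst aBound (by decide)]; exact h.bound
  budget := by rw [hst aBudget (by decide)]; exact h.budget

theorem Context.run {p : Stmt} (h : Context n N r s T E st) (hp : ∀ a < 8, a ∉ p.writes) :
    Context n N r s T E (p.run N env st) :=
  h.congr fun a ha => p.run_of_notMem_writes N (hp a ha) env st

theorem Context.numTerminals (h : Context n N r s T E st) (hN : n ≤ N) :
    numTerminals.eval N env st = T.card := by
  change st aRank N = _
  rw [h.rank N le_rfl, Finset.filter_true_of_mem fun t ht => (h.term_lt t ht).trans_le hN]

/-- The program tests `a < b` as `b - a ≠ 0`, and an equality by two such tests; the case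
distinctions follow these guards. -/
theorem mat_build (h : Context n N r s T E st) {u v : ℕ} (hu : u < N) (hv : v < N) :
    mat N (build.run N env st) aRes u v = splitCap n N E (deleted n st) u v := by
  change build.run N env st aRes (u * N + v) = _
  rw [build, run_forN_forN_store (by decide) (by decide) (fun i hi => h.rowN i hi.le) hu hv]
  simp only [capacity, scalar, Expr.eval, List.getD_cons_succ, List.getD_cons_zero, h.num]
  by_cases h1 : u < n
  · rw [choice_of_ne (show n - u ≠ 0 by omega), splitCap]
    by_cases h2 : v = u + n
    · rw [choice_of_eq (show v - (u + n) = 0 by omega), choice_of_eq (show u + n - v = 0 by omega),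
        if_pos ⟨h1, h2⟩]
      by_cases h3 : st aDel u = 0
      · rw [choice_of_eq h3, if_neg fun h4 => (mem_deleted h1).1 h4 h3]
      · rw [choice_of_ne h3, if_pos ((mem_deleted h1).2 h3)]
    · rw [if_neg fun h3 => h2 h3.2, if_neg (by omega)]
      by_cases h3 : v - (u + n) = 0
      · rw [choice_of_eq h3, choice_of_ne (show u + n - v ≠ 0 by omega)]
      · rw [choice_of_ne h3]
  · rw [choice_of_eq (show n - u = 0 by omega), splitCap, if_neg fun h2 => h1 h2.1]
    by_cases h2 : u < 2 * n ∧ v < n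
    · rw [choice_of_ne (show n + n - u ≠ 0 by omega), choice_of_ne (show n - v ≠ 0 by omega),
        h.rown _ (by omega)]
      have hadj := h.adj (u - n) (by omega) v h2.2
      by_cases h3 : st aAdj ((u - n) * n + v) = 0
      · rw [choice_of_eq h3, if_neg fun h4 => hadj.2 h4.2.2.2 h3]
      · rw [choice_of_ne h3, if_pos ⟨by omega, h2.1, h2.2, hadj.1 h3⟩]
    · rw [if_neg fun h3 => h2 ⟨h3.2.1, h3.2.2.1⟩]
      by_cases h3 : n + n - u = 0
      · rw [choice_of_eq h3]
      · rw [choice_of_ne h3, choice_of_eq (show n - v = 0 by omega)]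

theorem run_maxFlow (h : Context n N r s T E st)
    (hcut : ∃ R, IsCut N (marked N (st aSrc)) (marked N (st aSink)) R ∧
      cutWeight N (splitCap n N E (deleted n st)) R < N) :
    IsFarCut N (splitCap n N E (deleted n st)) (marked N (st aSrc)) (marked N (st aSink))
      (unmarked N (maxFlow.run N env st aDist)) := by
  have hw : ∀ a, a ≠ aRes → a ∉ build.writes := fun a ha => by
    simpa [build, Stmt.writes] using ha
  have hfr : ∀ a, a ≠ aRes → build.run N env st a = st a := fun a ha =>
    Stmt.run_of_notMem_writes _ _ (hw a ha) _ _
  have hb : ∀ u < N, ∀ v < N, mat N (build.run N env st) aRes u v =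
      splitCap n N E (deleted n st) u v := fun u hu v hv => mat_build h hu hv
  have key := run_flow (N := N) (env := env) (s := build.run N env st)
    (fun i hi => by rw [hfr aRowN (by decide), h.rowN i hi.le])
    (by
      rw [hfr aSrc (by decide), hfr aSink (by decide)]
      obtain ⟨R, hR, hlt⟩ := hcut
      exact ⟨R, hR, by rwa [cutWeight_congr hb]⟩)
  rw [hfr aSrc (by decide), hfr aSink (by decide)] at key
  exact key.congr hb

/-- The store represents a position of the branching. -/
structure Position (n N : ℕ) (T : Finset ℕ) (g : ℕ → ℕ) (st : Store) (bs : List Bool)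
    (Z : Finset ℕ) (X : Set ℕ) (i : ℕ) : Prop where
  label : ∀ w < N, st aLabel w = nodeLabel n T g w
  deleted : deleted n st = Z
  source : marked N (st aSrc) = X
  stage : st aStage 0 = i
  bits : ∀ j (hj : j < bs.length), bs[j] = true ↔ st aAdvice (st aPos 0 + j) ≠ 0

variable {g : ℕ → ℕ} {bs : List Bool} {Z : Finset ℕ} {X : Set ℕ} {i : ℕ}

theorem Position.congr {st' : Store} (h : Position n N T g st bs Z X i)
    (hst : ∀ a ∈ [aLabel, aDel, aSrc, aStage, aAdvice, aPos], st' a = st a) :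
    Position n N T g st' bs Z X i where
  label := by rw [hst aLabel (by decide)]; exact h.label
  deleted := by
    unfold SeparatorProgram.deleted
    rw [hst aDel (by decide)]
    exact h.deleted
  source := by rw [hst aSrc (by decide)]; exact h.source
  stage := by rw [hst aStage (by decide)]; exact h.stage
  bits := by rw [hst aAdvice (by decide), hst aPos (by decide)]; exact h.bits

theorem marked_markSinks (hp : Position n N T g st bs Z X i) :
    marked N (markSinks.run N env st aSink) = (labeled n N E T s g).sink i := by
  ext w
  change w < N ∧ _ ↔ w < N ∧ nodeLabel n T g w ≠ 0 ∧ nodeLabel n T g w < i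
  refine and_congr_right fun hw => ?_
  rw [markSinks, run_forN_store (by decide) hw]
  simp only [scalar, Expr.eval, List.getD_cons_zero, hp.label w hw, hp.stage, choice_ne_zero_iff]
  omega

/-- The vertices found after the flow computation are those at which the far cut can be cut. -/
theorem run_findCrossing (h : Context n N r s T E st) (hN : 2 * n ≤ N) :
    (findCrossing.run N env st aFound 0 = 0 ∧
      (labeled n N E T s g).crossing (deleted n st) (unmarked N (st aDist)) = ∅) ∨
    (findCrossing.run N env st aFound 0 ≠ 0 ∧
      IsGreatest ((labeled n N E T s g).crossing (deleted n st) (unmarked N (st aDist)))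
        (findCrossing.run N env st aCur 0)) := by
  rw [findCrossing, Stmt.run]
  set s₀ := (assign aFound (lit 0)).run N env st with hs₀
  have hfr₀ : ∀ a, a ≠ aFound → s₀ a = st a := fun a ha =>
    Stmt.run_of_notMem_writes _ _ (by simpa [assign, Stmt.writes] using ha) _ _
  have hfind := run_forN_find (N := N) (env := env) (s := s₀) (a := aFound) (b := aCur)
    (e := cond (sub (scalar aNum) (var 0)) (cond (load aDel (var 0)) (lit 0)
      (cond (load aDist (var 0)) (lit 0) (load aDist (add (var 0) (scalar aNum))))) (lit 0))
    (by decide) (by decide) (by decide)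
    (by simp [hs₀, assign, Stmt.run, Store.set_apply, Expr.eval])
  have hset : {v | v < N ∧ (cond (sub (scalar aNum) (var 0)) (cond (load aDel (var 0)) (lit 0)
      (cond (load aDist (var 0)) (lit 0) (load aDist (add (var 0) (scalar aNum)))))
      (lit 0)).eval N (v :: env) s₀ ≠ 0} =
      (labeled n N E T s g).crossing (deleted n st) (unmarked N (st aDist)) := by
    ext v
    change v < N ∧ _ ↔ v < n ∧ v ∉ deleted n st ∧ (v < N ∧ st aDist v = 0) ∧
      ¬(v + n < N ∧ st aDist (v + n) = 0)
    simp only [scalar, Expr.eval, List.getD_cons_zero, hfr₀ aNum (by decide),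
      hfr₀ aDel (by decide), hfr₀ aDist (by decide), h.num, choice_ne_zero_iff]
    by_cases hv : v < n
    · rw [mem_deleted hv]
      have h1 : v < N := by omega
      have h2 : v + n < N := by omega
      have h3 : n - v ≠ 0 := by omega
      simp [hv, h1, h2, h3]
    · have h3 : n - v = 0 := by omega
      simp [hv, h3]
  rw [hset] at hfind
  refine hfind.imp_left fun ⟨h1, h2⟩ => ⟨h1, ?_⟩
  rw [← hset]
  exact Set.eq_empty_of_forall_notMem fun v hv => hv.2 (h2 v hv.1)

theorem run_choose_lower (hp : Position n N T g st bs Z X i) (hf : st aFound 0 = 0) :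
    Position n N T g (choose.run N env st) bs Z
      (X ∪ {w | w < N ∧ i - 1 ≤ (labeled n N E T s g).label w}) (i - 1) := by
  have hrun : choose.run N env st = (seq (assign aStage (sub (scalar aStage) (lit 1)))
      (forN (ite (sub (add (load aLabel (var 0)) (lit 1)) (scalar aStage))
        (store aSrc (var 0) (lit 1)) skip))).run N env st := choice_of_eq hf _ _
  have hw : ∀ a, a ≠ aStage → a ≠ aSrc → a ∉ (seq (assign aStage (sub (scalar aStage) (lit 1)))
      (forN (ite (sub (add (load aLabel (var 0)) (lit 1)) (scalar aStage))
        (store aSrc (var 0) (lit 1)) skip))).writes := fun a h1 h2 => by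
    simp [assign, Stmt.writes, h1, h2]
  have hfr : ∀ a, a ≠ aStage → a ≠ aSrc → choose.run N env st a = st a := fun a h1 h2 => by
    rw [hrun]
    exact Stmt.run_of_notMem_writes _ _ (hw a h1 h2) _ _
  have hstage : ((assign aStage (sub (scalar aStage) (lit 1))).run N env st) aStage 0 = i - 1 := by
    simp [assign, scalar, Stmt.run, Expr.eval, Store.set_apply, hp.stage]
  have hother : ∀ a, a ≠ aStage →
      ((assign aStage (sub (scalar aStage) (lit 1))).run N env st) a = st a := fun a ha =>
    Stmt.run_of_notMem_writes _ _ (by simpa [assign, Stmt.writes] using ha) _ _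
  refine ⟨?_, ?_, ?_, ?_, ?_⟩
  · rw [hfr aLabel (by decide) (by decide)]
    exact hp.label
  · unfold deleted
    rw [hfr aDel (by decide) (by decide)]
    exact hp.deleted
  · rw [← hp.source]
    ext w
    change w < N ∧ _ ↔ (w < N ∧ _) ∨ (w < N ∧ i - 1 ≤ nodeLabel n T g w)
    rw [← and_or_left]
    refine and_congr_right fun hw => ?_
    rw [hrun, Stmt.run_seq, run_forN_update (by decide) (by decide)]
    generalize (assign aStage (sub (scalar aStage) (lit 1))).run N env st = s₀ at hstage hother
    simp only [scalar, Expr.eval, List.getD_cons_zero, hstage, hother aLabel (by decide),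
      hother aSrc (by decide), hp.label w hw, hw, true_and]
    -- The guard, label plus one minus stage, is nonzero exactly if the label is at least the new
    -- stage `i - 1`.
    split_ifs with h1
    · exact ⟨fun _ => .inr (by omega), fun _ => one_ne_zero⟩
    · exact ⟨.inl, fun h2 => h2.resolve_right (by omega)⟩
  · rw [hrun, Stmt.run, Stmt.run_of_notMem_writes _ _ (by decide), hstage]
  · rw [hfr aAdvice (by decide) (by decide), hfr aPos (by decide) (by decide)]
    exact hp.bits

theorem run_choose_branch (hN : 2 * n ≤ N) (hn : st aNum 0 = n) {b : Bool}
    (hp : Position n N T g st (b :: bs) Z X i) (hf : st aFound 0 ≠ 0) (hP : st aCur 0 < n) :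
    if b then Position n N T g (choose.run N env st) bs Z
        (unmarked N (st aDist) ∪ {st aCur 0 + n}) i
      else Position n N T g (choose.run N env st) bs (insert (st aCur 0) Z) X i := by
  have hadv : b = true ↔ st aAdvice (st aPos 0) ≠ 0 := hp.bits 0 (by simp)
  -- Moving the reading position by one drops the bit just used.
  have htail : ∀ j (hj : j < bs.length), bs[j] = true ↔ st aAdvice (st aPos 0 + 1 + j) ≠ 0 :=
    fun j hj => by
      have := hp.bits (j + 1) (by simpa using hj)
      rw [List.getElem_cons_succ] at this
      rw [this, add_assoc, add_comm 1 j]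
  cases b with
  | false =>
    have h0 : st aAdvice (st aPos 0) = 0 := by
      by_contra hne
      exact Bool.false_ne_true (hadv.2 hne)
    have hrun : choose.run N env st =
        (st.set aDel (st aCur 0) 1).set aPos 0 (st aPos 0 + 1) := by
      simp only [choose, assign, scalar, Stmt.run, Expr.eval, choice_of_ne hf, choice_of_eq h0]
      rfl
    rw [if_neg (by decide), hrun]
    refine ⟨fun w hw => ?_, ?_, ?_, ?_, fun j hj => ?_⟩
    · simpa [Store.set_apply] using hp.label w hw
    · rw [← hp.deleted]
      ext v
      simp only [deleted, Store.set_apply, Finset.mem_filter, Finset.mem_range, Finset.mem_insert]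
      by_cases hv : v = st aCur 0
      · simp [hv, hP]
      · simp [hv]
    · rw [← hp.source]
      ext w
      simp [marked, Store.set_apply]
    · simpa [Store.set_apply] using hp.stage
    · simpa [Store.set_apply] using htail j hj
  | true =>
    have h0 : st aAdvice (st aPos 0) ≠ 0 := hadv.1 rfl
    set s₁ := (forN (store aSrc (var 0) (cond (load aDist (var 0)) (lit 0) (lit 1)))).run N env st
      with hs₁
    have hfr : ∀ a, a ≠ aSrc → s₁ a = st a := fun a ha =>
      Stmt.run_of_notMem_writes _ _ (by simpa [Stmt.writes] using ha) _ _
    have hrun : choose.run N env st =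
        (s₁.set aSrc (st aCur 0 + n) 1).set aPos 0 (st aPos 0 + 1) := by
      simp only [choose, assign, scalar, Stmt.run, Expr.eval, choice_of_ne hf, choice_of_ne h0]
      rw [← hn, ← hfr aCur (by decide), ← hfr aNum (by decide), ← hfr aPos (by decide)]
      simp [Store.set_apply, hs₁, Stmt.run, Expr.eval]
    rw [if_pos rfl, hrun]
    refine ⟨fun w hw => ?_, ?_, ?_, ?_, fun j hj => ?_⟩
    · simpa [Store.set_apply, hfr] using hp.label w hw
    · rw [← hp.deleted]
      ext v
      simp [deleted, Store.set_apply, hfr]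
    · ext w
      have hsrc : ∀ w < N, s₁ aSrc w ≠ 0 ↔ st aDist w = 0 := fun w hw => by
        rw [hs₁, run_forN_store (by decide) hw]
        simp [Expr.eval, choice_ne_zero_iff]
      simp only [marked, unmarked, Store.set_apply]
      change w < N ∧ _ ↔ (w < N ∧ st aDist w = 0) ∨ w = st aCur 0 + n
      by_cases hw : w = st aCur 0 + n
      · simp [hw]
        omega
      · by_cases hwN : w < N
        · simpa [hw, hwN] using hsrc w hwN
        · simp [hw, hwN]
    · simpa [Store.set_apply, hfr] using hp.stage
    · simpa [Store.set_apply, hfr] using htail j hj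

/-- `Wins` supplies the light cut that the flow computation depends on, and then applies to the far
cut that was computed. -/
theorem run_round (hN : 2 * n ≤ N) (h : Context n N r s T E st)
    (hp : Position n N T g st bs Z X i) {m : ℕ}
    (hw : (labeled n N E T s g).Wins (m + 1) bs Z X i) :
    ∃ bs' Z' X' i', Position n N T g (round.run N env st) bs' Z' X' i' ∧
      (labeled n N E T s g).Wins m bs' Z' X' i' := by
  rw [round, Stmt.run, Stmt.run, Stmt.run]
  have hp₁ : Position n N T g (markSinks.run N env st) bs Z X i :=
    hp.congr fun a ha => Stmt.run_of_notMem_writes _ _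
      ((by decide : ∀ a ∈ [aLabel, aDel, aSrc, aStage, aAdvice, aPos], a ∉ markSinks.writes) a ha) _ _
  have hc₁ : Context n N r s T E (markSinks.run N env st) := h.run (by decide)
  have hsink := marked_markSinks (E := E) (s := s) (env := env) hp
  set s₁ := markSinks.run N env st
  obtain ⟨⟨R, hR, hlt⟩, hall⟩ := hw
  have hfar := run_maxFlow (env := env) hc₁ ⟨R, by rw [hsink, hp₁.source]; exact hR,
    by rw [hp₁.deleted]; exact hlt⟩
  rw [hsink, hp₁.source, hp₁.deleted] at hfar
  have hp₂ : Position n N T g (maxFlow.run N env s₁) bs Z X i :=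
    hp₁.congr fun a ha => Stmt.run_of_notMem_writes _ _
      ((by decide : ∀ a ∈ [aLabel, aDel, aSrc, aStage, aAdvice, aPos], a ∉ maxFlow.writes) a ha) _ _
  have hc₂ : Context n N r s T E (maxFlow.run N env s₁) := hc₁.run (by decide)
  set s₂ := maxFlow.run N env s₁
  have hfind := run_findCrossing (g := g) (env := env) hc₂ hN
  rw [hp₂.deleted] at hfind
  have hp₃ : Position n N T g (findCrossing.run N env s₂) bs Z X i :=
    hp₂.congr fun a ha => Stmt.run_of_notMem_writes _ _
      ((by decide : ∀ a ∈ [aLabel, aDel, aSrc, aStage, aAdvice, aPos],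
        a ∉ findCrossing.writes) a ha) _ _
  have hc₃ : Context n N r s T E (findCrossing.run N env s₂) := hc₂.run (by decide)
  have hdist : findCrossing.run N env s₂ aDist = s₂ aDist :=
    Stmt.run_of_notMem_writes _ _ (by decide) _ _
  set s₃ := findCrossing.run N env s₂
  obtain ⟨hlow, hbr⟩ := hall _ hfar
  rcases hfind with ⟨h1, h2⟩ | ⟨h1, h2⟩
  · exact ⟨_, _, _, _, run_choose_lower (E := E) (s := s) hp₃ h1, hlow h2⟩
  · obtain ⟨b, bs', rfl, hwin⟩ := hbr _ h2
    have := run_choose_branch (env := env) hN hc₃.num hp₃ h1 h2.1.1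
    rw [hdist] at this
    cases b with
    | false => exact ⟨_, _, _, _, this, hwin⟩
    | true => exact ⟨_, _, _, _, this, hwin⟩

theorem run_prepare (hN : 2 * n ≤ N) (h : Context n N r s T E st)
    (hg : ∀ t ∈ T, g t = st aAdvice (T.filter (· < t)).card)
    (hbs : ∀ j (hj : j < bs.length), bs[j] = true ↔ st aAdvice (T.card + j) ≠ 0) :
    Position n N T g (prepare.run N env st) bs (T.filter fun t => g t = 0) ∅ (T.card + 1) := by
  simp only [prepare, Stmt.run_seq]
  set s₁ := (forN (store aLabel (var 0) (cond (sub (scalar aNum) (var 0))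
      (cond (load aTerm (var 0)) (load aAdvice (load aRank (var 0))) (lit 0))
      (cond (load aTerm (sub (var 0) (scalar aNum)))
        (load aAdvice (load aRank (sub (var 0) (scalar aNum)))) (lit 0))))).run N env st with hs₁
  have hc₁ : Context n N r s T E s₁ := h.run (by decide)
  have hA₁ : s₁ aAdvice = st aAdvice := Stmt.run_of_notMem_writes _ _ (by decide) _ _
  have hl₁ : ∀ w < N, s₁ aLabel w = nodeLabel n T g w := by
    intro w hw
    rw [hs₁, run_forN_store (by decide) hw]
    simp only [scalar, Expr.eval, List.getD_cons_zero, h.num]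
    by_cases h1 : w < n
    · rw [choice_of_ne (show n - w ≠ 0 by omega), h.rank w hw.le, nodeLabel]
      by_cases h2 : w ∈ T
      · rw [choice_of_ne ((h.term w).2 h2), if_pos h2, hg w h2]
      · rw [choice_of_eq (by_contra fun h3 => h2 ((h.term w).1 h3)), if_neg h2,
          if_neg fun h3 => by omega]
    · rw [choice_of_eq (show n - w = 0 by omega), h.rank (w - n) (by omega), nodeLabel,
        if_neg fun h2 => h1 (h.term_lt w h2)]
      by_cases h2 : w - n ∈ T
      · rw [choice_of_ne ((h.term _).2 h2), if_pos ⟨by omega, h2⟩, hg _ h2]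
      · rw [choice_of_eq (by_contra fun h3 => h2 ((h.term _).1 h3)), if_neg fun h3 => h2 h3.2]
  clear_value s₁
  set s₂ := (forN (store aDel (var 0) (cond (load aTerm (var 0))
      (cond (load aAdvice (load aRank (var 0))) (lit 0) (lit 1)) (lit 0)))).run N env s₁ with hs₂
  have hc₂ : Context n N r s T E s₂ := hc₁.run (by decide)
  have hA₂ : s₂ aAdvice = st aAdvice := by
    rw [hs₂, Stmt.run_of_notMem_writes _ _ (by decide), hA₁]
  have hl₂ : s₂ aLabel = s₁ aLabel := Stmt.run_of_notMem_writes _ _ (by decide) _ _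
  have hd₂ : deleted n s₂ = T.filter fun t => g t = 0 := by
    ext v
    by_cases hv : v < n
    · rw [mem_deleted hv, hs₂, run_forN_store (by decide) (by omega)]
      simp only [Expr.eval, List.getD_cons_zero, hA₁, choice_ne_zero_iff, Finset.mem_filter,
        hc₁.rank v (by omega), hc₁.term]
      refine ⟨?_, fun ⟨h1, h2⟩ => .inl ⟨h1, .inr ⟨by rw [← hg v h1, h2], one_ne_zero⟩⟩⟩
      rintro (⟨h1, h2⟩ | h2)
      · rcases h2 with h2 | h2
        · exact absurd rfl h2.2
        · exact ⟨h1, by rw [hg v h1, h2.1]⟩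
      · exact absurd rfl h2.2
    · refine ⟨fun h1 => absurd (Finset.mem_range.1 (Finset.mem_filter.1 h1).1) hv, fun h1 =>
        absurd (h.term_lt v (Finset.mem_filter.1 h1).1) hv⟩
  clear_value s₂
  set s₃ := (forN (store aSrc (var 0) (lit 0))).run N env s₂ with hs₃
  have hc₃ : Context n N r s T E s₃ := hc₂.run (by decide)
  have hfr₃ : ∀ a, a ≠ aSrc → s₃ a = s₂ a := fun a ha =>
    Stmt.run_of_notMem_writes _ _ (by simpa [Stmt.writes] using ha) _ _
  have hx₃ : marked N (s₃ aSrc) = ∅ := by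
    refine Set.eq_empty_of_forall_notMem fun w hw => hw.2 ?_
    rw [hs₃, run_forN_store (by decide) hw.1]
    rfl
  clear_value s₃
  have hK : ∀ st', (∀ a < 8, st' a = s₃ a) → numTerminals.eval N env st' = T.card :=
    fun st' hst' => (hc₃.congr hst').numTerminals (by omega)
  set s₄ := (assign aStage (add numTerminals (lit 1))).run N env s₃ with hs₄
  have hfr₄ : ∀ a, a ≠ aStage → s₄ a = s₃ a := fun a ha =>
    Stmt.run_of_notMem_writes _ _ (by simpa [assign, Stmt.writes] using ha) _ _
  have hst₄ : s₄ aStage 0 = T.card + 1 := by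
    simp [hs₄, assign, Stmt.run, Expr.eval, Store.set_apply, hK s₃ fun _ _ => rfl]
  set s₅ := (assign aPos numTerminals).run N env s₄ with hs₅
  have hfr₅ : ∀ a, a ≠ aPos → s₅ a = s₄ a := fun a ha =>
    Stmt.run_of_notMem_writes _ _ (by simpa [assign, Stmt.writes] using ha) _ _
  have hpos₅ : s₅ aPos 0 = T.card := by
    simp [hs₅, assign, Stmt.run, Expr.eval, Store.set_apply,
      hK s₄ fun a ha => hfr₄ a (by omega)]
  refine ⟨?_, ?_, ?_, ?_, ?_⟩
  · rw [hfr₅ _ (by decide), hfr₄ _ (by decide), hfr₃ _ (by decide), hl₂]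
    exact hl₁
  · rw [← hd₂]
    unfold deleted
    rw [hfr₅ _ (by decide), hfr₄ _ (by decide), hfr₃ _ (by decide)]
  · rw [hfr₅ _ (by decide), hfr₄ _ (by decide), hx₃]
  · rw [hfr₅ _ (by decide), hst₄]
  · rw [hpos₅, hfr₅ _ (by decide), hfr₄ _ (by decide), hfr₃ _ (by decide), hA₂]
    exact hbs

/-- Good advice leads to a solution. -/
theorem run_candidate (hN : 2 * n ≤ N) (h : Context n N r s T E st)
    (hg : ∀ t ∈ T, g t = st aAdvice (T.filter (· < t)).card)
    (hbs : ∀ j (hj : j < bs.length), bs[j] = true ↔ st aAdvice (T.card + j) ≠ 0)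
    (hw : (labeled n N E T s g).Wins N bs (T.filter fun t => g t = 0) ∅ (T.card + 1)) :
    (labeled n N E T s g).Solves (deleted n (candidate.run N env st)) := by
  rw [candidate, Stmt.run]
  have hc : Context n N r s T E (prepare.run N env st) := h.run (by decide)
  have hrw : ∀ a < 8, a ∉ round.writes := by decide
  have main := Stmt.run_forN (N := N) (env := env) (s := prepare.run N env st) (p := round)
    -- The rounds left in `Wins` count down; at zero it unfolds to `Solves`.
    (fun j s' => ∃ bs' Z' X' i', Position n N T g s' bs' Z' X' i' ∧
      (labeled n N E T s g).Wins (N - j) bs' Z' X' i')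
    ⟨_, _, _, _, run_prepare hN h hg hbs, hw⟩ ?_
  · obtain ⟨bs', Z', X', i', hp, hw'⟩ := main
    rw [Nat.sub_self] at hw'
    rw [hp.deleted]
    exact hw'
  · intro j hj s' hfr ⟨bs', Z', X', i', hp, hw'⟩
    rw [show N - j = N - (j + 1) + 1 by omega] at hw'
    exact run_round hN (hc.congr fun a ha => hfr a (hrw a ha)) hp hw'

end SeparatorProgram

namespace SeparatorProgram

open BoundedLoop Stmt Expr Network

variable {n N r s : ℕ} {T : Finset ℕ} {E : ℕ → ℕ → Prop} {st : Store} {env : List ℕ}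

/-! ### Checking a candidate -/

theorem lt_of_mem_deleted {v : ℕ} (h : v ∈ deleted n st) : v < n :=
  Finset.mem_range.1 (Finset.mem_filter.1 h).1

theorem mem_of_mem_companions {Z : Finset ℕ} {t v : ℕ} (h : v ∈ companions E T Z t) : v ∈ T := by
  classical
  exact (Finset.mem_filter.1 h).1

/-- The search finds the nodes from which the sink can be reached. -/
theorem PartialSearch.ne_zero_iff {m t : ℕ} {F : ℕ → ℕ → ℕ} {Y B P : ℕ → ℕ} {ρ : ℕ → ℕ → Prop}
    (h : PartialSearch N F Y B P m) (hs : Saturated N F B) (ht : t < N)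
    (hY : ∀ w < N, Y w ≠ 0 ↔ w = t) (hF : ∀ u < N, ∀ v < N, F u v ≠ 0 ↔ ρ u v)
    (hρ : ∀ u v, ρ u v → u < N ∧ v < N) {w : ℕ} (hw : w < N) :
    B w ≠ 0 ↔ Relation.ReflTransGen ρ w t := by
  constructor
  · have key : ∀ d w, w < N → B w = d → d ≠ 0 → Relation.ReflTransGen ρ w t := by
      intro d
      induction d using Nat.strong_induction_on with
      | _ d ih =>
        intro w hw hd hd0
        by_cases h1 : d = 1
        · rw [(hY w hw).1 ((h.eq_one w hw).1 (hd.trans h1))]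
        · obtain ⟨n1, n2, n3, n4⟩ := h.next w hw (by omega)
          exact .head ((hF w hw _ n1).1 n2) (ih _ (by omega) _ n1 rfl n3)
    exact key _ w hw rfl
  · intro hr
    induction hr using Relation.ReflTransGen.head_induction_on with
    | refl => rw [(h.eq_one t ht).2 ((hY t ht).2 rfl)]; exact one_ne_zero
    | head hab _ ih =>
      obtain ⟨ha, hb⟩ := hρ _ _ hab
      exact hs _ ha _ hb (ih hb) ((hF _ ha _ hb).2 hab)

/-- Row `t` is a backward search with `t` as only sink. Searching does not change the capacities, so
they are built once. -/
theorem run_allReach (hN : 2 * n ≤ N) (h : Context n N r s T E st) {t w : ℕ} (ht : t < N)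
    (hw : w < N) :
    mat N (allReach.run N env st) aReach t w ≠ 0 ↔ NetReach n N E (deleted n st) w t := by
  rw [allReach, Stmt.run_seq]
  have hfrb : ∀ a, a ≠ aRes → build.run N env st a = st a := fun a ha =>
    Stmt.run_of_notMem_writes _ _ (by simpa [build, Stmt.writes] using ha) _ _
  set s₀ := build.run N env st with hs₀
  have hc₀ : Context n N r s T E s₀ := h.run (by decide)
  refine Stmt.run_forN (N := N) (env := env) (s := s₀) (fun j s' => ∀ t < j, ∀ w < N,
    mat N s' aReach t w ≠ 0 ↔ NetReach n N E (deleted n st) w t) (by simp) ?_ t ht w hw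
  intro t ht s' hfr ih u hu w hw
  have hfrR : ∀ a ∈ [aRowN, aRes], s' a = s₀ a := fun a ha => hfr a
    ((by decide : ∀ a ∈ [aRowN, aRes], a ∉ (seq (forN (store aSink (var 0)
      (cond (sub (var 0) (var 1)) (lit 0) (cond (sub (var 1) (var 0)) (lit 0) (lit 1)))))
      (seq search (forN (store aReach (add (load aRowN (var 1)) (var 0))
        (load aDist (var 0)))))).writes) a ha)
  rw [Stmt.run_seq, Stmt.run_seq]
  set s₁ := (forN (store aSink (var 0) (cond (sub (var 0) (var 1)) (lit 0)
      (cond (sub (var 1) (var 0)) (lit 0) (lit 1))))).run N (t :: env) s' with hs₁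
  have hfr₁ : ∀ a, a ≠ aSink → s₁ a = s' a := fun a ha =>
    Stmt.run_of_notMem_writes _ _ (by simpa [Stmt.writes] using ha) _ _
  have hY : ∀ w < N, s₁ aSink w ≠ 0 ↔ w = t := fun w hw => by
    rw [hs₁, run_forN_store (by decide) hw]
    simp only [Expr.eval, List.getD_cons_zero, List.getD_cons_succ, choice_ne_zero_iff]
    omega
  have hrow₁ : ∀ i < N, s₁ aRowN i = i * N := fun i hi => by
    rw [hfr₁ aRowN (by decide), hfrR aRowN (by decide), hc₀.rowN i hi.le]
  obtain ⟨hp, hsat⟩ := run_search (N := N) (env := t :: env) (s := s₁) hrow₁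
  have hF : ∀ u < N, ∀ v < N, mat N s₁ aRes u v ≠ 0 ↔ splitCap n N E (deleted n st) u v ≠ 0 :=
    fun u hu v hv => by
      rw [mat_congr (hfr₁ aRes (by decide)), mat_congr (hfrR aRes (by decide)), mat_build h hu hv]
  have hdist := fun w (hw : w < N) => hp.ne_zero_iff hsat ht hY hF (fun u v huv => by
    rcases (splitCap_ne_zero_iff (by omega)).1 huv with h1 | h1 <;> omega) hw
  have hfr₂ : ∀ a, a ≠ aDist → a ≠ aNext → search.run N (t :: env) s₁ a = s₁ a := fun a h1 h2 =>
    Stmt.run_of_notMem_writes _ _ (by simp [search, Stmt.writes, h1, h2]) _ _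
  set s₂ := search.run N (t :: env) s₁ with hs₂
  have hold : ∀ a, a ≠ aSink → a ≠ aDist → a ≠ aNext → s₂ a = s' a := fun a h1 h2 h3 => by
    rw [hfr₂ a h2 h3, hfr₁ a h1]
  have inner := Stmt.run_forN (N := N) (env := t :: env) (s := s₂)
    (p := store aReach (add (load aRowN (var 1)) (var 0)) (load aDist (var 0)))
    (fun k s'' => ∀ u < t + 1, ∀ w < N, (u < t ∨ w < k) →
      (mat N s'' aReach u w ≠ 0 ↔ NetReach n N E (deleted n st) w u)) ?_ ?_
  · exact inner u hu w hw (.inr hw)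
  · intro u _ w hw h1
    rw [mat_congr (hold aReach (by decide) (by decide) (by decide))]
    exact ih u (by omega) w hw
  · intro k hk s₃ hfr₃ ih₃ u hu w hw h1
    have hfr₃' : ∀ a, a ≠ aReach → s₃ a = s₂ a := fun a ha =>
      hfr₃ a (by simpa [Stmt.writes] using ha)
    have hrow₃ : s₃ aRowN t = t * N := by
      rw [hfr₃' aRowN (by decide), hfr₂ aRowN (by decide) (by decide), hrow₁ t ht]
    simp only [mat, Stmt.run, Expr.eval, List.getD_cons_zero, List.getD_cons_succ, Store.set_apply,
      hrow₃, hfr₃' aDist (by decide), true_and, mul_add_inj hw hk]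
    split_ifs with h2
    · rw [h2.1, h2.2]
      exact hdist k hk
    · exact ih₃ u hu w hw (by omega)

theorem avoidReach_iff_netReach (hN : 0 < N) (hE : ∀ x y, E x y → x < n ∧ y < n) {Z : Finset ℕ}
    {u v : ℕ} (hu : u < n) (hv : v < n) (huZ : u ∉ Z) (hvZ : v ∉ Z) :
    AvoidReach E Z u v ↔ NetReach n N E Z u v := by
  refine ⟨netReach_of_avoidReach hN hE, fun h => ?_⟩
  rcases avoidReach_of_netReach hN hu h with h1 | h1
  · exact h1.2 huZ hvZ
  · omega

theorem run_checkSize (hN : n ≤ N) (h : Context n N r s T E st) :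
    checkSize.run N env st aBad 0 = (deleted n st).card - s := by
  rw [checkSize, Stmt.run_seq, Stmt.run_seq]
  set s₀ := (assign aCount (lit 0)).run N env st with hs₀
  have hfr₀ : ∀ a, a ≠ aCount → s₀ a = st a := fun a ha =>
    Stmt.run_of_notMem_writes _ _ (by simpa [assign, Stmt.writes] using ha) _ _
  have h0 : s₀ aCount 0 = 0 := by simp [hs₀, assign, Stmt.run, Expr.eval, Store.set_apply]
  set e : Expr := cond (sub (scalar aNum) (var 0)) (cond (load aDel (var 0)) (lit 1) (lit 0)) (lit 0)
    with he
  have heval : ∀ v ∈ Finset.range N, e.eval N (v :: env) s₀ = if v ∈ deleted n st then 1 else 0 := by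
    intro v _
    simp only [he, scalar, Expr.eval, List.getD_cons_zero, hfr₀ aNum (by decide),
      hfr₀ aDel (by decide), h.num]
    by_cases hv : v < n
    · rw [choice_of_ne (show n - v ≠ 0 by omega)]
      by_cases h1 : st aDel v = 0
      · rw [choice_of_eq h1, if_neg fun h2 => (mem_deleted hv).1 h2 h1]
      · rw [choice_of_ne h1, if_pos ((mem_deleted hv).2 h1)]
    · rw [choice_of_eq (show n - v = 0 by omega), if_neg fun h2 => hv (lt_of_mem_deleted h2)]
  have hsum := run_forN_sum (N := N) (env := env) (s := s₀) (a := aCount) (e := e) (by decide)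
  rw [h0, zero_add, Finset.sum_congr rfl heval, Finset.sum_ite_mem, Finset.sum_const, smul_eq_mul,
    mul_one, Finset.inter_eq_right.2 fun v hv => Finset.mem_range.2
      ((lt_of_mem_deleted hv).trans_le hN)] at hsum
  have hfr₁ : ∀ a, a ≠ aCount → (forN (assign aCount (add (scalar aCount) e))).run N env s₀ a =
      st a := fun a ha => by
    rw [← hfr₀ a ha]
    exact Stmt.run_of_notMem_writes _ _ (by simpa [assign, Stmt.writes] using ha) _ _
  change (forN (assign aCount (add (scalar aCount) e))).run N env s₀ aCount 0 = _ at hsum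
  generalize (forN (assign aCount (add (scalar aCount) e))).run N env s₀ = s₁ at hsum hfr₁
  simp [assign, scalar, Stmt.run, Expr.eval, Store.set_apply, hsum, hfr₁ aBudget (by decide),
    h.budget]

theorem run_checkBalance (hN : 2 * n ≤ N) (hE : ∀ x y, E x y → x < n ∧ y < n)
    (h : Context n N r s T E st)
    (hreach : ∀ t < N, ∀ w < N, mat N st aReach t w ≠ 0 ↔ NetReach n N E (deleted n st) w t) :
    checkBalance.run N env st aBad 0 = 0 ↔ st aBad 0 = 0 ∧ Balanced E T r (deleted n st) := by
  classical
  have main : checkBalance.run N env st aBad 0 = 0 ↔ st aBad 0 = 0 ∧ ∀ t < N, t ∈ T →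
      t ∉ deleted n st → (companions E T (deleted n st) t).card ≤ r := by
    refine Stmt.run_forN (N := N) (env := env) (s := st) (fun j s' => s' aBad 0 = 0 ↔ st aBad 0 = 0 ∧
      ∀ t < j, t ∈ T → t ∉ deleted n st → (companions E T (deleted n st) t).card ≤ r) (by simp) ?_
    intro t ht s' hfr ih
    have hfr' : ∀ a, a ≠ aCount → a ≠ aBad → s' a = st a := fun a h1 h2 =>
      hfr a (by simp [assign, Stmt.writes, h1, h2])
    have hterm := hfr' aTerm (by decide) (by decide)
    have hdel := hfr' aDel (by decide) (by decide)
    -- Each iteration adds one condition `q` to the conjunction; for a deleted vertex or a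
    -- non-terminal it is vacuous.
    have step : ∀ {p q : Prop}, (p ↔ (s' aBad 0 = 0 ∧ q)) →
        (q ↔ (t ∈ T → t ∉ deleted n st → (companions E T (deleted n st) t).card ≤ r)) →
        (p ↔ st aBad 0 = 0 ∧ ∀ t' < t + 1, t' ∈ T → t' ∉ deleted n st →
          (companions E T (deleted n st) t').card ≤ r) := by
      intro p q h1 h2
      rw [h1, ih, h2, and_assoc]
      refine and_congr_right fun _ => ⟨fun h3 t' ht' => ?_, fun h3 =>
        ⟨fun t' ht' => h3 t' (by omega), h3 t (by omega)⟩⟩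
      rcases Nat.lt_succ_iff_lt_or_eq.1 ht' with h4 | rfl
      exacts [h3.1 t' h4, h3.2]
    by_cases hcond : t ∈ T ∧ t ∉ deleted n st
    · obtain ⟨htT, htZ⟩ := hcond
      have htn := h.term_lt t htT
      have hguard : (cond (load aTerm (var 0)) (cond (load aDel (var 0)) (lit 0) (lit 1))
          (lit 0)).eval N (t :: env) s' ≠ 0 := by
        simp only [Expr.eval, List.getD_cons_zero, choice_ne_zero_iff, hterm, hdel]
        exact .inl ⟨(h.term t).2 htT, .inr ⟨not_not.1 fun h1 => htZ ((mem_deleted htn).2 h1),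
          one_ne_zero⟩⟩
      rw [Stmt.run, choice_of_ne hguard, Stmt.run_seq, Stmt.run_seq]
      set s₀ := (assign aCount (lit 0)).run N (t :: env) s' with hs₀
      have hfr₀ : ∀ a, a ≠ aCount → s₀ a = s' a := fun a ha =>
        Stmt.run_of_notMem_writes _ _ (by simpa [assign, Stmt.writes] using ha) _ _
      have h0 : s₀ aCount 0 = 0 := by simp [hs₀, assign, Stmt.run, Expr.eval, Store.set_apply]
      set e : Expr := cond (load aTerm (var 0)) (cond (load aDel (var 0)) (lit 0)
        (cond (entry aReach (var 0) (var 1)) (cond (entry aReach (var 1) (var 0)) (lit 1) (lit 0))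
          (lit 0))) (lit 0) with he
      have heval : ∀ v ∈ Finset.range N, e.eval N (v :: t :: env) s₀ =
          if v ∈ companions E T (deleted n st) t then 1 else 0 := by
        intro v hv
        have hv := Finset.mem_range.1 hv
        have hrow : ∀ i < N, s₀ aRowN i = i * N := fun i hi => by
          rw [hfr₀ aRowN (by decide), hfr' aRowN (by decide) (by decide), h.rowN i hi.le]
        have hre : ∀ a < N, ∀ b < N, s₀ aReach (a * N + b) ≠ 0 ↔
            NetReach n N E (deleted n st) b a := fun a ha b hb => by
          rw [hfr₀ aReach (by decide), hfr' aReach (by decide) (by decide)]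
          exact hreach a ha b hb
        simp only [he, entry, Expr.eval, List.getD_cons_zero, List.getD_cons_succ, hrow v hv,
          hrow t ht, hfr₀ aTerm (by decide), hfr₀ aDel (by decide), hterm, hdel]
        by_cases hvT : v ∈ T
        · have hvn := h.term_lt v hvT
          rw [choice_of_ne ((h.term v).2 hvT)]
          by_cases hvZ : v ∈ deleted n st
          · rw [choice_of_ne ((mem_deleted hvn).1 hvZ), if_neg fun h1 =>
              (Finset.mem_filter.1 h1).2.1 hvZ]
          · rw [choice_of_eq (not_not.1 fun h1 => hvZ ((mem_deleted hvn).2 h1))]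
            have e1 := avoidReach_iff_netReach (N := N) (by omega) hE htn hvn htZ hvZ
            have e2 := avoidReach_iff_netReach (N := N) (by omega) hE hvn htn hvZ htZ
            rw [← hre v hv t ht] at e1
            rw [← hre t ht v hv] at e2
            have e3 : v ∈ companions E T (deleted n st) t ↔
                AvoidReach E (deleted n st) t v ∧ AvoidReach E (deleted n st) v t := by
              simp [companions, hvT, hvZ]
            by_cases h1 : s₀ aReach (v * N + t) = 0
            · rw [choice_of_eq h1, if_neg fun h2 => e1.1 (e3.1 h2).1 h1]
            · rw [choice_of_ne h1]
              by_cases h2 : s₀ aReach (t * N + v) = 0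
              · rw [choice_of_eq h2, if_neg fun h3 => e2.1 (e3.1 h3).2 h2]
              · rw [choice_of_ne h2, if_pos (e3.2 ⟨e1.2 h1, e2.2 h2⟩)]
        · rw [choice_of_eq (not_not.1 fun h1 => hvT ((h.term v).1 h1)), if_neg fun h1 => hvT (mem_of_mem_companions h1)]
      have hsum := run_forN_sum (N := N) (env := t :: env) (s := s₀) (a := aCount) (e := e)
        (by decide)
      rw [h0, zero_add, Finset.sum_congr rfl heval, Finset.sum_ite_mem, Finset.sum_const,
        smul_eq_mul, mul_one, Finset.inter_eq_right.2 fun v hv => Finset.mem_range.2 (by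
          have := h.term_lt v (mem_of_mem_companions hv)
          omega)] at hsum
      have hfr₁ : ∀ a, a ≠ aCount → (forN (assign aCount (add (scalar aCount) e))).run N (t :: env) s₀ a
          = s' a := fun a ha => by
        rw [← hfr₀ a ha]
        exact Stmt.run_of_notMem_writes _ _ (by simpa [assign, Stmt.writes] using ha) _ _
      change (forN (assign aCount (add (scalar aCount) e))).run N (t :: env) s₀ aCount 0 = _ at hsum
      change ((ite (sub (scalar aCount) (scalar aBound)) (assign aBad (lit 1)) skip).run N (t :: env)
        ((forN (assign aCount (add (scalar aCount) e))).run N (t :: env) s₀) aBad 0 = 0 ↔ _)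
      generalize (forN (assign aCount (add (scalar aCount) e))).run N (t :: env) s₀ = s₁ at hsum hfr₁
      have hb : s₁ aBound 0 = r := by
        rw [hfr₁ aBound (by decide), hfr' aBound (by decide) (by decide), h.bound]
      have hval : (sub (scalar aCount) (scalar aBound)).eval N (t :: env) s₁ =
          (companions E T (deleted n st) t).card - r := by
        simp [scalar, Expr.eval, hsum, hb]
      refine step (q := (companions E T (deleted n st) t).card ≤ r) ?_
        ⟨fun h1 _ _ => h1, fun h1 => h1 htT htZ⟩
      rw [Stmt.run, hval]
      by_cases hle : (companions E T (deleted n st) t).card ≤ r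
      · rw [choice_of_eq (by omega), Stmt.run, hfr₁ aBad (by decide)]
        simp [hle]
      · rw [choice_of_ne (by omega)]
        simp [assign, Stmt.run, Expr.eval, Store.set_apply, hle]
    · have hguard : (cond (load aTerm (var 0)) (cond (load aDel (var 0)) (lit 0) (lit 1))
          (lit 0)).eval N (t :: env) s' = 0 := by
        by_contra hne
        simp only [Expr.eval, List.getD_cons_zero, ← ne_eq, choice_ne_zero_iff, hterm, hdel] at hne
        rcases hne with ⟨h1, h2⟩ | h1
        · have htT := (h.term t).1 h1
          rcases h2 with h2 | h2
          · exact h2.2 rfl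
          · exact hcond ⟨htT, fun h3 => (mem_deleted (h.term_lt t htT)).1 h3 h2.1⟩
        · exact h1.2 rfl
      rw [Stmt.run, choice_of_eq hguard, Stmt.run]
      exact step (q := True) (by simp) ⟨fun _ h1 h2 => absurd ⟨h1, h2⟩ hcond, fun _ => trivial⟩
  rw [main]
  exact and_congr_right fun _ => ⟨fun h1 t ht => h1 t (by have := h.term_lt t ht; omega) ht,
    fun h1 t _ ht => h1 t ht⟩

/-- The test is exact: bad advice cannot cause a wrong answer, and the outcome of good advice is
never rejected. -/
theorem run_check (hN : 2 * n ≤ N) (hE : ∀ x y, E x y → x < n ∧ y < n)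
    (h : Context n N r s T E st) :
    check.run N env st aBad 0 = 0 ↔ (deleted n st).card ≤ s ∧ Balanced E T r (deleted n st) := by
  rw [check, Stmt.run_seq, Stmt.run_seq]
  have hc₁ : Context n N r s T E (checkSize.run N env st) := h.run (by decide)
  have hd₁ : deleted n (checkSize.run N env st) = deleted n st := by
    unfold deleted
    rw [Stmt.run_of_notMem_writes _ _ (by decide)]
  have hb₁ := run_checkSize (env := env) (by omega) h
  set s₁ := checkSize.run N env st
  have hc₂ : Context n N r s T E (allReach.run N env s₁) := hc₁.run (by decide)
  have hd₂ : deleted n (allReach.run N env s₁) = deleted n st := by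
    rw [← hd₁]
    unfold deleted
    rw [Stmt.run_of_notMem_writes _ _ (by decide)]
  have hb₂ : allReach.run N env s₁ aBad = s₁ aBad := Stmt.run_of_notMem_writes _ _ (by decide) _ _
  rw [run_checkBalance hN hE hc₂ fun t ht w hw => by rw [run_allReach hN hc₁ ht hw, hd₂, hd₁], hd₂,
    hb₂, hb₁, Nat.sub_eq_zero_iff_le]

end SeparatorProgram

namespace SeparatorProgram

open BoundedLoop Stmt Expr Network

variable {n N r s : ℕ} {T : Finset ℕ} {E : ℕ → ℕ → Prop} {st : Store} {env : List ℕ}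

/-! ### Enumerating the advice -/

/-- The digits of `m` in base `k + 1`. -/
def digit (k m i : ℕ) : ℕ := m / (k + 1) ^ i % (k + 1)

/-- Divisibility of `m + 1` by `(k + 1) ^ j` is how a carry that has reached position `j` is
expressed. -/
theorem digit_eq_zero_of_dvd {k m i j : ℕ} (h : (k + 1) ^ j ∣ m) (hij : i < j) :
    digit k m i = 0 := by
  obtain ⟨c, rfl⟩ := (pow_dvd_pow (k + 1) (Nat.succ_le_of_lt hij)).trans h
  rw [digit, pow_succ, mul_assoc, Nat.mul_div_cancel_left _ (Nat.pow_pos (Nat.succ_pos k)),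
    Nat.mul_mod_right]

theorem digit_add {k m i j : ℕ} : digit k m (j + i) = digit k (m / (k + 1) ^ j) i := by
  rw [digit, digit, pow_add, Nat.div_div_eq_div_mul]

theorem digit_le (k m i : ℕ) : digit k m i ≤ k := Nat.le_of_lt_succ (Nat.mod_lt _ (Nat.succ_pos k))

/-- How adding one with carry at position `j` changes the digits. -/
theorem digit_succ_of_dvd {k m j : ℕ} (h : (k + 1) ^ j ∣ m + 1) :
    (digit k m j < k → digit k (m + 1) j = digit k m j + 1 ∧
      (∀ i, j < i → digit k (m + 1) i = digit k m i) ∧ ¬(k + 1) ^ (j + 1) ∣ m + 1) ∧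
    (digit k m j = k → (k + 1) ^ (j + 1) ∣ m + 1) := by
  obtain ⟨c, hc⟩ := h
  have hpos : 0 < (k + 1) ^ j := Nat.pow_pos (Nat.succ_pos k)
  have hc0 : c ≠ 0 := by
    rintro rfl
    omega
  obtain ⟨d, rfl⟩ := Nat.exists_eq_succ_of_ne_zero hc0
  -- The last `j` digits of `m` are maximal, so its quotient is one less than that of `m + 1`.
  have hm : m / (k + 1) ^ j = d := by
    have : m = (k + 1) ^ j * d + ((k + 1) ^ j - 1) := by
      rw [Nat.succ_eq_add_one, mul_add] at hc
      omega
    rw [this, Nat.mul_add_div hpos, Nat.div_eq_of_lt (by omega), add_zero]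
  have hm1 : (m + 1) / (k + 1) ^ j = d + 1 := by rw [hc, Nat.mul_div_cancel_left _ hpos]
  have hdig : digit k m j = d % (k + 1) := by rw [digit, hm]
  have hdvd : (k + 1) ^ (j + 1) ∣ m + 1 ↔ (k + 1) ∣ d + 1 := by
    rw [hc, pow_succ]
    exact Nat.mul_dvd_mul_iff_left hpos
  have hmod := Nat.div_add_mod d (k + 1)
  rw [hdig, hdvd]
  constructor
  · intro hlt
    have hdec : d + 1 = (k + 1) * (d / (k + 1)) + (d % (k + 1) + 1) := by omega
    have hq : (d + 1) / (k + 1) = d / (k + 1) := by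
      have h0 : (d % (k + 1) + 1) / (k + 1) = 0 := Nat.div_eq_of_lt (by omega)
      rw [hdec, Nat.mul_add_div (Nat.succ_pos k), h0, add_zero]
    have hr : (d + 1) % (k + 1) = d % (k + 1) + 1 := by
      rw [hdec, Nat.mul_add_mod, Nat.mod_eq_of_lt (by omega)]
    refine ⟨by rw [digit, hm1, hr], fun i hi => ?_, fun hd => ?_⟩
    · obtain ⟨i, rfl⟩ : ∃ i', i = j + 1 + i' := ⟨i - (j + 1), by omega⟩
      rw [digit_add, digit_add, pow_succ, ← Nat.div_div_eq_div_mul, ← Nat.div_div_eq_div_mul, hm,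
        hm1, hq]
    · have := Nat.eq_zero_of_dvd_of_lt hd
      rw [Nat.dvd_iff_mod_eq_zero, hr] at hd
      omega
  · intro heq
    refine ⟨d / (k + 1) + 1, ?_⟩
    rw [mul_add, mul_one]
    omega

/-- Every sequence of digits comes from a number. -/
theorem exists_digit_eq (k L : ℕ) : ∀ a : ℕ → ℕ, (∀ i < L, a i ≤ k) →
    ∃ m < (k + 1) ^ L, ∀ i < L, digit k m i = a i := by
  induction L with
  | zero => exact fun a _ => ⟨0, by simp, by simp⟩
  | succ L ih =>
    intro a ha
    obtain ⟨m, hm, hdig⟩ := ih (fun i => a (i + 1)) fun i hi => ha (i + 1) (by omega)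
    have h0 := ha 0 (by omega)
    refine ⟨(k + 1) * m + a 0, ?_, fun i hi => ?_⟩
    · calc (k + 1) * m + a 0 < (k + 1) * m + (k + 1) := by omega
        _ = (k + 1) * (m + 1) := by ring
        _ ≤ (k + 1) * (k + 1) ^ L := Nat.mul_le_mul_left _ hm
        _ = (k + 1) ^ (L + 1) := by ring
    · cases i with
      | zero => rw [digit, pow_zero, Nat.div_one, Nat.mul_add_mod, Nat.mod_eq_of_lt (by omega)]
      | succ i =>
        rw [add_comm i 1, digit_add, pow_one, Nat.mul_add_div (Nat.succ_pos k),
          Nat.div_eq_of_lt (by omega), add_zero, hdig i (by omega), add_comm 1 i]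

/-- The advice array holds the digits of `m`. -/
def HoldsAdvice (T : Finset ℕ) (st : Store) (m : ℕ) : Prop :=
  ∀ j < 3 * T.card, st aAdvice j = digit T.card m j

theorem run_advance (hN : 4 * n ≤ N) (h : Context n N r s T E st) {m : ℕ}
    (hadv : HoldsAdvice T st m) (hm : m < (T.card + 1) ^ (3 * T.card)) (hrun : st aRun 0 ≠ 0) :
    (m + 1 = (T.card + 1) ^ (3 * T.card) ∧ advance.run N env st aRun 0 = 0) ∨
    (m + 1 < (T.card + 1) ^ (3 * T.card) ∧ advance.run N env st aRun 0 ≠ 0 ∧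
      HoldsAdvice T (advance.run N env st) (m + 1)) := by
  have hkn : T.card ≤ n := by
    simpa using Finset.card_le_card fun t ht => Finset.mem_range.2 (h.term_lt t ht)
  set k := T.card with hk
  rw [advance, Stmt.run_seq, Stmt.run_seq]
  set s₀ := (assign aCarry (lit 1)).run N env st with hs₀
  have hfr₀ : ∀ a, a ≠ aCarry → s₀ a = st a := fun a ha =>
    Stmt.run_of_notMem_writes _ _ (by simpa [assign, Stmt.writes] using ha) _ _
  have h0 : s₀ aCarry 0 = 1 := by simp [hs₀, assign, Stmt.run, Expr.eval, Store.set_apply]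
  have main := Stmt.run_forN (N := N) (env := env) (s := s₀) (p := ite (cond (scalar aCarry)
      (sub (add numTerminals (add numTerminals numTerminals)) (var 0)) (lit 0))
    (ite (sub numTerminals (load aAdvice (var 0)))
      (seq (store aAdvice (var 0) (add (load aAdvice (var 0)) (lit 1))) (assign aCarry (lit 0)))
      (store aAdvice (var 0) (lit 0))) skip)
    -- While the carry is alive, the digits passed are zero and the others are those of `m`; once it
    -- is absorbed, all are those of `m + 1`. The minimum accounts for idle iterations beyond the
    -- last digit.
    (fun j s' => (s' aCarry 0 ≠ 0 ∧ (k + 1) ^ (min j (3 * k)) ∣ m + 1 ∧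
        (∀ i < min j (3 * k), s' aAdvice i = 0) ∧
        ∀ i < 3 * k, j ≤ i → s' aAdvice i = digit k m i) ∨
      (s' aCarry 0 = 0 ∧ ¬(k + 1) ^ (3 * k) ∣ m + 1 ∧ ∀ i < 3 * k, s' aAdvice i = digit k (m + 1) i))
    ?_ ?_
  · have hrun₁ : (forN (ite (cond (scalar aCarry)
        (sub (add numTerminals (add numTerminals numTerminals)) (var 0)) (lit 0))
        (ite (sub numTerminals (load aAdvice (var 0)))
        (seq (store aAdvice (var 0) (add (load aAdvice (var 0)) (lit 1))) (assign aCarry (lit 0)))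
        (store aAdvice (var 0) (lit 0))) skip)).run N env s₀ aRun = st aRun := by
      rw [Stmt.run_of_notMem_writes _ _ (by decide), hfr₀ aRun (by decide)]
    generalize (forN (ite (cond (scalar aCarry)
        (sub (add numTerminals (add numTerminals numTerminals)) (var 0)) (lit 0))
        (ite (sub numTerminals (load aAdvice (var 0)))
        (seq (store aAdvice (var 0) (add (load aAdvice (var 0)) (lit 1))) (assign aCarry (lit 0)))
        (store aAdvice (var 0) (lit 0))) skip)).run N env s₀ = s₁ at main hrun₁
    rcases main with ⟨h1, h2, -⟩ | ⟨h1, h2, h3⟩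
    · left
      have h1' : (scalar aCarry).eval N env s₁ ≠ 0 := h1
      rw [Stmt.run, choice_of_ne h1']
      rw [min_eq_right (by omega)] at h2
      refine ⟨le_antisymm hm (Nat.le_of_dvd (Nat.succ_pos m) h2), ?_⟩
      simp [assign, Stmt.run, Expr.eval, Store.set_apply]
    · right
      have h1' : (scalar aCarry).eval N env s₁ = 0 := h1
      rw [Stmt.run, choice_of_eq h1', Stmt.run, hrun₁]
      refine ⟨lt_of_le_of_ne hm fun heq => h2 ?_, hrun, h3⟩
      exact dvd_of_eq heq.symm
  · refine .inl ⟨by rw [h0]; exact one_ne_zero, by simp, by simp, fun i hi _ => ?_⟩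
    rw [hfr₀ aAdvice (by decide)]
    exact hadv i hi
  · intro j hj s' hfr ih
    have hfr' : ∀ a, a ≠ aAdvice → a ≠ aCarry → s' a = st a := fun a h1 h2 => by
      rw [hfr a (by simp [assign, Stmt.writes, h1, h2]), hfr₀ a h2]
    have hK : ∀ env', numTerminals.eval N env' s' = k := fun env' =>
      (h.congr fun a ha => hfr' a (by omega) (by omega)).numTerminals (by omega)
    by_cases hcond : s' aCarry 0 ≠ 0 ∧ j < 3 * k
    · obtain ⟨hcarry, hj3⟩ := hcond
      have hguard : (cond (scalar aCarry)
          (sub (add numTerminals (add numTerminals numTerminals)) (var 0)) (lit 0)).eval N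
          (j :: env) s' ≠ 0 := by
        simp only [scalar, Expr.eval, List.getD_cons_zero, choice_ne_zero_iff, hK]
        exact .inl ⟨hcarry, by omega⟩
      rw [Stmt.run, choice_of_ne hguard]
      rcases ih with ⟨_, h2, h3, h4⟩ | h1
      swap
      · exact absurd h1.1 hcarry
      rw [min_eq_left hj3.le] at h2 h3
      have hdj := h4 j hj3 le_rfl
      have hle := digit_le k m j
      obtain ⟨s1, s2⟩ := digit_succ_of_dvd h2
      have hval : (sub numTerminals (load aAdvice (var 0))).eval N (j :: env) s' = k - digit k m j := by
        simp only [Expr.eval, List.getD_cons_zero, hK, hdj]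
      by_cases hlt : digit k m j < k
      · obtain ⟨e1, e2, e3⟩ := s1 hlt
        right
        rw [Stmt.run, choice_of_ne (by omega)]
        simp only [assign, Stmt.run, Expr.eval, List.getD_cons_zero, Store.set_apply]
        refine ⟨by simp, fun hd => e3 ((pow_dvd_pow _ hj3).trans hd), fun i hi => ?_⟩
        rcases lt_trichotomy i j with h5 | rfl | h5
        · simpa [h5.ne, digit_eq_zero_of_dvd h2 h5] using h3 i h5
        · simp [hdj, e1]
        · simpa [h5.ne', e2 i h5] using h4 i hi h5.le
      · left
        rw [Stmt.run, choice_of_eq (by omega), min_eq_left (by omega)]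
        simp only [Stmt.run, Expr.eval, List.getD_cons_zero, Store.set_apply]
        refine ⟨by simpa using hcarry, s2 (by omega), fun i hi => ?_, fun i hi hji => ?_⟩
        · by_cases h5 : i = j
          · simp [h5]
          · simpa [h5] using h3 i (by omega)
        · have h5 : i ≠ j := by omega
          simpa [h5] using h4 i hi (by omega)
    · have hguard : (cond (scalar aCarry)
          (sub (add numTerminals (add numTerminals numTerminals)) (var 0)) (lit 0)).eval N
          (j :: env) s' = 0 := by
        by_contra hne
        simp only [scalar, Expr.eval, List.getD_cons_zero, ← ne_eq, choice_ne_zero_iff, hK] at hne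
        rcases hne with h1 | h1
        · exact hcond ⟨h1.1, by omega⟩
        · exact h1.2 rfl
      rw [Stmt.run, choice_of_eq hguard, Stmt.run]
      rcases ih with ⟨h1, h2, h3, h4⟩ | h1
      · have hj3 : 3 * k ≤ j := by
          by_contra hlt
          exact hcond ⟨h1, by omega⟩
        rw [min_eq_right (by omega)] at h2 h3 ⊢
        exact .inl ⟨h1, h2, h3, fun i hi hji => absurd hi (by omega)⟩
      · exact .inr h1

/-- Advice that is certain to lead to a solution. -/
def GoodAdvice (n N r s : ℕ) (T : Finset ℕ) (E : ℕ → ℕ → Prop) (A : ℕ → ℕ) : Prop :=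
  ∃ (g : ℕ → ℕ) (bs : List Bool), (∀ t ∈ T, g t = A (T.filter (· < t)).card) ∧
    bs.length = 2 * T.card ∧ (∀ j (hj : j < bs.length), bs[j] = true ↔ A (T.card + j) ≠ 0) ∧
    (labeled n N E T s g).Wins N bs (T.filter fun t => g t = 0) ∅ (T.card + 1) ∧
    ∀ Z, (labeled n N E T s g).Solves Z → Balanced E T r Z ∧ Z.card ≤ s

theorem card_filter_lt_lt {t : ℕ} (ht : t ∈ T) : (T.filter (· < t)).card < T.card :=
  Finset.card_lt_card ⟨Finset.filter_subset _ _, fun h =>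
    lt_irrefl t (Finset.mem_filter.1 (h ht)).2⟩

/-- If there is a solution, then some advice is good. -/
theorem exists_goodAdvice (hN : 4 * n + 1 ≤ N) (hE : ∀ x y, E x y → x < n ∧ y < n)
    (hT : ∀ t ∈ T, t < n) (hs : s < T.card) {Z : Finset ℕ} (hZ : ∀ v ∈ Z, v < n)
    (hcard : Z.card ≤ s) (hbal : Balanced E T r Z) :
    ∃ m < (T.card + 1) ^ (3 * T.card), GoodAdvice n N r s T E (digit T.card m) := by
  have hkn : T.card ≤ n := by
    simpa using Finset.card_le_card fun t ht => Finset.mem_range.2 (hT t ht)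
  obtain ⟨g, hg, ⟨l, b, hb, hfeas⟩, hsolve⟩ := hbal.exists_label (N := N) (by omega) (by omega) hE hT
    hZ hcard (by omega)
  -- The measure starts at `2 * b ≤ 2 * T.card`, which bounds the bits, and `T.card + 1 + 2 * b ≤
  -- N`, so `N` rounds suffice.
  obtain ⟨bs, hlen, hwins⟩ := hfeas.exists_wins (show 2 * n ≤ N by omega) N (2 * T.card) (by omega)
    (by omega)
  have hrank : ∀ t ∈ T, ∀ t' ∈ T, (T.filter (· < t)).card = (T.filter (· < t')).card → t = t' := by
    have aux : ∀ t ∈ T, ∀ t' ∈ T, t < t' → (T.filter (· < t)).card < (T.filter (· < t')).card :=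
      fun t ht t' _ hlt => Finset.card_lt_card ⟨fun x hx => Finset.mem_filter.2
        ⟨(Finset.mem_filter.1 hx).1, (Finset.mem_filter.1 hx).2.trans hlt⟩, fun hsub =>
        lt_irrefl t (Finset.mem_filter.1 (hsub (Finset.mem_filter.2 ⟨ht, hlt⟩))).2⟩
    intro t ht t' ht' heq
    rcases lt_trichotomy t t' with h1 | h1 | h1
    · exact absurd heq (aux t ht t' ht' h1).ne
    · exact h1
    · exact absurd heq (aux t' ht' t ht h1).ne'
  -- First the labels, in increasing order of the terminals, then the bits. The supremum ranges over
  -- the only terminal of rank `j`.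
  let a : ℕ → ℕ := fun j => if j < T.card then (T.filter fun t => (T.filter (· < t)).card = j).sup g
    else if bs.getD (j - T.card) false then 1 else 0
  have ha : ∀ j < 3 * T.card, a j ≤ T.card := by
    intro j _
    simp only [a]
    split_ifs with h1 h2
    · exact Finset.sup_le fun t ht => hg t (Finset.mem_filter.1 ht).1
    -- The digit `1` is admissible because there is at least one terminal.
    · omega
    · omega
  obtain ⟨m, hm, hdig⟩ := exists_digit_eq T.card (3 * T.card) a ha
  refine ⟨m, hm, g, bs, fun t ht => ?_, hlen, fun j hj => ?_, hwins, hsolve⟩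
  · have hlt := card_filter_lt_lt ht
    rw [hdig _ (by omega)]
    simp only [a, hlt, if_true]
    have : (T.filter fun t' => (T.filter (· < t')).card = (T.filter (· < t)).card) = {t} := by
      ext t'
      simp only [Finset.mem_filter, Finset.mem_singleton]
      exact ⟨fun h1 => hrank t' h1.1 t ht h1.2, fun h1 => by rw [h1]; exact ⟨ht, rfl⟩⟩
    rw [this, Finset.sup_singleton]
  · rw [hdig _ (by omega)]
    have h1 : ¬T.card + j < T.card := by omega
    simp [a, hj]

/-- The effect of testing one advice. -/
theorem run_testAdvice (hN : 4 * n + 1 ≤ N) (hE : ∀ x y, E x y → x < n ∧ y < n)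
    (h : Context n N r s T E st) {m : ℕ} (hadv : HoldsAdvice T st m)
    (hm : m < (T.card + 1) ^ (3 * T.card)) (hrun : st aRun 0 ≠ 0) (hans : st aAns 0 = 0) :
    (testAdvice.run N env st aRun 0 = 0 ∧ testAdvice.run N env st aAns 0 ≠ 0 ∧
      (deleted n (testAdvice.run N env st)).card ≤ s ∧
      Balanced E T r (deleted n (testAdvice.run N env st))) ∨
    (¬GoodAdvice n N r s T E (digit T.card m) ∧ testAdvice.run N env st aAns 0 = 0 ∧
      ((m + 1 = (T.card + 1) ^ (3 * T.card) ∧ testAdvice.run N env st aRun 0 = 0) ∨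
      (m + 1 < (T.card + 1) ^ (3 * T.card) ∧ testAdvice.run N env st aRun 0 ≠ 0 ∧
        HoldsAdvice T (testAdvice.run N env st) (m + 1)))) := by
  rw [testAdvice, Stmt.run_seq, Stmt.run_seq]
  have hc₁ : Context n N r s T E (candidate.run N env st) := h.run (by decide)
  have hgood : GoodAdvice n N r s T E (digit T.card m) →
      (deleted n (candidate.run N env st)).card ≤ s ∧
        Balanced E T r (deleted n (candidate.run N env st)) := by
    rintro ⟨g, bs, hg, hlen, hbs, hwins, hsolve⟩
    have := run_candidate (env := env) (show 2 * n ≤ N by omega) h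
      (fun t ht => by
        have := card_filter_lt_lt ht
        rw [hadv _ (by omega)]
        exact hg t ht)
      (fun j hj => by
        rw [hadv _ (by omega)]
        exact hbs j hj) hwins
    exact (hsolve _ this).symm
  have hfr₁ : ∀ a ∈ [aAdvice, aRun, aAns], candidate.run N env st a = st a := fun a ha =>
    Stmt.run_of_notMem_writes _ _
      ((by decide : ∀ a ∈ [aAdvice, aRun, aAns], a ∉ candidate.writes) a ha) _ _
  set s₁ := candidate.run N env st
  have hcheck := run_check (env := env) (show 2 * n ≤ N by omega) hE hc₁
  have hc₂ : Context n N r s T E (check.run N env s₁) := hc₁.run (by decide)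
  have hfr₂ : ∀ a ∈ [aAdvice, aRun, aAns, aDel], check.run N env s₁ a = s₁ a := fun a ha =>
    Stmt.run_of_notMem_writes _ _
      ((by decide : ∀ a ∈ [aAdvice, aRun, aAns, aDel], a ∉ check.writes) a ha) _ _
  set s₂ := check.run N env s₁
  by_cases hbad : s₂ aBad 0 = 0
  · left
    have hbad' : (scalar aBad).eval N env s₂ = 0 := hbad
    have hd : ∀ s', s' aDel = s₂ aDel → deleted n s' = deleted n s₁ := fun s' hs' => by
      unfold deleted
      rw [hs', hfr₂ aDel (by decide)]
    rw [Stmt.run, choice_of_eq hbad', hd _ (Stmt.run_of_notMem_writes _ _ (by decide) _ _)]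
    refine ⟨?_, ?_, hcheck.1 hbad⟩
    · simp [assign, Stmt.run, Expr.eval, Store.set_apply]
    · simp [assign, Stmt.run, Expr.eval, Store.set_apply]
  · right
    have hbad' : (scalar aBad).eval N env s₂ ≠ 0 := hbad
    rw [Stmt.run, choice_of_ne hbad']
    refine ⟨fun hg => hbad (hcheck.2 (hgood hg)), ?_, run_advance (by omega) hc₂ (fun j hj => ?_) hm ?_⟩
    · rw [Stmt.run_of_notMem_writes _ _ (by decide), hfr₂ aAns (by decide), hfr₁ aAns (by decide),
        hans]
    · rw [hfr₂ aAdvice (by decide), hfr₁ aAdvice (by decide), hadv j hj]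
    · rwa [hfr₂ aRun (by decide), hfr₁ aRun (by decide)]

/-- The effect of the initialization. -/
theorem run_setUp (hN : n ≤ N) (hterm : ∀ v, st aTerm v = if v ∈ T then 1 else 0)
    (hT : ∀ t ∈ T, t < n) (hadj : ∀ u < n, ∀ v < n, st aAdj (u * n + v) ≠ 0 ↔ E u v)
    (hnum : st aNum 0 = n) (hbound : st aBound 0 = r) (hbudget : st aBudget 0 = s)
    (hzero : ∀ a, a ∉ [aTerm, aAdj, aNum, aBound, aBudget] → ∀ i, st a i = 0) :
    Context n N r s T E (setUp.run N env st) ∧ HoldsAdvice T (setUp.run N env st) 0 ∧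
    ((T.card ≤ s ∧ setUp.run N env st aRun 0 = 0 ∧ setUp.run N env st aAns 0 ≠ 0 ∧
      deleted n (setUp.run N env st) = T) ∨
    (s < T.card ∧ setUp.run N env st aRun 0 ≠ 0 ∧ setUp.run N env st aAns 0 = 0)) := by
  rw [setUp, Stmt.run_seq, Stmt.run_seq, Stmt.run_seq]
  set s₁ := (forN (store aRowN (add (var 0) (lit 1)) (add (load aRowN (var 0)) size))).run N env st
    with hs₁
  have hfr₁ : ∀ a, a ≠ aRowN → s₁ a = st a := fun a ha =>
    Stmt.run_of_notMem_writes _ _ (by simpa [Stmt.writes] using ha) _ _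
  have h₁ : ∀ i ≤ N, s₁ aRowN i = i * N := fun i hi => by
    rw [hs₁, run_forN_prefix (by decide) hi, hzero aRowN (by decide)]
    simp [Expr.eval]
  clear_value s₁
  set s₂ := (forN (store aRown (add (var 0) (lit 1)) (add (load aRown (var 0)) (scalar aNum)))).run N
    env s₁ with hs₂
  have hfr₂ : ∀ a, a ≠ aRown → s₂ a = s₁ a := fun a ha =>
    Stmt.run_of_notMem_writes _ _ (by simpa [Stmt.writes] using ha) _ _
  have h₂ : ∀ i ≤ N, s₂ aRown i = i * n := fun i hi => by
    rw [hs₂, run_forN_prefix (by decide) hi, hfr₁ aRown (by decide), hzero aRown (by decide)]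
    simp [scalar, Expr.eval, hfr₁ aNum (by decide), hnum]
  clear_value s₂
  set s₃ := (forN (store aRank (add (var 0) (lit 1)) (add (load aRank (var 0))
    (cond (load aTerm (var 0)) (lit 1) (lit 0))))).run N env s₂ with hs₃
  have hfr₃ : ∀ a, a ≠ aRank → s₃ a = s₂ a := fun a ha =>
    Stmt.run_of_notMem_writes _ _ (by simpa [Stmt.writes] using ha) _ _
  have hterm₂ : s₂ aTerm = st aTerm := by rw [hfr₂ aTerm (by decide), hfr₁ aTerm (by decide)]
  have h₃ : ∀ i ≤ N, s₃ aRank i = (T.filter (· < i)).card := fun i hi => by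
    rw [hs₃, run_forN_prefix (by decide) hi, hfr₂ aRank (by decide), hfr₁ aRank (by decide),
      hzero aRank (by decide), zero_add]
    have heval : ∀ v ∈ Finset.range i, (cond (load aTerm (var 0)) (lit 1) (lit 0)).eval N
        (v :: env) s₂ = if v ∈ T then 1 else 0 := fun v _ => by
      simp only [Expr.eval, List.getD_cons_zero, hterm₂, hterm]
      by_cases hv : v ∈ T <;> simp [hv, choice]
    rw [Finset.sum_congr rfl heval, Finset.sum_ite_mem, Finset.sum_const, smul_eq_mul, mul_one]
    congr 1
    ext v
    simp [and_comm]
  clear_value s₃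
  have hold : ∀ a, a ≠ aRowN → a ≠ aRown → a ≠ aRank → s₃ a = st a := fun a e1 e2 e3 => by
    rw [hfr₃ a e3, hfr₂ a e2, hfr₁ a e1]
  have hc₃ : Context n N r s T E s₃ := by
    refine ⟨fun v => ?_, hT, ?_, ?_, ?_, h₃, ?_, ?_, ?_⟩
    · rw [hold aTerm (by decide) (by decide) (by decide), hterm]
      by_cases hv : v ∈ T <;> simp [hv]
    · rw [hold aAdj (by decide) (by decide) (by decide)]
      exact hadj
    · rw [hfr₃ aRowN (by decide), hfr₂ aRowN (by decide)]
      exact h₁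
    · rw [hfr₃ aRown (by decide)]
      exact h₂
    · rw [hold aNum (by decide) (by decide) (by decide), hnum]
    · rw [hold aBound (by decide) (by decide) (by decide), hbound]
    · rw [hold aBudget (by decide) (by decide) (by decide), hbudget]
  have hz₃ : ∀ a ∈ [aAdvice, aRun, aAns], ∀ i, s₃ a i = 0 := fun a ha i => by
    rw [hold a (by rintro rfl; revert ha; decide) (by rintro rfl; revert ha; decide)
      (by rintro rfl; revert ha; decide)]
    exact hzero a ((by decide : ∀ a ∈ [aAdvice, aRun, aAns],
      a ∉ [aTerm, aAdj, aNum, aBound, aBudget]) a ha) i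
  refine ⟨hc₃.run (by decide), fun j _ => ?_, ?_⟩
  · rw [Stmt.run_of_notMem_writes _ _ (by decide), hz₃ aAdvice (by decide)]
    simp [digit]
  · have hval : (sub numTerminals (scalar aBudget)).eval N env s₃ = T.card - s := by
      rw [Expr.eval, hc₃.numTerminals hN, ← hc₃.budget]
      rfl
    -- If `s` is large, the terminals themselves are the answer. Otherwise `s < T.card`, which is
    -- what bounds the number of bits in terms of `T.card`.
    by_cases hle : T.card ≤ s
    · refine .inl ⟨hle, ?_⟩
      rw [Stmt.run, choice_of_eq (by omega)]
      refine ⟨?_, ?_, ?_⟩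
      · rw [Stmt.run_of_notMem_writes _ _ (by decide), hz₃ aRun (by decide)]
      · simp [assign, Stmt.run, Expr.eval, Store.set_apply]
      · ext v
        rw [Stmt.run_seq]
        unfold deleted
        rw [Stmt.run_of_notMem_writes (p := assign aAns (lit 1)) _ (by decide)]
        simp only [Finset.mem_filter, Finset.mem_range]
        constructor
        · rintro ⟨hv, hne⟩
          rw [run_forN_store (by decide) (by omega)] at hne
          exact (hc₃.term v).1 hne
        · intro hv
          have hvn := hT v hv
          refine ⟨hvn, ?_⟩
          rw [run_forN_store (by decide) (by omega)]
          exact (hc₃.term v).2 hv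
    · refine .inr ⟨by omega, ?_⟩
      rw [Stmt.run, choice_of_ne (by omega)]
      refine ⟨?_, ?_⟩
      · simp [assign, Stmt.run, Expr.eval, Store.set_apply]
      · rw [Stmt.run_of_notMem_writes _ _ (by decide), hz₃ aAns (by decide)]

end SeparatorProgram

/-! ### Strong components -/
namespace MultiDigraph

variable {V : Type*} {D : MultiDigraph V}

/-- The vertices in the strong component of `x`. -/
def strongClass (D : MultiDigraph V) (x : V) : Set V := {y | D.Reachable x y ∧ D.Reachable y x}

theorem Reachable.of_induce {S : Set V} {x y : S} (h : (D.induce S).Reachable x y) :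
    D.Reachable x y :=
  Relation.ReflTransGen.lift Subtype.val (fun _ _ hxy => hxy) _ _ h

/-- A walk between members of the class never leaves it: each vertex on the way is reachable from
`x` and reaches `x`. -/
theorem strongClass_stronglyConnected (x : V) :
    (D.induce (D.strongClass x)).StronglyConnected := by
  have key : ∀ u v : D.strongClass x, (D.induce (D.strongClass x)).Reachable u v := by
    intro u ⟨v, hv⟩
    have huv : D.Reachable u v := u.2.2.trans hv.1
    induction huv with
    | refl => exact .refl
    | @tail w v hw hwv ih =>
      have hw' : w ∈ D.strongClass x := ⟨u.2.1.trans hw, .head hwv hv.2⟩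
      exact (ih hw').tail (show 0 < D.mult w v from hwv)
  exact fun u v => ⟨key u v, key v u⟩

theorem strongClass_isStrongComponent (x : V) : D.IsStrongComponent (D.strongClass x) :=
  ⟨strongClass_stronglyConnected x, fun S hS hle y hy =>
    have hx : x ∈ S := hle ⟨.refl, .refl⟩
    ⟨(hS ⟨x, hx⟩ ⟨y, hy⟩).1.of_induce, (hS ⟨x, hx⟩ ⟨y, hy⟩).2.of_induce⟩⟩

theorem IsStrongComponent.eq_strongClass {C : Set V} (hC : D.IsStrongComponent C) {x : V}
    (hx : x ∈ C) : C = D.strongClass x :=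
  hC.eq_of_le (strongClass_stronglyConnected x) fun y hy =>
    ⟨(hC.prop ⟨x, hx⟩ ⟨y, hy⟩).1.of_induce, (hC.prop ⟨x, hx⟩ ⟨y, hy⟩).2.of_induce⟩

/-- Adjacency, on the numbers of the vertices. -/
def adj {n : ℕ} (D : MultiDigraph (Fin n)) (x y : ℕ) : Prop :=
  ∃ u v : Fin n, (u : ℕ) = x ∧ (v : ℕ) = y ∧ 0 < D.mult u v

open Network

variable {n : ℕ} {D : MultiDigraph (Fin n)} {T Z : Finset (Fin n)} {r : ℕ}

theorem avoidReach_adj_iff {x y : ((Z : Set (Fin n))ᶜ : Set (Fin n))} :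
    AvoidReach D.adj (Z.map Fin.valEmbedding) (x : Fin n) (y : Fin n) ↔
      (D.deleteVerts (Z : Set (Fin n))).Reachable x y := by
  have hmem : ∀ v : Fin n, (v : ℕ) ∉ Z.map Fin.valEmbedding ↔ v ∉ Z := fun v => by
    simp [Fin.val_inj]
  refine ⟨fun h => ?_, fun h => Relation.ReflTransGen.lift
    (fun w : ((Z : Set (Fin n))ᶜ : Set (Fin n)) => ((w : Fin n) : ℕ))
    (fun a b hab => ⟨(hmem a).2 a.2, (hmem b).2 b.2, a, b, rfl, rfl, hab⟩) _ _ h⟩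
  -- The end of the walk is an arbitrary number here, so that the induction can lift every prefix to
  -- surviving vertices.
  have key : ∀ m, AvoidReach D.adj (Z.map Fin.valEmbedding) (x : Fin n) m →
      ∃ w : ((Z : Set (Fin n))ᶜ : Set (Fin n)), ((w : Fin n) : ℕ) = m ∧
        (D.deleteVerts (Z : Set (Fin n))).Reachable x w := by
    intro m hm
    induction hm with
    | refl => exact ⟨x, rfl, .refl⟩
    | tail _ hstep ih =>
      obtain ⟨w, rfl, hw⟩ := ih
      obtain ⟨-, hz, u, v, hu, rfl, huv⟩ := hstep
      obtain rfl : u = w := Fin.ext hu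
      exact ⟨⟨v, (hmem v).1 hz⟩, rfl, hw.tail huv⟩
  obtain ⟨w, hw, hxw⟩ := key _ h
  rwa [← Subtype.ext (Fin.ext hw)]

theorem coe_companions_adj (x : ((Z : Set (Fin n))ᶜ : Set (Fin n))) :
    (companions D.adj (T.map Fin.valEmbedding) (Z.map Fin.valEmbedding) (x : Fin n) : Set ℕ) =
      Fin.val '' (Subtype.val '' (D.deleteVerts (Z : Set (Fin n))).strongClass x ∩
        (T : Set (Fin n))) := by
  ext m
  simp only [companions, Finset.coe_filter, Finset.mem_map, Fin.valEmbedding_apply, Set.mem_ofPred_eq,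
    Set.mem_image, Set.mem_inter_iff, Finset.mem_coe]
  constructor
  · rintro ⟨⟨v, hv, rfl⟩, hz, h1, h2⟩
    have hvz : v ∉ Z := fun h => hz ⟨v, h, rfl⟩
    exact ⟨v, ⟨⟨⟨v, hvz⟩, ⟨avoidReach_adj_iff.1 h1, avoidReach_adj_iff.1 h2⟩, rfl⟩, hv⟩, rfl⟩
  · rintro ⟨v, ⟨⟨y, ⟨h1, h2⟩, rfl⟩, hv⟩, rfl⟩
    refine ⟨⟨y, hv, rfl⟩, ?_, avoidReach_adj_iff.2 h1, avoidReach_adj_iff.2 h2⟩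
    rintro ⟨w, hw, hwy⟩
    exact y.2 (Fin.ext hwy ▸ hw)

theorem card_companions_adj (x : ((Z : Set (Fin n))ᶜ : Set (Fin n))) :
    (companions D.adj (T.map Fin.valEmbedding) (Z.map Fin.valEmbedding) (x : Fin n)).card =
      (Subtype.val '' (D.deleteVerts (Z : Set (Fin n))).strongClass x ∩
        (T : Set (Fin n))).ncard := by
  rw [← Set.ncard_coe_finset, coe_companions_adj, Set.ncard_image_of_injective _ Fin.val_injective]

/-- A component that contains a terminal is the class of that terminal, and one without terminals
satisfies the bound trivially. -/
theorem isBalancedSeparator_iff : D.IsBalancedSeparator T r Z ↔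
    Balanced D.adj (T.map Fin.valEmbedding) r (Z.map Fin.valEmbedding) := by
  constructor
  · intro h t ht htz
    obtain ⟨u, -, rfl⟩ := Finset.mem_map.1 ht
    have hu : u ∉ Z := fun hu => htz (Finset.mem_map_of_mem _ hu)
    have := card_companions_adj (D := D) (T := T) ⟨u, hu⟩
    exact this.trans_le (h _ (strongClass_isStrongComponent _))
  · intro h C hC
    obtain he | ⟨v, ⟨x, hx, rfl⟩, hv⟩ := (Subtype.val '' C ∩ (T : Set (Fin n))).eq_empty_or_nonempty
    · simp [he]
    · rw [hC.eq_strongClass hx, ← card_companions_adj]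
      refine h _ (Finset.mem_map_of_mem _ hv) fun hz => x.2 ?_
      obtain ⟨w, hw, hwx⟩ := Finset.mem_map.1 hz
      exact Fin.ext hwx ▸ hw

end MultiDigraph

/-! ### Running the algorithm on the machine -/
namespace SeparatorProgram

open RAM BoundedLoop Network

/-- Set register `0` to cell `0` of array `a`. -/
def loadFlag (a : ℕ) : Program := .seq (.const 3 0) (.load 0 a 3)

/-- Try advice until the flag is cleared. -/
def searchLoop : Program := .loop 0 (.seq (testAdvice.compile [] 3) (loadFlag aRun))

/-- Copy the parameters of the instance to arrays, and set registers `1` and `2` to `1` and `4n + 4`. -/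
def preamble : Program :=
  .seq (.const 3 0) (.seq (.store aNum 3 0) (.seq (.store aBound 3 1) (.seq (.store aBudget 3 2)
    (.seq (.const 4 4) (.seq (.add 5 0 0) (.seq (.add 5 5 5) (.seq (.add 2 5 4) (.const 1 1))))))))

/-- The program that solves Balanced Separator. -/
def program : Program :=
  .seq preamble (.seq (setUp.compile [] 3) (.seq (loadFlag aRun) (.seq searchLoop
    (.seq (finish.compile [] 3) (loadFlag aAns)))))

theorem exec_loadFlag (a : ℕ) (σ : State) : ∃ τ, Exec (loadFlag a) σ 2 τ ∧ τ.arr = σ.arr ∧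
    τ.reg 0 = σ.arr a 0 ∧ τ.reg 1 = σ.reg 1 ∧ τ.reg 2 = σ.reg 2 :=
  ⟨_, .seq (.const ..) (.load ..), rfl, by simp [State.setReg], by simp [State.setReg],
    by simp [State.setReg]⟩

theorem exec_compile_nil (p : Stmt) {N : ℕ} {σ : State} (h1 : σ.reg 1 = 1) (h2 : σ.reg 2 = N) :
    ∃ t τ, Exec (p.compile [] 3) σ t τ ∧ t ≤ p.cost N ∧ τ.arr = p.run N [] σ.arr ∧
      τ.reg 1 = 1 ∧ τ.reg 2 = N := by
  obtain ⟨t, τ, he, ht, harr, hreg⟩ := p.exec_compile (regs := []) (d := 3) (env := [])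
    ⟨by omega, h1, h2, by simp, rfl⟩
  exact ⟨t, τ, he, ht, harr, by rw [hreg 1 (by omega), h1], by rw [hreg 2 (by omega), h2]⟩

variable {n N r s : ℕ} {T : Finset ℕ} {E : ℕ → ℕ → Prop}

/-- Induction on the number `j` of advice numbers not yet tested. For `m = 0`, failure means that no
advice is good, which `exists_goodAdvice` turns into the absence of separators. -/
theorem exec_searchLoop (hN : 4 * n + 1 ≤ N) (hE : ∀ x y, E x y → x < n ∧ y < n) (j : ℕ) :
    ∀ (m : ℕ) (σ : State), m + j = (T.card + 1) ^ (3 * T.card) → 0 < j →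
      Context n N r s T E σ.arr → HoldsAdvice T σ.arr m → σ.reg 0 ≠ 0 → σ.arr aRun 0 ≠ 0 →
      σ.arr aAns 0 = 0 → σ.reg 1 = 1 → σ.reg 2 = N →
      ∃ t τ, Exec searchLoop σ t τ ∧ t ≤ j * (testAdvice.cost N + 3) + 1 ∧
        τ.reg 1 = 1 ∧ τ.reg 2 = N ∧
        ((τ.arr aAns 0 ≠ 0 ∧ (deleted n τ.arr).card ≤ s ∧ Balanced E T r (deleted n τ.arr)) ∨
          (τ.arr aAns 0 = 0 ∧ ∀ m', m ≤ m' → m' < (T.card + 1) ^ (3 * T.card) →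
            ¬GoodAdvice n N r s T E (digit T.card m'))) := by
  induction j with
  | zero => intro _ _ _ h; omega
  | succ j ih =>
    intro m σ hmj _ hctx hadv h0 hrun hans h1 h2
    obtain ⟨t, τ, he, ht, harr, h1', h2'⟩ := exec_compile_nil testAdvice h1 h2
    obtain ⟨υ, hl, hl_arr, hl0, hl1, hl2⟩ := exec_loadFlag aRun τ
    rw [h1'] at hl1
    rw [h2'] at hl2
    rw [← hl_arr] at harr hl0
    have hctx' : Context n N r s T E υ.arr := harr ▸ hctx.run (by decide)
    have hj : (j + 1) * (testAdvice.cost N + 3) =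
      j * (testAdvice.cost N + 3) + (testAdvice.cost N + 3) := by ring
    have hstep := run_testAdvice (env := []) hN hE hctx hadv (by omega) hrun hans
    rw [← harr] at hstep
    obtain ⟨hr, ha, hc, hb⟩ | ⟨hbad, ha, ⟨hm, hr⟩ | ⟨hm, hr, hadv'⟩⟩ := hstep
    · exact ⟨_, υ, .loopTrue h0 (he.seq hl) (.loopFalse (hl0.trans hr)), by omega, hl1, hl2,
        .inl ⟨ha, hc, hb⟩⟩
    · refine ⟨_, υ, .loopTrue h0 (he.seq hl) (.loopFalse (hl0.trans hr)), by omega, hl1, hl2,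
        .inr ⟨ha, fun m' h h' => ?_⟩⟩
      obtain rfl : m' = m := by omega
      exact hbad
    · obtain ⟨t', ρ, he', ht', hρ1, hρ2, hρ⟩ := ih (m + 1) υ (by omega) (by omega) hctx' hadv'
        (by rwa [hl0]) hr ha hl1 hl2
      refine ⟨_, ρ, .loopTrue h0 (he.seq hl) he', by omega, hρ1, hρ2, hρ.imp_right
        fun ⟨h, h'⟩ => ⟨h, fun m' hle hlt => ?_⟩⟩
      rcases hle.eq_or_lt with rfl | hlt'
      · exact hbad
      · exact h' m' hlt' hlt

/-- The common loop length covers the `2 * n` nodes, the `3 * T.card` digits and the rounds of the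
branching. It is obtained by doubling `n` twice, after the parameters in registers `1` and `2` have
been saved. -/
theorem exec_preamble {σ : State} : ∃ t τ, Exec preamble σ t τ ∧ t ≤ 9 ∧ τ.reg 1 = 1 ∧
    τ.reg 2 = 4 * σ.reg 0 + 4 ∧ τ.arr aNum 0 = σ.reg 0 ∧ τ.arr aBound 0 = σ.reg 1 ∧
    τ.arr aBudget 0 = σ.reg 2 ∧ ∀ a, a ∉ [aNum, aBound, aBudget] → τ.arr a = σ.arr a := by
  refine ⟨_, _, .seq (.const ..) (.seq (.store ..) (.seq (.store ..) (.seq (.store ..)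
    (.seq (.const ..) (.seq (.add ..) (.seq (.add ..) (.seq (.add ..) (.const ..)))))))), le_rfl,
    ?_, ?_, ?_, ?_, ?_, fun a ha => ?_⟩
  · simp [State.setReg]
  · simp [State.setReg, State.setArr]
    ring
  · simp [State.setReg, State.setArr]
  · simp [State.setReg, State.setArr]
  · simp [State.setReg, State.setArr]
  · simp only [List.mem_cons, List.not_mem_nil, or_false, not_or] at ha
    simp [State.setReg, State.setArr, ha]

theorem exec_program {σ : State} (hE : ∀ x y, E x y → x < n ∧ y < n) (hT : ∀ t ∈ T, t < n)
    (h0 : σ.reg 0 = n) (h1 : σ.reg 1 = r) (h2 : σ.reg 2 = s)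
    (hterm : ∀ v, σ.arr aTerm v = if v ∈ T then 1 else 0)
    (hadj : ∀ u < n, ∀ v < n, σ.arr aAdj (u * n + v) ≠ 0 ↔ E u v)
    (hzero : ∀ a, a ∉ [aTerm, aAdj] → ∀ i, σ.arr a i = 0) :
    ∃ t τ, Exec program σ t τ ∧
      t ≤ (T.card + 1) ^ (3 * T.card) *
        ((Stmt.seq setUp (.seq testAdvice finish)).cost (4 * n + 4) + 17) ∧
      ((τ.reg 0 ≠ 0 ∧ ∃ Z : Finset ℕ, (∀ v, v ∈ Z ↔ v < n ∧ τ.arr aTerm v ≠ 0) ∧ Z.card ≤ s ∧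
        Balanced E T r Z) ∨
      (τ.reg 0 = 0 ∧ ∀ Z : Finset ℕ, (∀ v ∈ Z, v < n) → Balanced E T r Z → s < Z.card)) := by
  obtain ⟨t₁, σ₁, he₁, ht₁, hone, htwo, hnum, hbound, hbudget, hfr⟩ := exec_preamble (σ := σ)
  rw [h0] at htwo hnum
  rw [h1] at hbound
  rw [h2] at hbudget
  obtain ⟨t₂, σ₂, he₂, ht₂, harr₂, hone₂, htwo₂⟩ := exec_compile_nil setUp hone htwo
  obtain ⟨σ₃, he₃, harr₃, hz₃, hone₃, htwo₃⟩ := exec_loadFlag aRun σ₂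
  rw [hone₂] at hone₃
  rw [htwo₂] at htwo₃
  have hset := run_setUp (env := []) (N := 4 * n + 4) (st := σ₁.arr) (E := E) (by omega)
    (by rwa [hfr aTerm (by decide)]) hT (by rwa [hfr aAdj (by decide)]) hnum hbound hbudget
    fun a ha i => by
      simp only [List.mem_cons, List.not_mem_nil, or_false, not_or] at ha
      rw [hfr a (by simp [ha]), hzero a (by simp [ha])]
  rw [← harr₂, ← harr₃] at hset
  rw [← harr₃] at hz₃
  obtain ⟨hctx, hadv, hset⟩ := hset
  have hpos : 0 < (T.card + 1) ^ (3 * T.card) := by positivity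
  have hloop : ∃ t τ, Exec searchLoop σ₃ t τ ∧
      t ≤ (T.card + 1) ^ (3 * T.card) * (testAdvice.cost (4 * n + 4) + 3) + 1 ∧
      τ.reg 1 = 1 ∧ τ.reg 2 = 4 * n + 4 ∧
      ((τ.arr aAns 0 ≠ 0 ∧ (deleted n τ.arr).card ≤ s ∧ Balanced E T r (deleted n τ.arr)) ∨
        (τ.arr aAns 0 = 0 ∧
          ∀ Z : Finset ℕ, (∀ v ∈ Z, v < n) → Balanced E T r Z → s < Z.card)) := by
    obtain ⟨hcard, hrun, hans, hdel⟩ | ⟨hcard, hrun, hans⟩ := hset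
    · refine ⟨1, σ₃, .loopFalse (hz₃.trans hrun), by omega, hone₃, htwo₃, .inl ⟨hans, ?_, ?_⟩⟩
      · rwa [hdel]
      -- No terminal survives, so balance is vacuous.
      · rw [hdel]
        exact fun t ht ht' => absurd ht ht'
    · obtain ⟨t, τ, he, ht, h1', h2', h⟩ := exec_searchLoop (by omega) hE _ 0 σ₃ (Nat.zero_add _) hpos
        hctx hadv (by rwa [hz₃]) hrun hans hone₃ htwo₃
      refine ⟨t, τ, he, ht, h1', h2', h.imp_right fun ⟨ha, hno⟩ => ⟨ha, fun Z hZ hbal => ?_⟩⟩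
      by_contra hle
      obtain ⟨m, hm, hgood⟩ := exists_goodAdvice (N := 4 * n + 4) (by omega) hE hT hcard hZ
        (not_lt.1 hle) hbal
      exact hno m m.zero_le hm hgood
  obtain ⟨t₄, σ₄, he₄, ht₄, hone₄, htwo₄, hres⟩ := hloop
  obtain ⟨t₅, σ₅, he₅, ht₅, harr₅, hone₅, htwo₅⟩ := exec_compile_nil finish hone₄ htwo₄
  obtain ⟨σ₆, he₆, harr₆, hz₆, -, -⟩ := exec_loadFlag aAns σ₅
  rw [harr₅, Stmt.run_of_notMem_writes _ _ (by decide)] at hz₆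
  refine ⟨_, σ₆, .seq he₁ (.seq he₂ (.seq he₃ (.seq he₄ (.seq he₅ he₆)))), ?_, ?_⟩
  · simp only [Stmt.cost]
    -- Besides the compiled statements, `14` steps occur outside the iterations and `3` in each of
    -- them; together they give `17`.
    have := Nat.le_mul_of_pos_left (setUp.cost (4 * n + 4) + finish.cost (4 * n + 4) + 14) hpos
    nlinarith
  · refine hres.imp (fun ⟨ha, hcard, hbal⟩ => ⟨by rwa [hz₆], _, fun v => ?_, hcard, hbal⟩)
      fun ⟨ha, hno⟩ => ⟨hz₆.trans ha, hno⟩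
    refine ⟨fun hv => ?_, fun ⟨hv, hv'⟩ => ?_⟩
    · have hvn : v < n := Finset.mem_range.1 (Finset.mem_filter.1 hv).1
      refine ⟨hvn, ?_⟩
      rw [harr₆, harr₅, finish, run_forN_store (by decide) (by omega)]
      exact (mem_deleted hvn).1 hv
    · rw [harr₆, harr₅, finish, run_forN_store (by decide) (by omega)] at hv'
      exact (mem_deleted hv).2 hv'

end SeparatorProgram

/-! ### The main theorem -/
namespace BalancedSeparator

variable {n : ℕ} (D : MultiDigraph (Fin n)) (T : Finset (Fin n)) (r s : ℕ)

theorem input_terminal (v : ℕ) :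
    (input D T r s).arr 0 v = if v ∈ T.map Fin.valEmbedding then 1 else 0 := by
  simp [input]

theorem input_adj {u v : ℕ} (hv : v < n) :
    (input D T r s).arr 1 (u * n + v) ≠ 0 ↔ D.adj u v := by
  simp only [input, one_ne_zero, if_false, if_true, ne_eq, Finset.sum_eq_zero_iff, Finset.mem_univ,
    true_implies, not_forall, MultiDigraph.adj]
  refine exists_congr fun u' => exists_congr fun v' => ?_
  rw [ite_eq_right_iff, Classical.not_imp, ← and_assoc, BoundedLoop.mul_add_inj v'.2 hv, Nat.pos_iff_ne_zero]

/-- For `k ≥ 2` use `k + 1 ≤ k ^ 2`. The factor `8` is for `k = 1`, where `k * log k` vanishes but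
the left side is `8`. -/
theorem pow_le_two_rpow (k : ℕ) :
    (((k + 1) ^ (3 * k) : ℕ) : ℝ) ≤ 8 * (2 : ℝ) ^ ((6 : ℕ) * ((k : ℝ) * Real.logb 2 k)) := by
  rcases Nat.lt_or_ge k 2 with hk | hk
  · interval_cases k <;> norm_num
  · have hk0 : (0 : ℝ) < k := by positivity
    have h : (2 : ℝ) ^ ((6 : ℕ) * ((k : ℝ) * Real.logb 2 k)) = (k : ℝ) ^ (6 * k) := by
      rw [show ((6 : ℕ) : ℝ) * ((k : ℝ) * Real.logb 2 k) = Real.logb 2 k * ((6 * k : ℕ) : ℝ) by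
        push_cast; ring, Real.rpow_mul (by norm_num), Real.rpow_natCast,
        Real.rpow_logb (by norm_num) (by norm_num) hk0]
    have h' : (k + 1) ^ (3 * k) ≤ k ^ (6 * k) := by
      rw [show 6 * k = 2 * (3 * k) by ring, pow_mul k 2]
      exact Nat.pow_le_pow_left (by nlinarith) _
    have h'' : (((k + 1) ^ (3 * k) : ℕ) : ℝ) ≤ (k : ℝ) ^ (6 * k) := by exact_mod_cast h'
    rw [h]
    linarith [pow_pos hk0 (6 * k)]

end BalancedSeparator

theorem mainTheorem3 :
    ∃ (p : RAM.Program) (a b c : ℕ),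
      ∀ (n : ℕ) (D : MultiDigraph (Fin n)) (T : Finset (Fin n)) (r s : ℕ),
        ∃ (t : ℕ) (σ : RAM.State),
          RAM.Exec p (BalancedSeparator.input D T r s) t σ ∧
          BalancedSeparator.IsCorrectAnswer D T r s (BalancedSeparator.output n σ) ∧
          (t : ℝ) ≤ (a : ℝ) * (2 : ℝ) ^ ((b : ℝ) * ((T.card : ℝ) * Real.logb 2 (T.card : ℝ))) *
            ((n : ℝ) + 1) ^ c := by
  obtain ⟨a, c, hcost⟩ := BoundedLoop.Stmt.exists_cost_le
    (.seq SeparatorProgram.setUp (.seq SeparatorProgram.testAdvice SeparatorProgram.finish))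
  -- The constants `8` and `6` come from `pow_le_two_rpow`, and `5 ^ c` from `4 * n + 5 ≤ 5 * (n +
  -- 1)`.
  refine ⟨SeparatorProgram.program, 8 * ((a + 17) * 5 ^ c), 6, c, fun n D T r s => ?_⟩
  obtain ⟨t, σ, he, ht, hres⟩ := SeparatorProgram.exec_program (n := n) (r := r) (s := s)
    (E := D.adj) (T := T.map Fin.valEmbedding) (σ := BalancedSeparator.input D T r s)
    (fun x y ⟨u, v, hu, hv, _⟩ => ⟨hu ▸ u.2, hv ▸ v.2⟩)
    (fun t ht => by obtain ⟨u, -, rfl⟩ := Finset.mem_map.1 ht; exact u.2) rfl rfl rfl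
    (BalancedSeparator.input_terminal D T r s)
    (fun _ _ _ hv => BalancedSeparator.input_adj D T r s hv)
    (fun a ha i => by
      simp only [List.mem_cons, List.not_mem_nil, or_false, not_or] at ha
      simp [BalancedSeparator.input, ha])
  refine ⟨t, σ, he, ?_, ?_⟩
  · obtain ⟨h0, Z, hZ, hcard, hbal⟩ | ⟨h0, hno⟩ := hres
    · have hout : Z = (Finset.univ.filter fun v : Fin n => σ.arr 0 v ≠ 0).map Fin.valEmbedding := by
        ext v
        simp only [hZ, Finset.mem_map, Finset.mem_filter, Finset.mem_univ, true_and,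
          Fin.valEmbedding_apply]
        exact ⟨fun ⟨h, h'⟩ => ⟨⟨v, h⟩, h', rfl⟩, fun ⟨u, hu, huv⟩ => huv ▸ ⟨u.2, hu⟩⟩
      rw [BalancedSeparator.output, if_neg h0]
      rw [hout] at hcard hbal
      exact ⟨MultiDigraph.isBalancedSeparator_iff.2 hbal, by rwa [Finset.card_map] at hcard⟩
    · rw [BalancedSeparator.output, if_pos h0]
      rintro ⟨Z, hbal, hcard⟩
      have := hno _ (fun v hv => by obtain ⟨u, -, rfl⟩ := Finset.mem_map.1 hv; exact u.2)
        (MultiDigraph.isBalancedSeparator_iff.1 hbal)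
      rw [Finset.card_map] at this
      omega
  · rw [Finset.card_map] at ht
    have hpoly : (BoundedLoop.Stmt.seq SeparatorProgram.setUp
        (.seq SeparatorProgram.testAdvice SeparatorProgram.finish)).cost (4 * n + 4) + 17 ≤
          (a + 17) * 5 ^ c * (n + 1) ^ c := by
      have h1 := hcost (4 * n + 4)
      have h2 : (4 * n + 4 + 1) ^ c ≤ 5 ^ c * (n + 1) ^ c := by
        rw [← mul_pow]
        exact Nat.pow_le_pow_left (by omega) c
      have h3 : 1 ≤ 5 ^ c * (n + 1) ^ c := Nat.one_le_iff_ne_zero.2 (by positivity)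
      nlinarith [Nat.mul_le_mul_left a h2]
    have h4 : (t : ℝ) ≤ (((T.card + 1) ^ (3 * T.card) : ℕ) : ℝ) *
        (((a + 17) * 5 ^ c * (n + 1) ^ c : ℕ) : ℝ) := by
      exact_mod_cast ht.trans (Nat.mul_le_mul_left _ hpoly)
    calc (t : ℝ) ≤ _ := h4
      _ ≤ _ := mul_le_mul_of_nonneg_right (BalancedSeparator.pow_le_two_rpow T.card)
        (Nat.cast_nonneg _)
      _ = _ := by push_cast; ring
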